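/- Let $(M_1,\nabla_1)$ and $(M_2,\nabla_2)$ be connected, paracompact, Hausdorff, finite-dimensional smooth ($C^\infty$) manifolds without boundary, each with a smooth linear connection (torsion is allowed). Let $\nabla_1\times\nabla_2$ be the product connection on $M_1\times M_2$: under $T(M_1\times M_2)=TM_1\oplus TM_2$, for $\sigma=(\sigma_1,\sigma_2)$ and $u=(u_1,u_2)$ at $(x_1,x_2)$, the first component of $(\nabla_1\times\nabla_2)_u\sigma$ is $(\nabla_1)_{u_1}(\sigma_1(\cdot,x_2))$ plus the derivative along $u_2$ of $\sigma_1(x_1,\cdot):M_2\to T_{x_1}M_1$, and symmetrically for the second. For a manifold with linear connection $(M,\nabla)$ let $T'M$ be $TM$ less the zero section, let $PM$ be the quotient of $T'M$ which identifies proportional vectors at each point, and let the space of geodesics $G(M)$ be the quotient of $PM$ (with the quotient topology) which identifies two tangent lines if they are tangent to a common inextendible nonconstant geodesic. Call $G(M)$ locally Euclidean if it is connected (the empty space is allowed) and its quotient topology underlies a smooth, not necessarily Hausdorff, manifold, locally modelled on some $\mathbb R^m$, for which the natural projection $PM\to G(M)$ (equivalently $T'M\to G(M)$) is a smooth submersion.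 **Theorem.** If $G(M_1\times M_2)$, formed with $\nabla_1\times\nabla_2$, is locally Euclidean, then so are $G(M_1)$ and $G(M_2)$. If moreover $G(M_1\times M_2)$ is paracompact (every open cover has a locally finite open refinement), then so are $G(M_1)$ and $G(M_2)$. -/

import Mathlib

open Set Bundle
open scoped Manifold ContDiff Topology

set_option linter.unusedSectionVars false

noncomputable section

section OneManifold

variable {E : Type*} [NormedAddCommGroup E] [NormedSpace ℝ E]
  {H : Type*} [TopologicalSpace H] (I : ModelWithCorners ℝ E H)
  (M : Type*) [TopologicalSpace M] [ChartedSpace H M] [IsManifold I ∞ M]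

/-- A *linear connection* on `M`: a Koszul connection (covariant derivative) on the tangent
bundle. Its smoothness is the separate class `ContMDiffCovariantDerivative`. -/
abbrev LinearConnection :=
  CovariantDerivative I E (fun x : M ↦ TangentSpace I x)

/-- The set of nonzero tangent vectors is open. -/
theorem isOpen_nonzero_tangent : IsOpen {v : TangentBundle I M | v.2 ≠ 0} := by
  rw [isOpen_iff_mem_nhds]
  intro v hv
  set e := trivializationAt E (TangentSpace I : M → Type _) v.proj with he
  have hvs : v ∈ e.source := FiberBundle.mem_trivializationAt_proj_source
  have hpre : IsOpen (e.source ∩ e ⁻¹' {p | p.2 ≠ 0}) :=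
    e.continuousOn.isOpen_inter_preimage e.open_source
      (isOpen_ne_fun continuous_snd continuous_const)
  have key : ∀ w ∈ e.source, ((e w).2 ≠ 0 ↔ w.2 ≠ 0) := by
    intro w hw
    have hb : w.proj ∈ e.baseSet := e.mem_source.1 hw
    have h1 : (e w).2 = e.continuousLinearEquivAt ℝ w.proj hb w.2 := rfl
    rw [h1]
    exact (e.continuousLinearEquivAt ℝ w.proj hb).map_ne_zero_iff
  refine Filter.mem_of_superset (hpre.mem_nhds ⟨hvs, (key v hvs).2 hv⟩) ?_
  exact fun w hw ↦ (key w hw.1).1 hw.2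

/-- The reduced tangent bundle `T'M`: the tangent bundle less the zero section, as an open
submanifold of `TM`. -/
def ReducedTangentBundle : TopologicalSpace.Opens (TangentBundle I M) :=
  ⟨{v | v.2 ≠ 0}, isOpen_nonzero_tangent I M⟩

variable {I M}

/-- Two nonzero tangent vectors are proportional: they have the same base point and differ by a
nonzero scalar. -/
def Proportional (v w : ReducedTangentBundle I M) : Prop :=
  ∃ c : ℝ, c ≠ 0 ∧ w.1 = ⟨v.1.proj, c • v.1.2⟩

variable (I M) in
/-- The space `PM` of tangent lines, with the quotient topology of `T'M`. -/
def TangentLines : Type _ := Quot (Proportional (I := I) (M := M))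

instance : TopologicalSpace (TangentLines I M) :=
  inferInstanceAs (TopologicalSpace (Quot (Proportional (I := I) (M := M))))

/-- The Christoffel symbols of a connection in the preferred chart at `q`: for coordinate vectors
`u` and `v`, this is the coordinate expression at `x` of `∇_U V`, where `U` and `V` are the vector
fields which have constant components `u` and `v` in the chart. -/
def LinearConnection.christoffel (cov : LinearConnection I M) (q x : M) (u v : E) : E :=
  (trivializationAt E (TangentSpace I : M → Type _) q).continuousLinearMapAt ℝ x
    (cov (fun y ↦ (trivializationAt E (TangentSpace I : M → Type _) q).symmL ℝ y v) x
      ((trivializationAt E (TangentSpace I : M → Type _) q).symmL ℝ x u))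

variable (I) in
/-- The velocity vector of a curve. -/
def curveVelocity (γ : ℝ → M) (t : ℝ) : TangentSpace I (γ t) :=
  mfderiv 𝓘(ℝ, ℝ) I γ t (1 : ℝ)

/-- `γ` restricted to the open interval `J` is an affinely parametrized geodesic: it is `C²` on
`J`, and in every chart `x` of the manifold it solves `x'' + Γ(x)(x', x') = 0`. The values
of `γ` outside `J` are irrelevant. -/
structure LinearConnection.IsGeodesicOn (cov : LinearConnection I M) (γ : ℝ → M) (J : Set ℝ) :
    Prop where
  isOpen : IsOpen J
  ordConnected : J.OrdConnected
  contMDiffOn : ContMDiffOn 𝓘(ℝ, ℝ) I 2 γ J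
  equation : ∀ q : M, ∀ t ∈ J, γ t ∈ (chartAt H q).source →
    deriv (deriv (extChartAt I q ∘ γ)) t +
      cov.christoffel q (γ t) (deriv (extChartAt I q ∘ γ) t) (deriv (extChartAt I q ∘ γ) t) = 0

/-- Two tangent lines are tangent to a common geodesic. Since each geodesic extends to an
inextendible one, it makes no difference whether the geodesic is asked to be inextendible. -/
def LinearConnection.OnCommonGeodesic (cov : LinearConnection I M) (p q : TangentLines I M) :
    Prop :=
  ∃ (γ : ℝ → M) (J : Set ℝ), cov.IsGeodesicOn γ J ∧
    ∃ s ∈ J, ∃ t ∈ J, ∃ (hs : curveVelocity I γ s ≠ 0) (ht : curveVelocity I γ t ≠ 0),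
      p = Quot.mk _ ⟨⟨γ s, curveVelocity I γ s⟩, hs⟩ ∧
      q = Quot.mk _ ⟨⟨γ t, curveVelocity I γ t⟩, ht⟩

/-- The space `G(M)` of (unoriented) geodesics: the quotient of `PM` which identifies tangent lines
that lie on the lift of a common geodesic, with the quotient topology. -/
def LinearConnection.GeodesicSpace (cov : LinearConnection I M) : Type _ :=
  Quot cov.OnCommonGeodesic

instance (cov : LinearConnection I M) : TopologicalSpace cov.GeodesicSpace :=
  inferInstanceAs (TopologicalSpace (Quot cov.OnCommonGeodesic))

/-- The natural projection `T'M → PM → G(M)`. -/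
def LinearConnection.toGeodesic (cov : LinearConnection I M) (v : ReducedTangentBundle I M) :
    cov.GeodesicSpace :=
  Quot.mk _ (Quot.mk _ v)

/-- `G(M)` is *locally Euclidean*: it is connected and its quotient topology underlies a
smooth, not necessarily Hausdorff, manifold of some dimension `m` which is the
quotient manifold, i.e. the natural projection is a smooth submersion. Since `T'M → PM` is a
surjective submersion, this is the same for the projections from `T'M` and from `PM`. -/
def LinearConnection.GeodesicSpaceLocallyEuclidean (cov : LinearConnection I M) : Prop :=
  PreconnectedSpace cov.GeodesicSpace ∧
  ∃ (m : ℕ) (_ : ChartedSpace (EuclideanSpace ℝ (Fin m)) cov.GeodesicSpace),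
    IsManifold (𝓡 m) ∞ cov.GeodesicSpace ∧
    Manifold.IsSubmersion I.tangent (𝓡 m) ∞ cov.toGeodesic

end OneManifold

section Product

variable {E₁ : Type*} [NormedAddCommGroup E₁] [NormedSpace ℝ E₁]
  {H₁ : Type*} [TopologicalSpace H₁] {I₁ : ModelWithCorners ℝ E₁ H₁}
  {M₁ : Type*} [TopologicalSpace M₁] [ChartedSpace H₁ M₁] [IsManifold I₁ ∞ M₁]
  {E₂ : Type*} [NormedAddCommGroup E₂] [NormedSpace ℝ E₂]
  {H₂ : Type*} [TopologicalSpace H₂] {I₂ : ModelWithCorners ℝ E₂ H₂}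
  {M₂ : Type*} [TopologicalSpace M₂] [ChartedSpace H₂ M₂] [IsManifold I₂ ∞ M₂]

/-- The first component of a tangent vector under `T(M₁ × M₂) = TM₁ ⊕ TM₂`. -/
def tangentFst (I₁ : ModelWithCorners ℝ E₁ H₁) (I₂ : ModelWithCorners ℝ E₂ H₂) (x : M₁ × M₂) :
    TangentSpace (I₁.prod I₂) x →L[ℝ] TangentSpace I₁ x.1 :=
  ContinuousLinearMap.fst ℝ (TangentSpace I₁ x.1) (TangentSpace I₂ x.2)

/-- The second component of a tangent vector under `T(M₁ × M₂) = TM₁ ⊕ TM₂`. -/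
def tangentSnd (I₁ : ModelWithCorners ℝ E₁ H₁) (I₂ : ModelWithCorners ℝ E₂ H₂) (x : M₁ × M₂) :
    TangentSpace (I₁.prod I₂) x →L[ℝ] TangentSpace I₂ x.2 :=
  ContinuousLinearMap.snd ℝ (TangentSpace I₁ x.1) (TangentSpace I₂ x.2)

/-- The vector field `σ₁(·, x₂)` on `M₁`, for a vector field `σ = (σ₁, σ₂)` on `M₁ × M₂`. -/
def sliceFst (σ : Π x : M₁ × M₂, TangentSpace (I₁.prod I₂) x) (x₂ : M₂) (y₁ : M₁) :
    TangentSpace I₁ y₁ :=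
  tangentFst I₁ I₂ (y₁, x₂) (σ (y₁, x₂))

/-- The vector field `σ₂(x₁, ·)` on `M₂`, for a vector field `σ = (σ₁, σ₂)` on `M₁ × M₂`. -/
def sliceSnd (σ : Π x : M₁ × M₂, TangentSpace (I₁.prod I₂) x) (x₁ : M₁) (y₂ : M₂) :
    TangentSpace I₂ y₂ :=
  tangentSnd I₁ I₂ (x₁, y₂) (σ (x₁, y₂))

/-- The derivative at `x₂` of the map `σ₁(x₁, ·)` from `M₂` to the fixed vector space
`T_{x₁} M₁`. -/
def crossFst (σ : Π x : M₁ × M₂, TangentSpace (I₁.prod I₂) x) (x : M₁ × M₂) :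
    TangentSpace I₂ x.2 →L[ℝ] TangentSpace I₁ x.1 :=
  mvfderiv I₂ (F := E₁) (fun y₂ ↦ tangentFst I₁ I₂ (x.1, y₂) (σ (x.1, y₂))) x.2

/-- The derivative at `x₁` of the map `σ₂(·, x₂)` from `M₁` to the fixed vector space
`T_{x₂} M₂`. -/
def crossSnd (σ : Π x : M₁ × M₂, TangentSpace (I₁.prod I₂) x) (x : M₁ × M₂) :
    TangentSpace I₁ x.1 →L[ℝ] TangentSpace I₂ x.2 :=
  mvfderiv I₁ (F := E₂) (fun y₁ ↦ tangentSnd I₁ I₂ (y₁, x.2) (σ (y₁, x.2))) x.1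

/-- The product of two connections as a map on vector fields. For a vector field `σ = (σ₁, σ₂)`
and a vector `u = (u₁, u₂)` at `(x₁, x₂)`, the first component of `∇_u σ` is the `∇₁`-derivative
along `u₁` of the vector field `σ₁(·, x₂)` on `M₁` plus the derivative along `u₂` of the map
`σ₁(x₁, ·)` from `M₂` to the fixed vector space `T_{x₁} M₁`; symmetrically for the second. -/
def LinearConnection.prodFun (cov₁ : LinearConnection I₁ M₁) (cov₂ : LinearConnection I₂ M₂)
    (σ : Π x : M₁ × M₂, TangentSpace (I₁.prod I₂) x) (x : M₁ × M₂) :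
    TangentSpace (I₁.prod I₂) x →L[ℝ] TangentSpace (I₁.prod I₂) x :=
  ContinuousLinearMap.prod
    (cov₁ (sliceFst σ x.2) x.1 ∘L tangentFst I₁ I₂ x + crossFst σ x ∘L tangentSnd I₁ I₂ x)
    (cov₂ (sliceSnd σ x.1) x.2 ∘L tangentSnd I₁ I₂ x + crossSnd σ x ∘L tangentFst I₁ I₂ x)

/-- A curve in the total space of a tangent bundle lying in one fiber is differentiable as a curve
in that fiber. -/
theorem mdifferentiableAt_fiber {x₁ : M₁} {f : M₂ → E₁} {x₂ : M₂}
    (hf : MDifferentiableAt I₂ I₁.tangent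
      (fun y ↦ (⟨x₁, f y⟩ : TangentBundle I₁ M₁)) x₂) :
    MDifferentiableAt I₂ 𝓘(ℝ, E₁) f x₂ := by
  have h := ((mdifferentiableAt_totalSpace I₁
    (fun y ↦ (⟨x₁, f y⟩ : TangentBundle I₁ M₁))).1 hf).2
  refine h.congr_of_eventuallyEq (Filter.Eventually.of_forall fun y ↦ ?_)
  exact ((tangentBundleCore I₁ M₁).coordChange_self (achart H₁ x₁) x₁
    (mem_chart_source H₁ x₁) (f y)).symm

section

variable {σ : Π x : M₁ × M₂, TangentSpace (I₁.prod I₂) x} {x : M₁ × M₂}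

theorem mdifferentiableAt_tangentFst
    (hσ : MDifferentiableAt (I₁.prod I₂) (I₁.prod I₂).tangent
      (fun y ↦ (⟨y, σ y⟩ : TangentBundle (I₁.prod I₂) (M₁ × M₂))) x) :
    MDifferentiableAt (I₁.prod I₂) I₁.tangent
      (fun y ↦ (⟨y.1, tangentFst I₁ I₂ y (σ y)⟩ : TangentBundle I₁ M₁)) x :=
  MDifferentiableAt.comp x
    (((contMDiff_equivTangentBundleProd (n := 1) (I := I₁) (I' := I₂) (M := M₁)
      (M' := M₂)).mdifferentiable one_ne_zero).mdifferentiableAt.fst) hσ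

theorem mdifferentiableAt_tangentSnd
    (hσ : MDifferentiableAt (I₁.prod I₂) (I₁.prod I₂).tangent
      (fun y ↦ (⟨y, σ y⟩ : TangentBundle (I₁.prod I₂) (M₁ × M₂))) x) :
    MDifferentiableAt (I₁.prod I₂) I₂.tangent
      (fun y ↦ (⟨y.2, tangentSnd I₁ I₂ y (σ y)⟩ : TangentBundle I₂ M₂)) x :=
  MDifferentiableAt.comp x
    (((contMDiff_equivTangentBundleProd (n := 1) (I := I₁) (I' := I₂) (M := M₁)
      (M' := M₂)).mdifferentiable one_ne_zero).mdifferentiableAt.snd) hσ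

theorem mdifferentiableAt_mk_left : MDifferentiableAt I₁ (I₁.prod I₂)
    (fun y₁ : M₁ ↦ (y₁, x.2)) x.1 :=
  mdifferentiableAt_id.prodMk mdifferentiableAt_const

theorem mdifferentiableAt_mk_right : MDifferentiableAt I₂ (I₁.prod I₂)
    (fun y₂ : M₂ ↦ (x.1, y₂)) x.2 :=
  mdifferentiableAt_const.prodMk mdifferentiableAt_id

theorem mdifferentiableAt_sliceFst
    (hσ : MDifferentiableAt (I₁.prod I₂) (I₁.prod I₂).tangent
      (fun y ↦ (⟨y, σ y⟩ : TangentBundle (I₁.prod I₂) (M₁ × M₂))) x) :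
    MDifferentiableAt I₁ I₁.tangent
      (fun y ↦ (⟨y, sliceFst σ x.2 y⟩ : TangentBundle I₁ M₁)) x.1 :=
  MDifferentiableAt.comp (x := x.1) (f := fun y₁ ↦ (y₁, x.2))
    (mdifferentiableAt_tangentFst hσ) mdifferentiableAt_mk_left

theorem mdifferentiableAt_sliceSnd
    (hσ : MDifferentiableAt (I₁.prod I₂) (I₁.prod I₂).tangent
      (fun y ↦ (⟨y, σ y⟩ : TangentBundle (I₁.prod I₂) (M₁ × M₂))) x) :
    MDifferentiableAt I₂ I₂.tangent
      (fun y ↦ (⟨y, sliceSnd σ x.1 y⟩ : TangentBundle I₂ M₂)) x.2 :=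
  MDifferentiableAt.comp (x := x.2) (f := fun y₂ ↦ (x.1, y₂))
    (mdifferentiableAt_tangentSnd hσ) mdifferentiableAt_mk_right

theorem mdifferentiableAt_crossFst
    (hσ : MDifferentiableAt (I₁.prod I₂) (I₁.prod I₂).tangent
      (fun y ↦ (⟨y, σ y⟩ : TangentBundle (I₁.prod I₂) (M₁ × M₂))) x) :
    MDifferentiableAt I₂ 𝓘(ℝ, E₁)
      (fun y₂ ↦ (tangentFst I₁ I₂ (x.1, y₂) (σ (x.1, y₂)) : E₁)) x.2 :=
  mdifferentiableAt_fiber (x₁ := x.1)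
    (MDifferentiableAt.comp (x := x.2) (f := fun y₂ ↦ (x.1, y₂))
      (mdifferentiableAt_tangentFst hσ) mdifferentiableAt_mk_right)

theorem mdifferentiableAt_crossSnd
    (hσ : MDifferentiableAt (I₁.prod I₂) (I₁.prod I₂).tangent
      (fun y ↦ (⟨y, σ y⟩ : TangentBundle (I₁.prod I₂) (M₁ × M₂))) x) :
    MDifferentiableAt I₁ 𝓘(ℝ, E₂)
      (fun y₁ ↦ (tangentSnd I₁ I₂ (y₁, x.2) (σ (y₁, x.2)) : E₂)) x.1 :=
  mdifferentiableAt_fiber (x₁ := x.2)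
    (MDifferentiableAt.comp (x := x.1) (f := fun y₁ ↦ (y₁, x.2))
      (mdifferentiableAt_tangentSnd hσ) mdifferentiableAt_mk_left)

theorem crossFst_add {σ' : Π x : M₁ × M₂, TangentSpace (I₁.prod I₂) x}
    (hσ : MDifferentiableAt (I₁.prod I₂) (I₁.prod I₂).tangent
      (fun y ↦ (⟨y, σ y⟩ : TangentBundle (I₁.prod I₂) (M₁ × M₂))) x)
    (hσ' : MDifferentiableAt (I₁.prod I₂) (I₁.prod I₂).tangent
      (fun y ↦ (⟨y, σ' y⟩ : TangentBundle (I₁.prod I₂) (M₁ × M₂))) x) :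
    crossFst (σ + σ') x = crossFst σ x + crossFst σ' x :=
  mvfderiv_add (mdifferentiableAt_crossFst hσ) (mdifferentiableAt_crossFst hσ')

theorem crossSnd_add {σ' : Π x : M₁ × M₂, TangentSpace (I₁.prod I₂) x}
    (hσ : MDifferentiableAt (I₁.prod I₂) (I₁.prod I₂).tangent
      (fun y ↦ (⟨y, σ y⟩ : TangentBundle (I₁.prod I₂) (M₁ × M₂))) x)
    (hσ' : MDifferentiableAt (I₁.prod I₂) (I₁.prod I₂).tangent
      (fun y ↦ (⟨y, σ' y⟩ : TangentBundle (I₁.prod I₂) (M₁ × M₂))) x) :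
    crossSnd (σ + σ') x = crossSnd σ x + crossSnd σ' x :=
  mvfderiv_add (mdifferentiableAt_crossSnd hσ) (mdifferentiableAt_crossSnd hσ')

theorem crossFst_smul {g : M₁ × M₂ → ℝ}
    (hσ : MDifferentiableAt (I₁.prod I₂) (I₁.prod I₂).tangent
      (fun y ↦ (⟨y, σ y⟩ : TangentBundle (I₁.prod I₂) (M₁ × M₂))) x)
    (hg : MDifferentiableAt (I₁.prod I₂) 𝓘(ℝ, ℝ) g x) :
    crossFst (g • σ) x = g x • crossFst σ x +
      (mvfderiv I₂ (fun y₂ ↦ g (x.1, y₂)) x.2).smulRight (tangentFst I₁ I₂ x (σ x)) :=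
  mvfderiv_smul
    (MDifferentiableAt.comp (x := x.2) (f := fun y₂ ↦ (x.1, y₂)) hg mdifferentiableAt_mk_right)
    (mdifferentiableAt_crossFst hσ)

theorem crossSnd_smul {g : M₁ × M₂ → ℝ}
    (hσ : MDifferentiableAt (I₁.prod I₂) (I₁.prod I₂).tangent
      (fun y ↦ (⟨y, σ y⟩ : TangentBundle (I₁.prod I₂) (M₁ × M₂))) x)
    (hg : MDifferentiableAt (I₁.prod I₂) 𝓘(ℝ, ℝ) g x) :
    crossSnd (g • σ) x = g x • crossSnd σ x +
      (mvfderiv I₁ (fun y₁ ↦ g (y₁, x.2)) x.1).smulRight (tangentSnd I₁ I₂ x (σ x)) :=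
  mvfderiv_smul
    (MDifferentiableAt.comp (x := x.1) (f := fun y₁ ↦ (y₁, x.2)) hg mdifferentiableAt_mk_left)
    (mdifferentiableAt_crossSnd hσ)

theorem mvfderiv_prod_split {g : M₁ × M₂ → ℝ}
    (hg : MDifferentiableAt (I₁.prod I₂) 𝓘(ℝ, ℝ) g x) (u : TangentSpace (I₁.prod I₂) x) :
    mvfderiv (I₁.prod I₂) g x u =
      mvfderiv I₁ (fun y₁ ↦ g (y₁, x.2)) x.1 (tangentFst I₁ I₂ x u) +
      mvfderiv I₂ (fun y₂ ↦ g (x.1, y₂)) x.2 (tangentSnd I₁ I₂ x u) :=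
  mfderiv_prod_eq_add_apply hg

theorem sliceFst_leibniz (cov₁ : LinearConnection I₁ M₁) {g : M₁ × M₂ → ℝ}
    (hσ : MDifferentiableAt (I₁.prod I₂) (I₁.prod I₂).tangent
      (fun y ↦ (⟨y, σ y⟩ : TangentBundle (I₁.prod I₂) (M₁ × M₂))) x)
    (hg : MDifferentiableAt (I₁.prod I₂) 𝓘(ℝ, ℝ) g x) :
    cov₁ (sliceFst (g • σ) x.2) x.1 = g x • cov₁ (sliceFst σ x.2) x.1 +
      (mvfderiv I₁ (fun y₁ ↦ g (y₁, x.2)) x.1).smulRight (tangentFst I₁ I₂ x (σ x)) :=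
  cov₁.isCovariantDerivativeOnUniv.leibniz (g := fun y₁ ↦ g (y₁, x.2))
    (mdifferentiableAt_sliceFst hσ)
    (MDifferentiableAt.comp (x := x.1) (f := fun y₁ ↦ (y₁, x.2)) hg mdifferentiableAt_mk_left)

theorem sliceSnd_leibniz (cov₂ : LinearConnection I₂ M₂) {g : M₁ × M₂ → ℝ}
    (hσ : MDifferentiableAt (I₁.prod I₂) (I₁.prod I₂).tangent
      (fun y ↦ (⟨y, σ y⟩ : TangentBundle (I₁.prod I₂) (M₁ × M₂))) x)
    (hg : MDifferentiableAt (I₁.prod I₂) 𝓘(ℝ, ℝ) g x) :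
    cov₂ (sliceSnd (g • σ) x.1) x.2 = g x • cov₂ (sliceSnd σ x.1) x.2 +
      (mvfderiv I₂ (fun y₂ ↦ g (x.1, y₂)) x.2).smulRight (tangentSnd I₁ I₂ x (σ x)) :=
  cov₂.isCovariantDerivativeOnUniv.leibniz (g := fun y₂ ↦ g (x.1, y₂))
    (mdifferentiableAt_sliceSnd hσ)
    (MDifferentiableAt.comp (x := x.2) (f := fun y₂ ↦ (x.1, y₂)) hg mdifferentiableAt_mk_right)

theorem sliceFst_add (cov₁ : LinearConnection I₁ M₁)
    {σ' : Π x : M₁ × M₂, TangentSpace (I₁.prod I₂) x}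
    (hσ : MDifferentiableAt (I₁.prod I₂) (I₁.prod I₂).tangent
      (fun y ↦ (⟨y, σ y⟩ : TangentBundle (I₁.prod I₂) (M₁ × M₂))) x)
    (hσ' : MDifferentiableAt (I₁.prod I₂) (I₁.prod I₂).tangent
      (fun y ↦ (⟨y, σ' y⟩ : TangentBundle (I₁.prod I₂) (M₁ × M₂))) x) :
    cov₁ (sliceFst (σ + σ') x.2) x.1 =
      cov₁ (sliceFst σ x.2) x.1 + cov₁ (sliceFst σ' x.2) x.1 :=
  cov₁.isCovariantDerivativeOnUniv.add
    (mdifferentiableAt_sliceFst hσ) (mdifferentiableAt_sliceFst hσ')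

theorem sliceSnd_add (cov₂ : LinearConnection I₂ M₂)
    {σ' : Π x : M₁ × M₂, TangentSpace (I₁.prod I₂) x}
    (hσ : MDifferentiableAt (I₁.prod I₂) (I₁.prod I₂).tangent
      (fun y ↦ (⟨y, σ y⟩ : TangentBundle (I₁.prod I₂) (M₁ × M₂))) x)
    (hσ' : MDifferentiableAt (I₁.prod I₂) (I₁.prod I₂).tangent
      (fun y ↦ (⟨y, σ' y⟩ : TangentBundle (I₁.prod I₂) (M₁ × M₂))) x) :
    cov₂ (sliceSnd (σ + σ') x.1) x.2 =
      cov₂ (sliceSnd σ x.1) x.2 + cov₂ (sliceSnd σ' x.1) x.2 :=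
  cov₂.isCovariantDerivativeOnUniv.add
    (mdifferentiableAt_sliceSnd hσ) (mdifferentiableAt_sliceSnd hσ')

end

theorem tangent_prod_ext {x : M₁ × M₂}
    {A B : TangentSpace (I₁.prod I₂) x →L[ℝ] TangentSpace (I₁.prod I₂) x}
    (h₁ : ∀ u, tangentFst I₁ I₂ x (A u) = tangentFst I₁ I₂ x (B u))
    (h₂ : ∀ u, tangentSnd I₁ I₂ x (A u) = tangentSnd I₁ I₂ x (B u)) : A = B :=
  ContinuousLinearMap.ext fun u ↦ Prod.ext (h₁ u) (h₂ u)

theorem tangentFst_prodFun (cov₁ : LinearConnection I₁ M₁) (cov₂ : LinearConnection I₂ M₂)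
    (σ : Π x : M₁ × M₂, TangentSpace (I₁.prod I₂) x) (x : M₁ × M₂)
    (u : TangentSpace (I₁.prod I₂) x) :
    tangentFst I₁ I₂ x (cov₁.prodFun cov₂ σ x u) =
      cov₁ (sliceFst σ x.2) x.1 (tangentFst I₁ I₂ x u) + crossFst σ x (tangentSnd I₁ I₂ x u) :=
  rfl

theorem tangentSnd_prodFun (cov₁ : LinearConnection I₁ M₁) (cov₂ : LinearConnection I₂ M₂)
    (σ : Π x : M₁ × M₂, TangentSpace (I₁.prod I₂) x) (x : M₁ × M₂)
    (u : TangentSpace (I₁.prod I₂) x) :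
    tangentSnd I₁ I₂ x (cov₁.prodFun cov₂ σ x u) =
      cov₂ (sliceSnd σ x.1) x.2 (tangentSnd I₁ I₂ x u) + crossSnd σ x (tangentFst I₁ I₂ x u) :=
  rfl

/-- The product connection `∇₁ × ∇₂` on `M₁ × M₂`. -/
def LinearConnection.prod (cov₁ : LinearConnection I₁ M₁) (cov₂ : LinearConnection I₂ M₂) :
    LinearConnection (I₁.prod I₂) (M₁ × M₂) where
  toFun := cov₁.prodFun cov₂
  isCovariantDerivativeOnUniv :=
    { add := by
        intro σ σ' x hσ hσ' _
        apply tangent_prod_ext <;> intro u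
        · rw [add_apply, map_add, tangentFst_prodFun, tangentFst_prodFun,
            tangentFst_prodFun, sliceFst_add cov₁ hσ hσ', crossFst_add hσ hσ',
            add_apply, add_apply]
          abel
        · rw [add_apply, map_add, tangentSnd_prodFun, tangentSnd_prodFun,
            tangentSnd_prodFun, sliceSnd_add cov₂ hσ hσ', crossSnd_add hσ hσ',
            add_apply, add_apply]
          abel
      leibniz := by
        intro σ g x hσ hg _
        apply tangent_prod_ext <;> intro u
        · rw [add_apply, map_add, smul_apply, map_smul,
            ContinuousLinearMap.smulRight_apply, map_smul, tangentFst_prodFun, tangentFst_prodFun,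
            sliceFst_leibniz cov₁ hσ hg, crossFst_smul hσ hg, mvfderiv_prod_split hg u]
          simp only [add_apply, smul_apply,
            ContinuousLinearMap.smulRight_apply, smul_add, add_smul]
          abel
        · rw [add_apply, map_add, smul_apply, map_smul,
            ContinuousLinearMap.smulRight_apply, map_smul, tangentSnd_prodFun, tangentSnd_prodFun,
            sliceSnd_leibniz cov₂ hσ hg, crossSnd_smul hσ hg, mvfderiv_prod_split hg u]
          simp only [add_apply, smul_apply,
            ContinuousLinearMap.smulRight_apply, smul_add, add_smul]
          abel }

end Product

end

noncomputable section

section ConstantRank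

variable {E G : Type*} [NormedAddCommGroup E] [NormedSpace ℝ E] [FiniteDimensional ℝ E]
  [NormedAddCommGroup G] [NormedSpace ℝ G] [FiniteDimensional ℝ G]

/-- A linear map with `k`-dimensional kernel is split by linear maps onto the model spaces of its
range and its kernel. -/
theorem exists_splitting_of_finrank_ker {d k : ℕ} (A : E →L[ℝ] G)
    (hE : Module.finrank ℝ E = d + k) (hk : Module.finrank ℝ A.ker = k) :
    ∃ (r : G →L[ℝ] EuclideanSpace ℝ (Fin d))
      (B : E ≃L[ℝ] EuclideanSpace ℝ (Fin d) × EuclideanSpace ℝ (Fin k)),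
      ∀ v, (B v).1 = r (A v) := by
  have hrange : Module.finrank ℝ (LinearMap.range (A : E →ₗ[ℝ] G)) = d := by
    have h := LinearMap.finrank_range_add_finrank_ker (A : E →ₗ[ℝ] G)
    have h' : Module.finrank ℝ (LinearMap.ker (A : E →ₗ[ℝ] G)) = k := hk
    omega
  obtain ⟨r₀, hr₀⟩ := LinearMap.exists_leftInverse_of_injective
    (LinearMap.range (A : E →ₗ[ℝ] G)).subtype (Submodule.ker_subtype _)
  obtain ⟨P₀, hP₀⟩ := LinearMap.exists_leftInverse_of_injective
    (LinearMap.ker (A : E →ₗ[ℝ] G)).subtype (Submodule.ker_subtype _)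
  let er : LinearMap.range (A : E →ₗ[ℝ] G) ≃ₗ[ℝ] EuclideanSpace ℝ (Fin d) :=
    LinearEquiv.ofFinrankEq _ _ (by rw [hrange, finrank_euclideanSpace_fin])
  let ek : LinearMap.ker (A : E →ₗ[ℝ] G) ≃ₗ[ℝ] EuclideanSpace ℝ (Fin k) :=
    LinearEquiv.ofFinrankEq _ _ (by rw [finrank_euclideanSpace_fin]; exact hk)
  let r : G →ₗ[ℝ] EuclideanSpace ℝ (Fin d) := er.toLinearMap ∘ₗ r₀
  let B₀ : E →ₗ[ℝ] EuclideanSpace ℝ (Fin d) × EuclideanSpace ℝ (Fin k) :=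
    (r ∘ₗ (A : E →ₗ[ℝ] G)).prod (ek.toLinearMap ∘ₗ P₀)
  have hinj : Function.Injective B₀ := by
    rw [← LinearMap.ker_eq_bot, LinearMap.ker_eq_bot']
    intro v hv
    have h1 : er (r₀ (A v)) = 0 := congrArg Prod.fst hv
    have h2 : ek (P₀ v) = 0 := congrArg Prod.snd hv
    have h3 : r₀ (A v) = ⟨A v, v, rfl⟩ :=
      LinearMap.congr_fun hr₀ (⟨A v, v, rfl⟩ : LinearMap.range (A : E →ₗ[ℝ] G))
    rw [er.map_eq_zero_iff, h3] at h1
    have h4 : A v = 0 := congrArg Subtype.val h1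
    have h5 : P₀ v = ⟨v, h4⟩ :=
      LinearMap.congr_fun hP₀ (⟨v, h4⟩ : LinearMap.ker (A : E →ₗ[ℝ] G))
    rw [ek.map_eq_zero_iff, h5] at h2
    exact congrArg Subtype.val h2
  let B := LinearEquiv.ofInjectiveOfFinrankEq B₀ hinj (by simp [hE])
  exact ⟨LinearMap.toContinuousLinearMap r, B.toContinuousLinearEquiv, fun v ↦ rfl⟩

/-- **Constant rank theorem.** If the derivative of `f` has kernel of constant dimension, then there
are coordinates in which the fibers of `f` are the fibers of a linear projection, and the first
coordinate is a linear function of `f`. -/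
theorem exists_chart_of_finrank_ker_eq {f : E → G} {U : Set E} (hU : IsOpen U) {x₀ : E}
    (hx₀ : x₀ ∈ U) (hf : ContDiffOn ℝ ∞ f U) {d k : ℕ} (hE : Module.finrank ℝ E = d + k)
    (hk : ∀ x ∈ U, Module.finrank ℝ (fderiv ℝ f x).ker = k) :
    ∃ (e : OpenPartialHomeomorph E (EuclideanSpace ℝ (Fin d) × EuclideanSpace ℝ (Fin k)))
      (r : G →L[ℝ] EuclideanSpace ℝ (Fin d)) (R : ℝ),
      x₀ ∈ e.source ∧ e.source ⊆ U ∧ ContDiffOn ℝ ∞ e e.source ∧ ContDiffOn ℝ ∞ e.symm e.target ∧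
      e.target = Metric.ball (e x₀) R ∧ (∀ x ∈ e.source, (e x).1 = r (f x)) ∧
      ∀ x ∈ e.source, ∀ y ∈ e.source, (e x).1 = (e y).1 → f x = f y := by
  obtain ⟨r, B, hB⟩ := exists_splitting_of_finrank_ker (fderiv ℝ f x₀) hE (hk x₀ hx₀)
  let P : E →L[ℝ] EuclideanSpace ℝ (Fin k) := 
    (ContinuousLinearMap.snd ℝ (EuclideanSpace ℝ (Fin d)) (EuclideanSpace ℝ (Fin k))).comp
      B.toContinuousLinearMap
  let F : E → EuclideanSpace ℝ (Fin d) × EuclideanSpace ℝ (Fin k) := fun x ↦ (r (f x), P x)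
  have hdf : ∀ x ∈ U, HasFDerivAt f (fderiv ℝ f x) x := fun x hx ↦
    ((hf.contDiffAt (hU.mem_nhds hx)).differentiableAt (by simp)).hasFDerivAt
  have hF : ContDiffOn ℝ ∞ F U := (r.contDiff.comp_contDiffOn hf).prodMk P.contDiff.contDiffOn
  have hFd : ∀ x ∈ U, HasFDerivAt F ((r.comp (fderiv ℝ f x)).prod P) x := fun x hx ↦
    (r.hasFDerivAt.comp x (hdf x hx)).prodMk P.hasFDerivAt
  have hB' : (r.comp (fderiv ℝ f x₀)).prod P = (B : E →L[ℝ] _) := by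
    ext1 v
    exact Prod.ext (hB v).symm rfl
  have hF₀ : HasFDerivAt F (B : E →L[ℝ] _) x₀ := hB' ▸ hFd x₀ hx₀
  have hFc : ContDiffAt ℝ ∞ F x₀ := hF.contDiffAt (hU.mem_nhds hx₀)
  let e₀ := hFc.toOpenPartialHomeomorph F hF₀ (by simp)
  have he₀ : x₀ ∈ e₀.source := hFc.mem_toOpenPartialHomeomorph_source hF₀ (by simp)
  have hcoe : (e₀ : E → _) = F := rfl
  -- the set where the derivative of `F` is invertible
  let W : Set E := U ∩ fderiv ℝ F ⁻¹' range ContinuousLinearEquiv.toContinuousLinearMap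
  have hW : IsOpen W := (hF.continuousOn_fderiv_of_isOpen hU (by simp)).isOpen_inter_preimage hU
    ContinuousLinearEquiv.isOpen
  have hxW : x₀ ∈ W := ⟨hx₀, B, hF₀.fderiv.symm⟩
  let e₁ := e₀.restrOpen W hW
  have hs₁ : e₁.source = e₀.source ∩ W := e₀.restrOpen_source W hW
  have hx₁ : x₀ ∈ e₁.source := by rw [hs₁]; exact ⟨he₀, hxW⟩
  obtain ⟨R, hR, hRt⟩ := Metric.isOpen_iff.1 e₁.open_target (e₁ x₀) (e₁.map_source hx₁)
  let e := (e₁.symm.restrOpen (Metric.ball (e₁ x₀) R) Metric.isOpen_ball).symm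
  have hecoe : (e : E → _) = F := rfl
  have hsrc : e.source ⊆ e₁.source := by
    intro x hx
    have : e₁.symm (e x) = x := e.left_inv hx
    rw [← this]
    exact e₁.map_target (hRt (e.map_source hx).2)
  have htgt : e.target = Metric.ball (e x₀) R := by
    have : e.target = e₁.target ∩ Metric.ball (e₁ x₀) R := rfl
    rw [this, inter_eq_right.2 hRt]
    rfl
  have hxe : x₀ ∈ e.source := by
    have h1 : e₁ x₀ ∈ e.target := by rw [htgt]; exact Metric.mem_ball_self hR
    have h2 := e.map_target h1
    have h3 : e.symm (e₁ x₀) = x₀ := e₁.left_inv hx₁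
    rwa [h3] at h2
  have hsW : e.source ⊆ W := fun x hx ↦ (hs₁ ▸ hsrc hx : x ∈ e₀.source ∩ W).2
  have hsU : e.source ⊆ U := fun x hx ↦ (hsW hx).1
  have hinv : ∀ x ∈ e.source, ∃ L : E ≃L[ℝ] EuclideanSpace ℝ (Fin d) × EuclideanSpace ℝ (Fin k),
      HasFDerivAt F (L : E →L[ℝ] _) x := by
    intro x hx
    obtain ⟨L, hL⟩ := (hsW hx).2
    refine ⟨L, ?_⟩
    have h := (hFd x (hsU hx))
    rw [← h.fderiv] at h
    rwa [← hL] at h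
  have hsymm : ContDiffOn ℝ ∞ e.symm e.target := by
    intro y hy
    obtain ⟨L, hL⟩ := hinv _ (e.map_target hy)
    exact (e.contDiffAt_symm hy hL
      (hF.contDiffAt (hU.mem_nhds (hsU (e.map_target hy))))).contDiffWithinAt
  refine ⟨e, r, R, hxe, hsU, hF.mono hsU, hsymm, htgt, fun x hx ↦ rfl, ?_⟩
  -- the kernel of the derivative of `f` agrees with that of the first coordinate
  have hker : ∀ x ∈ e.source, ∀ v, r (fderiv ℝ f x v) = 0 → fderiv ℝ f x v = 0 := by
    intro x hx v hv
    obtain ⟨L, hL⟩ := hinv x hx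
    have hLeq : (L : E →L[ℝ] _) = (r.comp (fderiv ℝ f x)).prod P := hL.unique (hFd x (hsU hx))
    let C : E →L[ℝ] EuclideanSpace ℝ (Fin d) := r.comp (fderiv ℝ f x)
    have hle : LinearMap.ker (fderiv ℝ f x : E →ₗ[ℝ] G) ≤
        LinearMap.ker (C : E →ₗ[ℝ] EuclideanSpace ℝ (Fin d)) := by
      intro w hw
      have hw' : fderiv ℝ f x w = 0 := hw
      change r (fderiv ℝ f x w) = 0
      rw [hw', map_zero]
    have hsurj : LinearMap.range (C : E →ₗ[ℝ] EuclideanSpace ℝ (Fin d)) = ⊤ := by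
      rw [LinearMap.range_eq_top]
      intro a
      refine ⟨L.symm (a, 0), ?_⟩
      have h := congrArg (fun T : E →L[ℝ] _ ↦ (T (L.symm (a, 0))).1) hLeq
      simpa [C] using h.symm
    have hfin := LinearMap.finrank_range_add_finrank_ker
      (C : E →ₗ[ℝ] EuclideanSpace ℝ (Fin d))
    rw [hsurj, finrank_top, finrank_euclideanSpace_fin] at hfin
    have hkx : Module.finrank ℝ (LinearMap.ker (fderiv ℝ f x : E →ₗ[ℝ] G)) = k := hk x (hsU hx)
    have heq := Submodule.eq_of_le_of_finrank_eq hle (by omega)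
    have : v ∈ LinearMap.ker (fderiv ℝ f x : E →ₗ[ℝ] G) := by rw [heq]; exact hv
    exact this
  intro x hx y hy hxy
  let g : EuclideanSpace ℝ (Fin k) → G := fun κ ↦ f (e.symm ((e x).1, κ))
  have hxb : e x ∈ Metric.ball (e x₀) R := htgt ▸ e.map_source hx
  have hyb : e y ∈ Metric.ball (e x₀) R := htgt ▸ e.map_source hy
  have hprod : ∀ κ ∈ Metric.ball (e x₀).2 R, ((e x).1, κ) ∈ e.target := by
    intro κ hκ
    rw [htgt]
    rw [Metric.mem_ball, Prod.dist_eq, max_lt_iff] at hxb ⊢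
    exact ⟨hxb.1, hκ⟩
  have hgd : ∀ κ ∈ Metric.ball (e x₀).2 R, HasFDerivAt g (0 : EuclideanSpace ℝ (Fin k) →L[ℝ] G) κ := by
    intro κ hκ
    have ht := hprod κ hκ
    have hxs := e.map_target ht
    have h1 : HasFDerivAt e.symm (fderiv ℝ e.symm ((e x).1, κ)) ((e x).1, κ) :=
      ((hsymm.contDiffAt (e.open_target.mem_nhds ht)).differentiableAt (by simp)).hasFDerivAt
    have h2 : HasFDerivAt (fun κ : EuclideanSpace ℝ (Fin k) ↦ ((e x).1, κ))
        (ContinuousLinearMap.inr ℝ (EuclideanSpace ℝ (Fin d)) _) κ := hasFDerivAt_prodMk_right _ _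
    have h3 := h1.comp κ h2
    have h4 := (hdf _ (hsU hxs)).comp κ h3
    convert! h4 using 1
    refine ContinuousLinearMap.ext fun w ↦ (hker _ hxs _ ?_).symm
    have h5 : HasFDerivAt (fun κ ↦ r (f (e.symm ((e x).1, κ)))) _ κ := r.hasFDerivAt.comp κ h4
    have h6 : (fun κ ↦ r (f (e.symm ((e x).1, κ)))) =ᶠ[𝓝 κ] fun _ ↦ (e x).1 := by
      filter_upwards [Metric.isOpen_ball.mem_nhds hκ] with κ' hκ'
      exact congrArg Prod.fst (e.right_inv (hprod κ' hκ'))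
    have h7 := h5.unique ((hasFDerivAt_const (e x).1 κ).congr_of_eventuallyEq h6)
    exact congrArg (fun T : EuclideanSpace ℝ (Fin k) →L[ℝ] _ ↦ T w) h7
  have hconst : g (e x).2 = g (e y).2 := by
    refine Metric.isOpen_ball.is_const_of_fderiv_eq_zero (𝕜 := ℝ)
      (convex_ball (e x₀).2 R).isPreconnected
      (fun κ hκ ↦ (hgd κ hκ).differentiableAt.differentiableWithinAt)
      (fun κ hκ ↦ (hgd κ hκ).fderiv) ?_ ?_
    · rw [Metric.mem_ball, Prod.dist_eq, max_lt_iff] at hxb; exact hxb.2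
    · rw [Metric.mem_ball, Prod.dist_eq, max_lt_iff] at hyb; exact hyb.2
  have hgx : g (e x).2 = f x := congrArg f (e.left_inv hx)
  have hgy : g (e y).2 = f y := by
    change f (e.symm ((e x).1, (e y).2)) = f y
    rw [hxy]
    exact congrArg f (e.left_inv hy)
  rw [← hgx, hconst, hgy]

end ConstantRank

section QuotientManifold

theorem finrank_ker_comp_comp {E₁ E₂ E₃ E₄ : Type*}
    [AddCommGroup E₁] [Module ℝ E₁] [TopologicalSpace E₁]
    [AddCommGroup E₂] [Module ℝ E₂] [TopologicalSpace E₂]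
    [AddCommGroup E₃] [Module ℝ E₃] [TopologicalSpace E₃]
    [AddCommGroup E₄] [Module ℝ E₄] [TopologicalSpace E₄]
    (A : E₃ →L[ℝ] E₄) (T : E₂ →L[ℝ] E₃) (B : E₁ →L[ℝ] E₂) (hA : A.IsInvertible)
    (hB : B.IsInvertible) :
    Module.finrank ℝ (A ∘L T ∘L B).ker = Module.finrank ℝ T.ker := by
  obtain ⟨A, rfl⟩ := hA
  obtain ⟨B, rfl⟩ := hB
  refine LinearEquiv.finrank_eq (LinearEquiv.ofSubmodules B.toLinearEquiv _ _ ?_)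
  ext w
  simp only [Submodule.mem_map, LinearMap.mem_ker]
  constructor
  · rintro ⟨v, hv, rfl⟩
    exact A.map_eq_zero_iff.1 hv
  · intro hw
    refine ⟨B.symm w, ?_, B.apply_symm_apply w⟩
    change A (T (B (B.symm w))) = 0
    rw [B.apply_symm_apply]
    exact A.map_eq_zero_iff.2 hw

variable {F : Type*} [NormedAddCommGroup F] [NormedSpace ℝ F] [FiniteDimensional ℝ F]
  {H : Type*} [TopologicalSpace H] {I : ModelWithCorners ℝ F H} [I.Boundaryless]
  {N : Type*} [TopologicalSpace N] [ChartedSpace H N] [IsManifold I ∞ N]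
  {F' : Type*} [NormedAddCommGroup F'] [NormedSpace ℝ F'] [FiniteDimensional ℝ F']
  {H' : Type*} [TopologicalSpace H'] {I' : ModelWithCorners ℝ F' H'} [I'.Boundaryless]
  {G : Type*} [TopologicalSpace G] [ChartedSpace H' G] [IsManifold I' ∞ G]

/-- The extended chart of a boundaryless manifold as an open partial homeomorphism. -/
def extChartHomeomorph (I : ModelWithCorners ℝ F H) [I.Boundaryless] (x : N) :
    OpenPartialHomeomorph N F :=
  (chartAt H x).trans I.toHomeomorph.toOpenPartialHomeomorph

theorem extChartHomeomorph_toPartialEquiv (x : N) :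
    (extChartHomeomorph I x).toPartialEquiv = extChartAt I x := by
  ext <;> simp [extChartHomeomorph, extChartAt]

theorem extChartHomeomorph_source (x : N) :
    (extChartHomeomorph I x).source = (extChartAt I x).source := by
  rw [← extChartHomeomorph_toPartialEquiv]

theorem extChartHomeomorph_target (x : N) :
    (extChartHomeomorph I x).target = (extChartAt I x).target := by
  rw [← extChartHomeomorph_toPartialEquiv]

/-- The dimension of the kernel of the derivative may be computed in any charts. -/
theorem finrank_ker_fderiv_writtenInCharts {f : N → G} {x : N} {y : G} {z : F}
    (hz : z ∈ (extChartAt I x).target) (hy : f ((extChartAt I x).symm z) ∈ (extChartAt I' y).source)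
    (hf : MDifferentiableAt I I' f ((extChartAt I x).symm z)) :
    Module.finrank ℝ (fderiv ℝ (extChartAt I' y ∘ f ∘ (extChartAt I x).symm) z).ker =
      Module.finrank ℝ (mfderiv I I' f ((extChartAt I x).symm z)).ker := by
  have : IsManifold I 1 N := .of_le (n := ∞) (by simp)
  have : IsManifold I' 1 G := .of_le (n := ∞) (by simp)
  have h1 : MDifferentiableAt 𝓘(ℝ, F) I (extChartAt I x).symm z := by
    have h := mdifferentiableWithinAt_extChartAt_symm hz
    rwa [I.range_eq_univ, mdifferentiableWithinAt_univ] at h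
  have h2 := mdifferentiableAt_extChartAt (I := I') ((extChartAt_source I' y) ▸ hy)
  have h3 : mfderiv 𝓘(ℝ, F) 𝓘(ℝ, F') (extChartAt I' y ∘ f ∘ (extChartAt I x).symm) z =
      mfderiv I' 𝓘(ℝ, F') (extChartAt I' y) (f ((extChartAt I x).symm z)) ∘L
      mfderiv I I' f ((extChartAt I x).symm z) ∘L mfderiv 𝓘(ℝ, F) I (extChartAt I x).symm z := by
    rw [mfderiv_comp (I' := I') z h2 (hf.comp z h1), mfderiv_comp (I' := I) z hf h1]
    rfl
  rw [← mfderiv_eq_fderiv, h3]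
  refine finrank_ker_comp_comp _ _ _ (isInvertible_mfderiv_extChartAt hy) ?_
  have h := isInvertible_mfderivWithin_extChartAt_symm hz
  rwa [I.range_eq_univ, mfderivWithin_univ] at h

/-- Coordinates in which the fibers of a map of constant rank are those of a linear projection. -/
theorem exists_adapted_chart {f : N → G} (hf : ContMDiff I I' ∞ f) {d k : ℕ}
    (hF : Module.finrank ℝ F = d + k) (hk : ∀ x, Module.finrank ℝ (mfderiv I I' f x).ker = k)
    (x : N) :
    ∃ (V : OpenPartialHomeomorph N (EuclideanSpace ℝ (Fin d) × EuclideanSpace ℝ (Fin k)))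
      (ρ : G → EuclideanSpace ℝ (Fin d)) (W : Set G) (R : ℝ), x ∈ V.source ∧
      ContMDiffOn I 𝓘(ℝ, EuclideanSpace ℝ (Fin d) × EuclideanSpace ℝ (Fin k)) ∞ V V.source ∧
      ContMDiffOn 𝓘(ℝ, EuclideanSpace ℝ (Fin d) × EuclideanSpace ℝ (Fin k)) I ∞ V.symm V.target ∧
      V.target = Metric.ball (V x) R ∧ IsOpen W ∧
      ContMDiffOn I' 𝓘(ℝ, EuclideanSpace ℝ (Fin d)) ∞ ρ W ∧
      (∀ v ∈ V.source, f v ∈ W ∧ (V v).1 = ρ (f v)) ∧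
      ∀ v ∈ V.source, ∀ w ∈ V.source, (V v).1 = (V w).1 → f v = f w := by
  let φ := extChartHomeomorph I x
  let ψ := extChartHomeomorph I' (f x)
  let O : Set F := φ.target ∩ φ.symm ⁻¹' (f ⁻¹' ψ.source)
  have hO : IsOpen O :=
    φ.symm.continuousOn.isOpen_inter_preimage φ.open_target (ψ.open_source.preimage hf.continuous)
  have hφs : φ.source = (extChartAt I x).source := extChartHomeomorph_source x
  have hφt : φ.target = (extChartAt I x).target := extChartHomeomorph_target x
  have hψs : ψ.source = (extChartAt I' (f x)).source := extChartHomeomorph_source (f x)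
  have hxφ : x ∈ φ.source := by rw [hφs]; exact mem_extChartAt_source x
  have hxψ : f x ∈ ψ.source := by rw [hψs]; exact mem_extChartAt_source (f x)
  have hxO : φ x ∈ O := ⟨φ.map_source hxφ, by
    change f (φ.symm (φ x)) ∈ ψ.source
    rwa [φ.left_inv hxφ]⟩
  have hφ : ContMDiffOn I 𝓘(ℝ, F) ∞ φ φ.source := by
    rw [hφs, extChartAt_source]; exact contMDiffOn_extChartAt
  have hφ' : ContMDiffOn 𝓘(ℝ, F) I ∞ φ.symm φ.target := by
    rw [hφt]; exact contMDiffOn_extChartAt_symm x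
  have hψ : ContMDiffOn I' 𝓘(ℝ, F') ∞ ψ ψ.source := by
    rw [hψs, extChartAt_source]; exact contMDiffOn_extChartAt
  have hfO : ContDiffOn ℝ ∞ (ψ ∘ f ∘ φ.symm) O := by
    rw [← contMDiffOn_iff_contDiffOn]
    exact hψ.comp (hf.comp_contMDiffOn (hφ'.mono inter_subset_left)) (fun z hz ↦ hz.2)
  obtain ⟨e, r, R, hxe, heO, he, he', heR, hr, hfib⟩ :=
    exists_chart_of_finrank_ker_eq hO hxO hfO hF (fun z hz ↦ by
      have h := finrank_ker_fderiv_writtenInCharts (f := f) (I := I) (I' := I') (x := x)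
        (y := f x) (z := z) (hφt ▸ hz.1) (hψs ▸ hz.2) (hf.mdifferentiable (by simp) _)
      exact h.trans (hk _))
  let V := φ.trans e
  have hVs : V.source ⊆ φ.source := fun v hv ↦ (φ.trans_source e ▸ hv).1
  have hVe : ∀ v ∈ V.source, φ v ∈ e.source := fun v hv ↦ (φ.trans_source e ▸ hv).2
  have hVt : V.target = e.target := by
    rw [φ.trans_target e, inter_eq_left]
    exact fun z hz ↦ (heO (e.map_target hz)).1
  have hVψ : ∀ v ∈ V.source, f v ∈ ψ.source := by
    intro v hv
    have h := (heO (hVe v hv)).2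
    change f (φ.symm (φ v)) ∈ ψ.source at h
    rwa [φ.left_inv (hVs hv)] at h
  have hφf : ∀ v ∈ V.source, (ψ ∘ f ∘ φ.symm) (φ v) = ψ (f v) := by
    intro v hv
    change ψ (f (φ.symm (φ v))) = ψ (f v)
    rw [φ.left_inv (hVs hv)]
  refine ⟨V, r ∘ ψ, ψ.source, R, ?_, ?_, ?_, ?_, ψ.open_source, ?_, ?_, ?_⟩
  · rw [φ.trans_source e]; exact ⟨hxφ, hxe⟩
  · exact (contMDiffOn_iff_contDiffOn.2 he).comp (hφ.mono hVs) hVe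
  · rw [hVt]
    exact (hφ'.comp (contMDiffOn_iff_contDiffOn.2 he') (fun z hz ↦ (heO (e.map_target hz)).1))
  · rw [hVt, heR]; rfl
  · exact r.contMDiff.comp_contMDiffOn hψ
  · exact fun v hv ↦ ⟨hVψ v hv, (hr _ (hVe v hv)).trans (congrArg r (hφf v hv))⟩
  · intro v hv w hw hvw
    have h := hfib _ (hVe v hv) _ (hVe w hw) hvw
    rw [hφf v hv, hφf w hw] at h
    exact ψ.injOn (hVψ v hv) (hVψ w hw) h

variable {Q : Type*} [TopologicalSpace Q]

/-- The chart of a quotient by the fibers of a map of constant rank. -/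
theorem exists_quotient_chart {f : N → G} (hf : ContMDiff I I' ∞ f) {d k : ℕ}
    (hF : Module.finrank ℝ F = d + k) (hk : ∀ x, Module.finrank ℝ (mfderiv I I' f x).ker = k)
    {p : N → Q} (hp : Continuous p) (hpo : IsOpenMap p) {g : Q → G} (hg : Function.Injective g)
    (hgc : Continuous g) (hgp : ∀ x, g (p x) = f x) (x : N) :
    ∃ (V : OpenPartialHomeomorph N (EuclideanSpace ℝ (Fin d) × EuclideanSpace ℝ (Fin k)))
      (c : OpenPartialHomeomorph Q (EuclideanSpace ℝ (Fin d)))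
      (ρ : G → EuclideanSpace ℝ (Fin d)) (W : Set G), x ∈ V.source ∧ p x ∈ c.source ∧
      ContMDiffOn I 𝓘(ℝ, EuclideanSpace ℝ (Fin d) × EuclideanSpace ℝ (Fin k)) ∞ V V.source ∧
      ContMDiffOn 𝓘(ℝ, EuclideanSpace ℝ (Fin d) × EuclideanSpace ℝ (Fin k)) I ∞ V.symm V.target ∧
      (∀ v ∈ V.source, c (p v) = (V v).1) ∧ IsOpen W ∧
      ContMDiffOn I' 𝓘(ℝ, EuclideanSpace ℝ (Fin d)) ∞ ρ W ∧
      (∀ q ∈ c.source, g q ∈ W ∧ c q = ρ (g q)) ∧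
      ContMDiffOn 𝓘(ℝ, EuclideanSpace ℝ (Fin d)) I' ∞ (g ∘ c.symm) c.target := by
  obtain ⟨V, ρ, W, R, hxV, hV, hV', hVR, hW, hρ, hVρ, hfib⟩ := exists_adapted_chart hf hF hk x
  let κ := (V x).2
  have hbox : ∀ z ∈ V.target, (z.1, κ) ∈ V.target := by
    intro z hz
    rw [hVR, Metric.mem_ball, Prod.dist_eq, max_lt_iff] at hz ⊢
    exact ⟨hz.1, by simpa [κ] using dist_nonneg.trans_lt hz.1⟩
  have hs : ContinuousOn (fun a : EuclideanSpace ℝ (Fin d) ↦ V.symm (a, κ))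
      {a | (a, κ) ∈ V.target} :=
    V.symm.continuousOn.comp (by fun_prop) (fun a ha ↦ ha)
  let c : OpenPartialHomeomorph Q (EuclideanSpace ℝ (Fin d)) :=
    { toFun := fun q ↦ ρ (g q)
      invFun := fun a ↦ p (V.symm (a, κ))
      source := p '' V.source
      target := {a | (a, κ) ∈ V.target}
      map_source' := by
        rintro _ ⟨v, hv, rfl⟩
        rw [mem_ofPred_eq, hgp, ← (hVρ v hv).2]
        exact hbox _ (V.map_source hv)
      map_target' := fun a ha ↦ mem_image_of_mem p (V.map_target ha)
      left_inv' := by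
        rintro _ ⟨v, hv, rfl⟩
        apply hg
        rw [hgp, hgp, ← (hVρ v hv).2]
        refine hfib _ (V.map_target (hbox _ (V.map_source hv))) _ hv ?_
        rw [V.right_inv (hbox _ (V.map_source hv))]
      right_inv' := by
        intro a ha
        rw [hgp, ← (hVρ _ (V.map_target ha)).2, V.right_inv ha]
      open_source := hpo _ V.open_source
      open_target := V.open_target.preimage (by fun_prop)
      continuousOn_toFun := by
        refine hρ.continuousOn.comp hgc.continuousOn ?_
        rintro _ ⟨v, hv, rfl⟩
        rw [hgp]
        exact (hVρ v hv).1
      continuousOn_invFun := hp.comp_continuousOn hs }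
  refine ⟨V, c, ρ, W, hxV, mem_image_of_mem p hxV, hV, hV', ?_, hW, hρ, ?_, ?_⟩
  · intro v hv
    change ρ (g (p v)) = _
    rw [hgp, (hVρ v hv).2]
  · rintro _ ⟨v, hv, rfl⟩
    rw [hgp]
    exact ⟨(hVρ v hv).1, congrArg ρ (hgp v)⟩
  · have h1 : ContMDiffOn 𝓘(ℝ, EuclideanSpace ℝ (Fin d)) I ∞
        (fun a : EuclideanSpace ℝ (Fin d) ↦ V.symm (a, κ)) {a | (a, κ) ∈ V.target} := by
      refine hV'.comp (contMDiffOn_iff_contDiffOn.2 ?_) (fun a ha ↦ ha)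
      exact (contDiff_id.prodMk contDiff_const).contDiffOn
    exact (hf.comp_contMDiffOn h1).congr fun a ha ↦ hgp _

/-- **Quotients by the fibers of a map of constant rank.** If an open quotient map `p` has the same
fibers as a smooth map of constant rank, then its codomain is a smooth manifold for which
`p` is a submersion. -/
theorem exists_manifold_isSubmersion {f : N → G} (hf : ContMDiff I I' ∞ f) {d k : ℕ}
    (hF : Module.finrank ℝ F = d + k) (hk : ∀ x, Module.finrank ℝ (mfderiv I I' f x).ker = k)
    {p : N → Q} (hp : Continuous p) (hpo : IsOpenMap p) (hps : Function.Surjective p)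
    {g : Q → G} (hg : Function.Injective g) (hgc : Continuous g) (hgp : ∀ x, g (p x) = f x) :
    ∃ _ : ChartedSpace (EuclideanSpace ℝ (Fin d)) Q,
      IsManifold (𝓡 d) ∞ Q ∧ Manifold.IsSubmersion I (𝓡 d) ∞ p := by
  choose V c ρ W hxV hxc hV hV' hcV hW hρ hcρ hgcs using
    exists_quotient_chart hf hF hk hp hpo hg hgc hgp
  let cs : ChartedSpace (EuclideanSpace ℝ (Fin d)) Q :=
    { atlas := range c
      chartAt := fun q ↦ c (Function.surjInv hps q)
      mem_chart_source := fun q ↦ by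
        have h := hxc (Function.surjInv hps q)
        rwa [Function.surjInv_eq hps q] at h
      chart_mem_atlas := fun q ↦ mem_range_self _ }
  have hman : IsManifold (𝓡 d) ∞ Q := by
    refine isManifold_of_contDiffOn (𝓡 d) ∞ Q ?_
    rintro _ _ ⟨x, rfl⟩ ⟨y, rfl⟩
    rw [← contMDiffOn_iff_contDiffOn]
    have h : ContMDiffOn 𝓘(ℝ, EuclideanSpace ℝ (Fin d)) 𝓘(ℝ, EuclideanSpace ℝ (Fin d)) ∞
        (ρ y ∘ (g ∘ (c x).symm)) ((c x).symm ≫ₕ c y).source :=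
      (hρ y).comp ((hgcs x).mono fun a ha ↦ ha.1) (fun a ha ↦ (hcρ y _ ha.2).1)
    refine (h.congr fun a ha ↦ (hcρ y _ ha.2).2).mono ?_
    exact fun a ha ↦ ha.1
  refine ⟨cs, hman, ?_⟩
  let B : F ≃L[ℝ] EuclideanSpace ℝ (Fin d) × EuclideanSpace ℝ (Fin k) :=
    ContinuousLinearEquiv.ofFinrankEq (by simp [hF])
  suffices h : Manifold.IsSubmersionOfComplement (EuclideanSpace ℝ (Fin k)) I (𝓡 d) ∞ p from
    h.isSubmersion
  intro x
  let D : OpenPartialHomeomorph N H := (V x).trans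
    (B.symm.toHomeomorph.trans I.toHomeomorph.symm).toOpenPartialHomeomorph
  have hDs : D.source = (V x).source := by simp [D]
  have hDt : ∀ z, z ∈ D.target ↔ B (I z) ∈ (V x).target := by
    intro z; simp [D]
  have hIsymm : ContMDiff 𝓘(ℝ, F) I ∞ I.symm := by
    have h := I.contMDiffOn_symm (n := ∞)
    rwa [I.range_eq_univ, contMDiffOn_univ] at h
  refine Manifold.IsSubmersionAtOfComplement.mk_of_continuousAt hp.continuousAt B D (c x)
    (hDs ▸ hxV x) (hxc x) ?_ ?_ ?_
  · refine D.mem_maximalAtlas_of_contMDiffOn ?_ ?_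
    · rw [hDs]
      exact hIsymm.comp_contMDiffOn
        (B.symm.toContinuousLinearMap.contMDiff.comp_contMDiffOn (hV x))
    · refine (hV' x).comp
        (B.toContinuousLinearMap.contMDiff.comp (ModelWithCorners.contMDiff I)).contMDiffOn ?_
      exact fun z hz ↦ (hDt z).1 hz
  · exact IsManifold.subset_maximalAtlas (mem_range_self x)
  · intro z hz
    have hz' : B z ∈ (V x).target := by
      have h : I.symm z ∈ D.target := by
        rw [OpenPartialHomeomorph.extend_target] at hz
        exact hz.1
      rw [hDt, I.right_inv (by simp [I.range_eq_univ])] at h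
      exact h
    have h1 : (D.extend I).symm z = (V x).symm (B z) := by
      change (V x).symm (B (I (I.symm z))) = _
      rw [I.right_inv (by simp [I.range_eq_univ])]
    change c x (p ((D.extend I).symm z)) = (B z).1
    rw [h1, hcV x _ ((V x).map_target hz'), (V x).right_inv hz']

end QuotientManifold

section Submersion

variable {E : Type*} [NormedAddCommGroup E] [NormedSpace ℝ E] [FiniteDimensional ℝ E]
  {H : Type*} [TopologicalSpace H] {I : ModelWithCorners ℝ E H} [I.Boundaryless]
  {X : Type*} [TopologicalSpace X] [ChartedSpace H X] [IsManifold I ∞ X]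
  {E' : Type*} [NormedAddCommGroup E'] [NormedSpace ℝ E'] [FiniteDimensional ℝ E']
  {H' : Type*} [TopologicalSpace H'] {I' : ModelWithCorners ℝ E' H'} [I'.Boundaryless]
  {G : Type*} [TopologicalSpace G] [ChartedSpace H' G] [IsManifold I' ∞ G]
  {K : Type*} [NormedAddCommGroup K] [NormedSpace ℝ K]
  {f : X → G} {x : X}

/-- The normal form of a submersion between boundaryless manifolds, in charts with values in the
model vector spaces. -/
theorem Manifold.IsSubmersionAtOfComplement.exists_normalForm
    (h : Manifold.IsSubmersionAtOfComplement K I I' ∞ f x) :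
    ∃ (D : OpenPartialHomeomorph X E) (P : OpenPartialHomeomorph G E') (L : E ≃L[ℝ] E' × K),
      x ∈ D.source ∧ MapsTo f D.source P.source ∧ ContMDiffOn I 𝓘(ℝ, E) ∞ D D.source ∧
      ContMDiffOn 𝓘(ℝ, E) I ∞ D.symm D.target ∧ ContMDiffOn I' 𝓘(ℝ, E') ∞ P P.source ∧
      ∀ y ∈ D.source, P (f y) = (L (D y)).1 := by
  let D := h.domChart.trans I.toHomeomorph.toOpenPartialHomeomorph
  let P := h.codChart.trans I'.toHomeomorph.toOpenPartialHomeomorph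
  have hDs : D.source = h.domChart.source := by simp [D]
  have hPs : P.source = h.codChart.source := by simp [P]
  have hDt : ∀ z, z ∈ D.target ↔ I.symm z ∈ h.domChart.target := by
    intro z; simp [D]
  refine ⟨D, P, h.equiv, hDs ▸ h.mem_domChart_source, ?_, ?_, ?_, ?_, ?_⟩
  · rw [hDs, hPs]; exact h.mapsto_domChart_source_codChart_source
  · rw [hDs]
    exact (ModelWithCorners.contMDiff I).comp_contMDiffOn
      (contMDiffOn_of_mem_maximalAtlas h.domChart_mem_maximalAtlas)
  · have hI := I.contMDiffOn_symm (n := ∞)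
    rw [I.range_eq_univ] at hI
    exact (contMDiffOn_symm_of_mem_maximalAtlas h.domChart_mem_maximalAtlas).comp
      (hI.mono (subset_univ _)) (fun z hz ↦ (hDt z).1 hz)
  · rw [hPs]
    exact (ModelWithCorners.contMDiff I').comp_contMDiffOn
      (contMDiffOn_of_mem_maximalAtlas h.codChart_mem_maximalAtlas)
  · intro y hy
    have hy' : D y ∈ (h.domChart.extend I).target := by
      rw [OpenPartialHomeomorph.extend_target, I.range_eq_univ, inter_univ]
      exact (hDt _).1 (D.map_source hy)
    have h1 := h.writtenInCharts hy'
    have h2 : (h.domChart.extend I).symm (D y) = y := D.left_inv hy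
    change (h.codChart.extend I') (f ((h.domChart.extend I).symm (D y))) = _ at h1
    rw [h2] at h1
    exact h1

theorem Manifold.IsSubmersionOfComplement.isOpenMap
    (h : Manifold.IsSubmersionOfComplement K I I' ∞ f) : IsOpenMap f := by
  rw [isOpenMap_iff_nhds_le]
  intro x
  obtain ⟨D, P, L, hx, hmaps, -, -, -, hn⟩ := (h x).exists_normalForm
  have h1 : Filter.map (fun y ↦ (L (D y)).1) (𝓝 x) = 𝓝 (L (D x)).1 := by
    change Filter.map (Prod.fst ∘ L ∘ D) (𝓝 x) = _
    rw [← Filter.map_map, ← Filter.map_map, D.map_nhds_eq hx, L.map_nhds_eq, map_fst_nhds]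
  have h2 : f =ᶠ[𝓝 x] P.symm ∘ fun y ↦ (L (D y)).1 := by
    filter_upwards [D.open_source.mem_nhds hx] with y hy
    change f y = P.symm (L (D y)).1
    rw [← hn y hy, P.left_inv (hmaps hy)]
  rw [Filter.map_congr h2, ← Filter.map_map, h1, ← hn x hx,
    P.symm.map_nhds_eq (P.map_source (hmaps hx)), P.left_inv (hmaps hx)]

/-- If a fiber of a submersion is covered by a parametrized surface, then it is at most
two-dimensional. -/
theorem Manifold.IsSubmersionAtOfComplement.finrank_le_two
    (h : Manifold.IsSubmersionAtOfComplement K I I' ∞ f x) {Φ : ℝ × ℝ → X} {S : Set (ℝ × ℝ)}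
    (hS : IsOpen S) (hΦ : ContMDiffOn 𝓘(ℝ, ℝ × ℝ) I 1 Φ S) (hfib : ∀ y, f y = f x → y ∈ Φ '' S) :
    FiniteDimensional ℝ K ∧ Module.finrank ℝ K ≤ 2 := by
  obtain ⟨D, P, L, hx, hmaps, hD, hD', -, hn⟩ := h.exists_normalForm
  have hK : FiniteDimensional ℝ K :=
    Module.Finite.of_surjective (LinearMap.snd ℝ E' K ∘ₗ (L.toLinearEquiv : E →ₗ[ℝ] E' × K))
      (Prod.snd_surjective.comp L.surjective)
  refine ⟨hK, ?_⟩
  let T : Set (ℝ × ℝ) := S ∩ Φ ⁻¹' D.source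
  have hT : IsOpen T := hΦ.continuousOn.isOpen_inter_preimage hS D.open_source
  let q : ℝ × ℝ → K := fun t ↦ (L (D (Φ t))).2
  have hq : ContDiffOn ℝ 1 q T := by
    rw [← contMDiffOn_iff_contDiffOn]
    have h1 : ContMDiffOn 𝓘(ℝ, ℝ × ℝ) 𝓘(ℝ, E) 1 (D ∘ Φ) T :=
      (hD.of_le (by simp)).comp (hΦ.mono inter_subset_left) (fun t ht ↦ ht.2)
    have h2 : ContMDiff 𝓘(ℝ, E) 𝓘(ℝ, K) 1 fun e : E ↦ (L e).2 :=
      contMDiff_iff_contDiff.2 (contDiff_snd.comp L.contDiff)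
    exact h2.comp_contMDiffOn h1
  let Z : Set K := {κ | L.symm ((L (D x)).1, κ) ∈ D.target}
  have hZ : IsOpen Z := D.open_target.preimage (by fun_prop)
  have hZq : Z ⊆ q '' T := by
    intro κ hκ
    have hy := D.map_target hκ
    have hDy : D (D.symm (L.symm ((L (D x)).1, κ))) = _ := D.right_inv hκ
    have hfy : f (D.symm (L.symm ((L (D x)).1, κ))) = f x := by
      apply P.injOn (hmaps hy) (hmaps hx)
      rw [hn _ hy, hn _ hx, hDy, L.apply_symm_apply]
    obtain ⟨t, ht, hty⟩ := hfib _ hfy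
    refine ⟨t, ⟨ht, ?_⟩, ?_⟩
    · change Φ t ∈ D.source
      rwa [hty]
    · change (L (D (Φ t))).2 = κ
      rw [hty, hDy, L.apply_symm_apply]
  have hxZ : (L (D x)).2 ∈ Z := by
    change L.symm (L (D x)) ∈ D.target
    rw [L.symm_apply_apply]
    exact D.map_source hx
  have h1 : dimH (q '' T) = Module.finrank ℝ K :=
    Real.dimH_of_nonempty_interior ⟨_, interior_mono hZq (hZ.interior_eq.symm ▸ hxZ)⟩
  have h2 : dimH (q '' T) ≤ dimH T := by
    apply dimH_image_le_of_locally_lipschitzOn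
    intro t ht
    obtain ⟨C, s, hs, hC⟩ := (hq.contDiffAt (hT.mem_nhds ht)).exists_lipschitzOnWith
    exact ⟨C, s, mem_nhdsWithin_of_mem_nhds hs, hC⟩
  have h3 : dimH T ≤ 2 := (dimH_mono (subset_univ T)).trans (by simp [Real.dimH_univ_eq_finrank])
  have h4 := h2.trans h3
  rw [h1] at h4
  exact_mod_cast h4

variable {F : Type*} [NormedAddCommGroup F] [NormedSpace ℝ F] [FiniteDimensional ℝ F]
  {HN : Type*} [TopologicalSpace HN] {J : ModelWithCorners ℝ F HN}
  {N : Type*} [TopologicalSpace N] [ChartedSpace HN N] {j : N → X} {w : N}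

theorem Manifold.IsSubmersionAtOfComplement.finrank_ker_comp_le [FiniteDimensional ℝ K]
    (h : Manifold.IsSubmersionAtOfComplement K I I' ∞ f (j w)) (hj : MDifferentiableAt J I j w)
    (hinj : Function.Injective (mfderiv J I j w)) :
    Module.finrank ℝ (mfderiv J I' (f ∘ j) w).ker ≤ Module.finrank ℝ K := by
  obtain ⟨D, P, L, hx, hmaps, hD, hD', hP, hn⟩ := h.exists_normalForm
  have hDw : HasMFDerivAt I 𝓘(ℝ, E) D (j w) (mfderiv I 𝓘(ℝ, E) D (j w)) :=
    ((hD.contMDiffAt (D.open_source.mem_nhds hx)).mdifferentiableAt (by simp)).hasMFDerivAt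
  have hDsw : HasMFDerivAt 𝓘(ℝ, E) I D.symm (D (j w)) (mfderiv 𝓘(ℝ, E) I D.symm (D (j w))) :=
    ((hD'.contMDiffAt (D.open_target.mem_nhds (D.map_source hx))).mdifferentiableAt
      (by simp)).hasMFDerivAt
  have hDinj : Function.Injective (mfderiv I 𝓘(ℝ, E) D (j w)) := by
    have h1 : HasMFDerivAt I I id (j w)
        (mfderiv 𝓘(ℝ, E) I D.symm (D (j w)) ∘L mfderiv I 𝓘(ℝ, E) D (j w)) := by
      refine (hDsw.comp (j w) hDw).congr_of_eventuallyEq ?_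
      filter_upwards [D.open_source.mem_nhds hx] with y hy
      exact (D.left_inv hy).symm
    have h2 := (hasMFDerivAt_unique h1 (hasMFDerivAt_id (j w)))
    intro a b hab
    have h3 := fun v ↦ congrArg (fun T : TangentSpace I (j w) →L[ℝ] TangentSpace I (j w) ↦ T v) h2
    exact (h3 a).symm.trans ((congrArg (mfderiv 𝓘(ℝ, E) I D.symm (D (j w))) hab).trans (h3 b))
  have hjw := hj.hasMFDerivAt
  have hfj : MDifferentiableAt J I' (f ∘ j) w :=
    (h.contMDiffAt.mdifferentiableAt (by simp)).comp w hj
  have hPw : MDifferentiableAt I' 𝓘(ℝ, E') P (f (j w)) :=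
    (hP.contMDiffAt (P.open_source.mem_nhds (hmaps hx))).mdifferentiableAt (by simp)
  have hLD : HasMFDerivAt J 𝓘(ℝ, E' × K) (fun v ↦ L (D (j v))) w
      (L.toContinuousLinearMap ∘L (mfderiv I 𝓘(ℝ, E) D (j w) ∘L mfderiv J I j w)) :=
    (L.toContinuousLinearMap.hasMFDerivAt (x := D (j w))).comp w (hDw.comp w hjw)
  have h1 : HasMFDerivAt J 𝓘(ℝ, E') (fun v ↦ (L (D (j v))).1) w
      (ContinuousLinearMap.fst ℝ E' K ∘L
        (L.toContinuousLinearMap ∘L (mfderiv I 𝓘(ℝ, E) D (j w) ∘L mfderiv J I j w))) :=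
    ((ContinuousLinearMap.fst ℝ E' K).hasMFDerivAt (x := L (D (j w)))).comp w hLD
  have h2 : HasMFDerivAt J 𝓘(ℝ, E') (fun v ↦ (L (D (j v))).1) w
      (mfderiv I' 𝓘(ℝ, E') P (f (j w)) ∘L mfderiv J I' (f ∘ j) w) := by
    refine (hPw.hasMFDerivAt.comp w hfj.hasMFDerivAt).congr_of_eventuallyEq ?_
    filter_upwards [hj.continuousAt.preimage_mem_nhds (D.open_source.mem_nhds hx)] with v hv
    exact (hn _ hv).symm
  have h3 := hasMFDerivAt_unique h1 h2
  let A : TangentSpace J w →L[ℝ] K := ContinuousLinearMap.snd ℝ E' K ∘L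
    (L.toContinuousLinearMap ∘L (mfderiv I 𝓘(ℝ, E) D (j w) ∘L mfderiv J I j w))
  have hA : ∀ v, mfderiv J I' (f ∘ j) w v = 0 → A v = 0 → v = 0 := by
    intro v hv hv'
    have h4 := congrArg (fun T : TangentSpace J w →L[ℝ] E' ↦ T v) h3
    have h5 : (L (mfderiv I 𝓘(ℝ, E) D (j w) (mfderiv J I j w v))).1 =
        mfderiv I' 𝓘(ℝ, E') P (f (j w)) (mfderiv J I' (f ∘ j) w v) := h4
    rw [hv, map_zero] at h5
    have h6 : L (mfderiv I 𝓘(ℝ, E) D (j w) (mfderiv J I j w v)) = 0 := Prod.ext h5 hv'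
    have h7 : mfderiv J I j w v = 0 :=
      hDinj ((L.map_eq_zero_iff.1 h6).trans (map_zero _).symm)
    exact hinj (h7.trans (map_zero _).symm)
  refine LinearMap.finrank_le_finrank_of_injective
    (f := (A : TangentSpace J w →ₗ[ℝ] K).domRestrict (mfderiv J I' (f ∘ j) w).ker) ?_
  rw [← LinearMap.ker_eq_bot, LinearMap.ker_eq_bot']
  intro v hv
  exact Subtype.ext (hA v.1 v.2 hv)

theorem two_le_finrank_ker_mfderiv {g : N → G} (hg : MDifferentiableAt J I' g w)
    {Φ : ℝ × ℝ → N} {t₀ : ℝ × ℝ} (hw : Φ t₀ = w)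
    (hΦ : MDifferentiableAt 𝓘(ℝ, ℝ × ℝ) J Φ t₀)
    (hinj : Function.Injective (mfderiv 𝓘(ℝ, ℝ × ℝ) J Φ t₀))
    (hconst : ∀ᶠ t in 𝓝 t₀, g (Φ t) = g w) :
    2 ≤ Module.finrank ℝ (mfderiv J I' g w).ker := by
  subst hw
  have h1 := hg.hasMFDerivAt.comp t₀ hΦ.hasMFDerivAt
  have h2 : HasMFDerivAt 𝓘(ℝ, ℝ × ℝ) I' (g ∘ Φ) t₀ 0 :=
    (hasMFDerivAt_const (g (Φ t₀)) t₀).congr_of_eventuallyEq hconst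
  have h3 := hasMFDerivAt_unique h1 h2
  have : FiniteDimensional ℝ (TangentSpace J (Φ t₀)) := inferInstanceAs (FiniteDimensional ℝ F)
  let A : ℝ × ℝ →L[ℝ] TangentSpace J (Φ t₀) := mfderiv 𝓘(ℝ, ℝ × ℝ) J Φ t₀
  have h4 := LinearMap.finrank_le_finrank_of_injective
    (f := LinearMap.codRestrict (mfderiv J I' g (Φ t₀)).ker
      (A : ℝ × ℝ →ₗ[ℝ] TangentSpace J (Φ t₀))
      (fun v ↦ congrArg (fun T : ℝ × ℝ →L[ℝ] TangentSpace I' (g (Φ t₀)) ↦ T v) h3))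
    (fun a b hab ↦ hinj (congrArg Subtype.val hab))
  simpa using h4

end Submersion

section Christoffel

variable {E : Type*} [NormedAddCommGroup E] [NormedSpace ℝ E]
  {H : Type*} [TopologicalSpace H] {I : ModelWithCorners ℝ E H}
  {M : Type*} [TopologicalSpace M] [ChartedSpace H M] [IsManifold I ∞ M]

variable (I) in
/-- The vector field with constant components in the preferred chart at `q`, extended by zero. -/
def coordField (q : M) (v : E) (y : M) : TangentSpace I y :=
  (trivializationAt E (TangentSpace I : M → Type _) q).symmL ℝ y v

theorem contMDiffAt_coordField {q x : M} (hx : x ∈ (chartAt H q).source) (v : E) :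
    ContMDiffAt I I.tangent ∞ (fun y ↦ (⟨y, coordField I q v y⟩ : TangentBundle I M)) x := by
  set e := trivializationAt E (TangentSpace I : M → Type _) q with he
  have hx' : x ∈ e.baseSet := hx
  have h1 := (e.contMDiffOn_symm (IB := I) (n := ∞)).contMDiffAt
    (x := (x, v)) (e.open_target.mem_nhds (e.mem_target.2 hx'))
  have h2 : ContMDiffAt I (I.prod 𝓘(ℝ, E)) ∞ (fun y : M ↦ (y, v)) x :=
    contMDiffAt_id.prodMk contMDiffAt_const
  refine (h1.comp x h2).congr_of_eventuallyEq ?_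
  filter_upwards [e.open_baseSet.mem_nhds hx'] with y hy
  refine Eq.trans ?_ (e.mk_symm hy v)
  exact congrArg (fun z ↦ (⟨y, z⟩ : TangentBundle I M)) (e.symmL_apply hy v)

theorem mdifferentiableAt_coordField {q x : M} (hx : x ∈ (chartAt H q).source) (v : E) :
    MDifferentiableAt I I.tangent (fun y ↦ (⟨y, coordField I q v y⟩ : TangentBundle I M)) x :=
  (contMDiffAt_coordField hx v).mdifferentiableAt (by simp)

namespace LinearConnection

theorem sum_smul (cov : LinearConnection I M) {ι : Type*} (s : Finset ι) {g : ι → M → ℝ}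
    {σ : ι → Π y : M, TangentSpace I y} {x : M}
    (hg : ∀ i, MDifferentiableAt I 𝓘(ℝ, ℝ) (g i) x)
    (hσ : ∀ i, MDifferentiableAt I I.tangent (fun y ↦ (⟨y, σ i y⟩ : TangentBundle I M)) x) :
    cov (fun y ↦ ∑ i ∈ s, g i y • σ i y) x =
      ∑ i ∈ s, (g i x • cov (σ i) x + (mvfderiv I (g i) x).smulRight (σ i x)) := by
  classical
  induction s using Finset.induction_on with
  | empty =>
    simp only [Finset.sum_empty]
    exact congrFun cov.zero x
  | insert a s ha ih =>
    rw [Finset.sum_insert ha, ← ih, ← cov.isCovariantDerivativeOnUniv.leibniz (hσ a) (hg a),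
      ← cov.isCovariantDerivativeOnUniv.add]
    · congr 1
      funext y
      rw [Finset.sum_insert ha]
      rfl
    · exact (hg a).smul_section (hσ a)
    · exact MDifferentiableAt.sum_section fun i _ ↦ (hg i).smul_section (hσ i)

theorem christoffel_eq (cov : LinearConnection I M) (q x : M) (u v : E) :
    cov.christoffel q x u v =
      (trivializationAt E (TangentSpace I : M → Type _) q).continuousLinearMapAt ℝ x
        (cov (coordField I q v) x (coordField I q u x)) := rfl

theorem coordField_eq_sum {ι : Type*} [Fintype ι] (b : Module.Basis ι ℝ E) (q y : M) (v : E) :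
    coordField I q v y = ∑ i, b.repr v i • coordField I q (b i) y := by
  conv_lhs => rw [← b.sum_repr v]
  simp only [coordField, map_sum, map_smul]

/-- The Christoffel symbols, as endomorphisms in the direction of differentiation. -/
def christoffelCLM (cov : LinearConnection I M) (q : M) (v : E) (x : M) : E →L[ℝ] E :=
  (trivializationAt E (TangentSpace I : M → Type _) q).continuousLinearMapAt ℝ x ∘L
    cov (coordField I q v) x ∘L
      (trivializationAt E (TangentSpace I : M → Type _) q).symmL ℝ x

theorem christoffelCLM_apply (cov : LinearConnection I M) (q x : M) (u v : E) :
    cov.christoffelCLM q v x u = cov.christoffel q x u v := rfl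

theorem christoffel_zero_left (cov : LinearConnection I M) (q x : M) (v : E) :
    cov.christoffel q x 0 v = 0 := by
  rw [← christoffelCLM_apply, map_zero]

theorem christoffel_eq_sum (cov : LinearConnection I M) {ι : Type*} [Fintype ι]
    (b : Module.Basis ι ℝ E) {q x : M} (hx : x ∈ (chartAt H q).source) (u v : E) :
    cov.christoffel q x u v = ∑ i, b.repr v i • cov.christoffel q x u (b i) := by
  have h1 : coordField I q v = fun y ↦ ∑ i, (fun _ : M ↦ b.repr v i) y • coordField I q (b i) y :=
    funext fun y ↦ coordField_eq_sum b q y v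
  have h2 := cov.sum_smul Finset.univ (g := fun i _ ↦ b.repr v i)
    (fun i ↦ mdifferentiableAt_const) (fun i ↦ mdifferentiableAt_coordField hx (b i))
  rw [christoffel_eq, h1, h2]
  simp only [sum_apply, map_sum]
  refine Finset.sum_congr rfl fun i _ ↦ ?_
  have h3 : mvfderiv I (fun _ : M ↦ b.repr v i) x = 0 := mvfderiv_const _
  rw [h3]
  simp [christoffel_eq]

theorem contMDiffAt_christoffelCLM [T2Space M] [FiniteDimensional ℝ E]
    (cov : LinearConnection I M) [hc : cov.ContMDiffCovariantDerivative ∞] (q : M) (v : E) :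
    ContMDiffAt I 𝓘(ℝ, E →L[ℝ] E) ∞ (cov.christoffelCLM q v) q := by
  let ρ : SmoothBumpFunction I q := Classical.arbitrary _
  let σ : Π y : M, TangentSpace I y := (ρ : M → ℝ) • coordField I q v
  have hσ : ContMDiff I I.tangent ∞ (fun y ↦ (⟨y, σ y⟩ : TangentBundle I M)) :=
    ContMDiffOn.smul_section_of_tsupport (u := (chartAt H q).source) ρ.contMDiff.contMDiffOn
      (chartAt H q).open_source ρ.tsupport_subset_chartAt_source
      (fun x hx ↦ (contMDiffAt_coordField hx v).contMDiffWithinAt)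
  have h1 := (hc.contMDiff.contMDiff (σ := σ) (by simpa using hσ.contMDiffOn)).contMDiffAt
    (x := q) Filter.univ_mem
  rw [contMDiffAt_hom_bundle] at h1
  refine h1.2.congr_of_eventuallyEq ?_
  have hev : ∀ᶠ y in 𝓝 q, σ y = coordField I q v y := by
    filter_upwards [ρ.eventuallyEq_one] with y hy
    change ρ y • coordField I q v y = _
    rw [hy]
    exact one_smul _ _
  filter_upwards [hev.eventually_nhds,
    (chartAt H q).open_source.mem_nhds (mem_chart_source H q)] with y hy hyq
  have h2 : cov (coordField I q v) y = cov σ y :=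
    (cov.isCovariantDerivativeOnUniv.congr_of_eventuallyEq
      (hσ.contMDiffAt.mdifferentiableAt (by simp)) (mdifferentiableAt_coordField hyq v)
      Filter.univ_mem hy).symm
  change _ ∘L cov (coordField I q v) y ∘L _ = _
  rw [h2]
  rfl

end LinearConnection

end Christoffel

section ChartChange

variable {E : Type*} [NormedAddCommGroup E] [NormedSpace ℝ E]
  {H : Type*} [TopologicalSpace H] {I : ModelWithCorners ℝ E H}
  {M : Type*} [TopologicalSpace M] [ChartedSpace H M] [IsManifold I ∞ M]

theorem continuousLinearMapAt_coordField {q q' y : M} (hy : y ∈ (chartAt H q).source)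
    (hy' : y ∈ (chartAt H q').source) (v : E) :
    (trivializationAt E (TangentSpace I : M → Type _) q').continuousLinearMapAt ℝ y
      (coordField I q v y) = tangentCoordChange I q q' y v := by
  rw [coordField, TangentBundle.continuousLinearMapAt_trivializationAt_eq_core hy',
    TangentBundle.symmL_trivializationAt_eq_core hy]
  refine tangentCoordChange_comp ⟨⟨?_, ?_⟩, ?_⟩
  · rwa [extChartAt_source]
  · rw [extChartAt_source]; exact mem_chart_source H y
  · rwa [extChartAt_source]

theorem coordField_continuousLinearMapAt {q y : M} (hy : y ∈ (chartAt H q).source)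
    (w : TangentSpace I y) :
    coordField I q ((trivializationAt E (TangentSpace I : M → Type _) q).continuousLinearMapAt ℝ y
      w) y = w :=
  (trivializationAt E (TangentSpace I : M → Type _) q).symmL_continuousLinearMapAt hy w

theorem coordField_tangentCoordChange {q q' y : M} (hy : y ∈ (chartAt H q).source)
    (hy' : y ∈ (chartAt H q').source) (v : E) :
    coordField I q' (tangentCoordChange I q q' y v) y = coordField I q v y := by
  rw [← continuousLinearMapAt_coordField hy hy', coordField_continuousLinearMapAt hy']

variable [I.Boundaryless] [FiniteDimensional ℝ E]

/-- The change of coordinates between the preferred charts at two points. -/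
abbrev chartChange (I : ModelWithCorners ℝ E H) (q q' : M) : E → E :=
  extChartAt I q' ∘ (extChartAt I q).symm

theorem contDiffAt_chartChange {q q' x : M} (hx : x ∈ (chartAt H q).source)
    (hx' : x ∈ (chartAt H q').source) :
    ContDiffAt ℝ ∞ (chartChange I q q') (extChartAt I q x) := by
  have h := contDiffWithinAt_ext_coord_change (I := I) (n := ∞) q' q (y := extChartAt I q x) (by
    rw [PartialEquiv.trans_source'', PartialEquiv.symm_symm, PartialEquiv.symm_target]
    refine mem_image_of_mem _ ⟨?_, ?_⟩ <;> rwa [extChartAt_source])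
  rwa [I.range_eq_univ, contDiffWithinAt_univ] at h

theorem tangentCoordChange_eq_fderiv (q q' x : M) :
    tangentCoordChange I q q' x = fderiv ℝ (chartChange I q q') (extChartAt I q x) := by
  rw [tangentCoordChange_def, I.range_eq_univ, fderivWithin_univ]

theorem mvfderiv_coordField {q x : M} (hx : x ∈ (chartAt H q).source) {g : M → ℝ}
    (hg : MDifferentiableAt I 𝓘(ℝ, ℝ) g x) (u : E) :
    mvfderiv I g x (coordField I q u x) =
      fderiv ℝ (g ∘ (extChartAt I q).symm) (extChartAt I q x) u := by
  have hx' : x ∈ (extChartAt I q).source := by rwa [extChartAt_source]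
  have h1 : MDifferentiableAt 𝓘(ℝ, E) I (extChartAt I q).symm (extChartAt I q x) := by
    have h := mdifferentiableWithinAt_extChartAt_symm ((extChartAt I q).map_source hx')
    rwa [I.range_eq_univ, mdifferentiableWithinAt_univ] at h
  have h2 : mfderiv 𝓘(ℝ, E) 𝓘(ℝ, ℝ) (g ∘ (extChartAt I q).symm) (extChartAt I q x) =
      mfderiv I 𝓘(ℝ, ℝ) g ((extChartAt I q).symm (extChartAt I q x)) ∘L
        mfderiv 𝓘(ℝ, E) I (extChartAt I q).symm (extChartAt I q x) := by
    refine mfderiv_comp _ ?_ h1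
    rwa [(extChartAt I q).left_inv hx']
  rw [← mfderiv_eq_fderiv, h2, coordField, TangentBundle.symmL_trivializationAt hx,
    I.range_eq_univ, mfderivWithin_univ]
  generalize_proofs
  have h3 := (extChartAt I q).left_inv hx'
  change mfderiv I 𝓘(ℝ, ℝ) g x _ = mfderiv I 𝓘(ℝ, ℝ) g ((extChartAt I q).symm (extChartAt I q x)) _
  rw [h3]
  rfl

/-- The transformation law of the Christoffel symbols. -/
theorem LinearConnection.christoffel_chartChange (cov : LinearConnection I M) {q q' x : M}
    (hx : x ∈ (chartAt H q).source) (hx' : x ∈ (chartAt H q').source) (u v : E) :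
    tangentCoordChange I q q' x (cov.christoffel q x u v) =
      cov.christoffel q' x (tangentCoordChange I q q' x u) (tangentCoordChange I q q' x v) +
        fderiv ℝ (fderiv ℝ (chartChange I q q')) (extChartAt I q x) u v := by
  let b := Module.finBasis ℝ E
  let T := tangentCoordChange I q q'
  have hT : DifferentiableAt ℝ (fderiv ℝ (chartChange I q q')) (extChartAt I q x) :=
    ((contDiffAt_chartChange hx hx').fderiv_right (m := ∞) le_rfl).differentiableAt (by simp)
  let ℓ := fun i ↦ LinearMap.toContinuousLinearMap (b.coord i)
  let g := fun i ↦ fun y ↦ ℓ i (T y v)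
  have hgd : ∀ i, HasFDerivAt (fun z ↦ ℓ i (fderiv ℝ (chartChange I q q') z v))
      ((ℓ i).comp ((ContinuousLinearMap.apply ℝ E v).comp
        (fderiv ℝ (fderiv ℝ (chartChange I q q')) (extChartAt I q x))))
      (extChartAt I q x) := fun i ↦
    (ℓ i).hasFDerivAt.comp _ ((ContinuousLinearMap.apply ℝ E v).hasFDerivAt.comp _ hT.hasFDerivAt)
  have hgE : ∀ i, g i = (fun z ↦ ℓ i (fderiv ℝ (chartChange I q q') z v)) ∘ extChartAt I q := by
    intro i
    funext y
    exact congrArg (fun T : E →L[ℝ] E ↦ ℓ i (T v)) (tangentCoordChange_eq_fderiv q q' y)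
  have hg : ∀ i, MDifferentiableAt I 𝓘(ℝ, ℝ) (g i) x := fun i ↦ by
    rw [hgE i]
    exact (hgd i).differentiableAt.mdifferentiableAt.comp x (mdifferentiableAt_extChartAt hx)
  have hσ : ∀ i, MDifferentiableAt I I.tangent
      (fun y ↦ (⟨y, coordField I q' (b i) y⟩ : TangentBundle I M)) x :=
    fun i ↦ mdifferentiableAt_coordField hx' (b i)
  have h1 := cov.sum_smul Finset.univ hg hσ
  have h2 : cov (coordField I q v) x = cov (fun y ↦ ∑ i, g i y • coordField I q' (b i) y) x := by
    refine cov.isCovariantDerivativeOnUniv.congr_of_eventuallyEq (mdifferentiableAt_coordField hx v)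
      (MDifferentiableAt.sum_section fun i _ ↦ (hg i).smul_section (hσ i)) Filter.univ_mem ?_
    filter_upwards [(chartAt H q).open_source.mem_nhds hx,
      (chartAt H q').open_source.mem_nhds hx'] with y hy hy'
    rw [← coordField_tangentCoordChange hy hy' v, coordField_eq_sum b]
    rfl
  have hdg : ∀ i, mvfderiv I (g i) x (coordField I q u x) =
      ℓ i (fderiv ℝ (fderiv ℝ (chartChange I q q')) (extChartAt I q x) u v) := by
    intro i
    rw [mvfderiv_coordField hx (hg i)]
    have h3 : g i ∘ (extChartAt I q).symm =ᶠ[𝓝 (extChartAt I q x)]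
        fun z ↦ ℓ i (fderiv ℝ (chartChange I q q') z v) := by
      filter_upwards [extChartAt_target_mem_nhds' (I := I) (x := q)
        ((extChartAt I q).map_source ((extChartAt_source I q).symm ▸ hx))] with z hz
      rw [hgE i]
      exact congrArg (fun z ↦ ℓ i (fderiv ℝ (chartChange I q q') z v)) ((extChartAt I q).right_inv hz)
    rw [h3.fderiv_eq, (hgd i).fderiv]
    rfl
  have h4 : tangentCoordChange I q q' x (cov.christoffel q x u v) =
      (trivializationAt E (TangentSpace I : M → Type _) q').continuousLinearMapAt ℝ x
        (cov (coordField I q v) x (coordField I q u x)) := by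
    rw [← continuousLinearMapAt_coordField hx hx', christoffel_eq,
      coordField_continuousLinearMapAt hx]
  rw [h4, h2, h1, cov.christoffel_eq_sum b hx', ← coordField_tangentCoordChange hx hx' u]
  simp only [sum_apply, map_sum]
  conv_rhs => rw [← b.sum_repr (fderiv ℝ (fderiv ℝ (chartChange I q q')) (extChartAt I q x) u v)]
  rw [← Finset.sum_add_distrib]
  refine Finset.sum_congr rfl fun i _ ↦ ?_
  rw [add_apply, map_add, smul_apply, map_smul, ContinuousLinearMap.smulRight_apply, map_smul]
  rw [coordField_tangentCoordChange hx hx' u, hdg]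
  have h5 := continuousLinearMapAt_coordField (I := I) hx' hx' (b i)
  rw [tangentCoordChange_self ((extChartAt_source I q').symm ▸ hx')] at h5
  rw [h5]
  rw [christoffel_eq, coordField_tangentCoordChange hx hx' u]
  rfl

end ChartChange

section Curves

variable {E : Type*} [NormedAddCommGroup E] [NormedSpace ℝ E]
  {H : Type*} [TopologicalSpace H] {I : ModelWithCorners ℝ E H}
  {M : Type*} [TopologicalSpace M] [ChartedSpace H M] [IsManifold I ∞ M]

variable (I) in
/-- The lift of a curve to the tangent bundle. -/
def curveLift (γ : ℝ → M) (t : ℝ) : TangentBundle I M := ⟨γ t, curveVelocity I γ t⟩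

theorem curveLift_congr {γ η : ℝ → M} {t : ℝ} (h : γ =ᶠ[𝓝 t] η) :
    curveLift I γ t = curveLift I η t := by
  have h1 : curveVelocity I γ t = curveVelocity I η t := by
    rw [curveVelocity, curveVelocity, h.mfderiv_eq]
    rfl
  exact TotalSpace.ext h.eq_of_nhds (heq_of_eq h1)

variable [I.Boundaryless]

theorem ContMDiffAt.contDiffAt_extChartAt {γ : ℝ → M} {t : ℝ} {n : WithTop ℕ∞}
    (hn : n ≤ ∞) (h : ContMDiffAt 𝓘(ℝ, ℝ) I n γ t) {q : M} (hq : γ t ∈ (chartAt H q).source) :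
    ContDiffAt ℝ n (extChartAt I q ∘ γ) t := by
  rw [← contMDiffAt_iff_contDiffAt]
  exact ((contMDiffAt_extChartAt' (n := ∞) hq).of_le hn).comp t h

theorem deriv_extChartAt_comp {γ : ℝ → M} {t : ℝ} (h : MDifferentiableAt 𝓘(ℝ, ℝ) I γ t) {q : M}
    (hq : γ t ∈ (chartAt H q).source) :
    deriv (extChartAt I q ∘ γ) t =
      (trivializationAt E (TangentSpace I : M → Type _) q).continuousLinearMapAt ℝ (γ t)
        (curveVelocity I γ t) := by
  have h1 : mfderiv 𝓘(ℝ, ℝ) 𝓘(ℝ, E) (extChartAt I q ∘ γ) t =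
      mfderiv I 𝓘(ℝ, E) (extChartAt I q) (γ t) ∘L mfderiv 𝓘(ℝ, ℝ) I γ t :=
    mfderiv_comp t (mdifferentiableAt_extChartAt hq) h
  rw [TangentBundle.continuousLinearMapAt_trivializationAt hq, ← fderiv_apply_one_eq_deriv,
    ← mfderiv_eq_fderiv, h1]
  rfl

theorem coordField_deriv_extChartAt_comp {γ : ℝ → M} {t : ℝ}
    (h : MDifferentiableAt 𝓘(ℝ, ℝ) I γ t) {q : M} (hq : γ t ∈ (chartAt H q).source) :
    coordField I q (deriv (extChartAt I q ∘ γ) t) (γ t) = curveVelocity I γ t := by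
  rw [deriv_extChartAt_comp h hq, coordField_continuousLinearMapAt hq]

theorem curveVelocity_eq_zero_iff {γ : ℝ → M} {t : ℝ}
    (h : MDifferentiableAt 𝓘(ℝ, ℝ) I γ t) {q : M} (hq : γ t ∈ (chartAt H q).source) :
    curveVelocity I γ t = 0 ↔ deriv (extChartAt I q ∘ γ) t = 0 := by
  constructor <;> intro h0
  · rw [deriv_extChartAt_comp h hq, h0, map_zero]
  · rw [← coordField_deriv_extChartAt_comp h hq, h0, coordField, map_zero]

theorem curveLift_eq_iff {γ η : ℝ → M} {t : ℝ} (hγ : MDifferentiableAt 𝓘(ℝ, ℝ) I γ t)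
    (hη : MDifferentiableAt 𝓘(ℝ, ℝ) I η t) {q : M} (hq : γ t ∈ (chartAt H q).source) :
    curveLift I γ t = curveLift I η t ↔
      γ t = η t ∧ deriv (extChartAt I q ∘ γ) t = deriv (extChartAt I q ∘ η) t := by
  constructor
  · intro h
    have h1 : γ t = η t := congrArg TotalSpace.proj h
    refine ⟨h1, ?_⟩
    rw [deriv_extChartAt_comp hγ hq, deriv_extChartAt_comp hη (h1 ▸ hq)]
    exact congrArg (fun w : TangentBundle I M ↦ (trivializationAt E (TangentSpace I : M → Type _)
      q).continuousLinearMapAt ℝ w.1 w.2) h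
  · rintro ⟨h1, h2⟩
    rw [curveLift, curveLift, ← coordField_deriv_extChartAt_comp hγ hq,
      ← coordField_deriv_extChartAt_comp hη (h1 ▸ hq), h2]
    exact congrArg (fun x ↦ (⟨x, coordField I q (deriv (extChartAt I q ∘ η) t) x⟩ :
      TangentBundle I M)) h1

/-- The map `(t, c) ↦ c • γ'(t)` is of class `C¹` if `γ` is of class `C²`. -/
theorem contMDiffAt_smul_curveLift {γ : ℝ → M} {t c : ℝ} (h : ContMDiffAt 𝓘(ℝ, ℝ) I 2 γ t) :
    ContMDiffAt 𝓘(ℝ, ℝ × ℝ) I.tangent 1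
      (fun s : ℝ × ℝ ↦ (⟨γ s.1, s.2 • curveVelocity I γ s.1⟩ : TangentBundle I M)) (t, c) := by
  have hfst : ContMDiffAt 𝓘(ℝ, ℝ × ℝ) 𝓘(ℝ, ℝ) 1 (Prod.fst : ℝ × ℝ → ℝ) (t, c) :=
    contMDiffAt_iff_contDiffAt.2 contDiffAt_fst
  have hγ : ContMDiffAt 𝓘(ℝ, ℝ × ℝ) I 1 (fun s : ℝ × ℝ ↦ γ s.1) (t, c) :=
    ContMDiffAt.comp (t, c) (g := γ) (h.of_le (by norm_num)) hfst
  rw [contMDiffAt_totalSpace]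
  refine ⟨hγ, ?_⟩
  set q := γ t with hq
  have hd : ContDiffAt ℝ 1 (deriv (extChartAt I q ∘ γ)) t := by
    have h1 := h.contDiffAt_extChartAt (q := q) (by exact WithTop.coe_le_coe.2 le_top)
      (mem_chart_source H q)
    exact h1.derivWithin one_add_one_eq_two.le
  have hd' : ContDiffAt ℝ 1 (fun s : ℝ × ℝ ↦ s.2 • deriv (extChartAt I q ∘ γ) s.1) (t, c) :=
    contDiffAt_snd.smul (ContDiffAt.comp (t, c) (g := deriv (extChartAt I q ∘ γ)) hd contDiffAt_fst)
  refine (contMDiffAt_iff_contDiffAt.2 hd').congr_of_eventuallyEq ?_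
  have h2 : ∀ᶠ s in 𝓝 t, MDifferentiableAt 𝓘(ℝ, ℝ) I γ s ∧ γ s ∈ (chartAt H q).source := by
    have h3 := (contMDiffAt_iff_contMDiffAt_nhds (n := 1) (by simp)).1 (h.of_le (by norm_num))
    filter_upwards [h3, h.continuousAt.preimage_mem_nhds
      ((chartAt H q).open_source.mem_nhds (mem_chart_source H q))] with s hs hs'
    exact ⟨hs.mdifferentiableAt (by simp), hs'⟩
  filter_upwards [(continuousAt_fst (p := (t, c))).eventually h2] with s hs
  rw [deriv_extChartAt_comp hs.1 hs.2, ← map_smul]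
  rw [Trivialization.continuousLinearMapAt_apply, Trivialization.coe_linearMapAt_of_mem _ hs.2]

end Curves

section Geodesics

variable {E : Type*} [NormedAddCommGroup E] [NormedSpace ℝ E] [FiniteDimensional ℝ E]
  {H : Type*} [TopologicalSpace H] {I : ModelWithCorners ℝ E H} [I.Boundaryless]
  {M : Type*} [TopologicalSpace M] [ChartedSpace H M] [IsManifold I ∞ M]

namespace LinearConnection

/-- The geodesic equation in the preferred chart at `q`. -/
def GeodesicEquation (cov : LinearConnection I M) (γ : ℝ → M) (q : M) (t : ℝ) : Prop :=
  deriv (deriv (extChartAt I q ∘ γ)) t +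
    cov.christoffel q (γ t) (deriv (extChartAt I q ∘ γ) t) (deriv (extChartAt I q ∘ γ) t) = 0

/-- The geodesic equation does not depend on the chart. -/
theorem GeodesicEquation.chartChange {cov : LinearConnection I M} {γ : ℝ → M} {t : ℝ} {q q' : M}
    (hγ : ContMDiffAt 𝓘(ℝ, ℝ) I 2 γ t) (hq : γ t ∈ (chartAt H q).source)
    (hq' : γ t ∈ (chartAt H q').source) (h : cov.GeodesicEquation γ q t) :
    cov.GeodesicEquation γ q' t := by
  set c := extChartAt I q ∘ γ with hc
  set τ := _root_.chartChange I q q' with hτ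
  have hcd : ContDiffAt ℝ 2 c t :=
    hγ.contDiffAt_extChartAt (by exact WithTop.coe_le_coe.2 le_top) hq
  have hτd : ContDiffAt ℝ ∞ τ (c t) := contDiffAt_chartChange hq hq'
  have h1 : extChartAt I q' ∘ γ =ᶠ[𝓝 t] τ ∘ c := by
    filter_upwards [hγ.continuousAt.preimage_mem_nhds ((chartAt H q).open_source.mem_nhds hq)]
      with s hs
    have hs' : γ s ∈ (extChartAt I q).source := by rwa [extChartAt_source]
    simp only [hτ, hc, Function.comp_apply, (extChartAt I q).left_inv hs']
  have h2 : deriv (extChartAt I q' ∘ γ) =ᶠ[𝓝 t] fun s ↦ fderiv ℝ τ (c s) (deriv c s) := by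
    have hc1 : ∀ᶠ s in 𝓝 t, ContDiffAt ℝ 2 c s := hcd.eventually (by simp)
    have hτ1 : ∀ᶠ s in 𝓝 t, ContDiffAt ℝ 1 τ (c s) :=
      hcd.continuousAt.eventually ((hτd.of_le (m := 1) (by simp)).eventually (by simp))
    filter_upwards [h1.eventually_nhds, hc1, hτ1] with s hs hcs hτs
    rw [Filter.EventuallyEq.deriv_eq hs]
    exact fderiv_comp_deriv s (hτs.differentiableAt (by simp)) (hcs.differentiableAt (by simp))
  have hd1 : HasDerivAt c (deriv c t) t := (hcd.differentiableAt (by simp)).hasDerivAt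
  have hd2 : HasDerivAt (deriv c) (deriv (deriv c) t) t :=
    ((hcd.derivWithin (m := 1) one_add_one_eq_two.le).differentiableAt (by simp)).hasDerivAt
  have hd3 : HasFDerivAt (fderiv ℝ τ) (fderiv ℝ (fderiv ℝ τ) (c t)) (c t) :=
    ((hτd.fderiv_right (m := ∞) le_rfl).differentiableAt (by simp)).hasFDerivAt
  have hd4 : HasDerivAt (fun s ↦ fderiv ℝ τ (c s) (deriv c s))
      (fderiv ℝ (fderiv ℝ τ) (c t) (deriv c t) (deriv c t) + fderiv ℝ τ (c t) (deriv (deriv c) t))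
      t := (hd3.comp_hasDerivAt t hd1).clm_apply hd2
  have htr := cov.christoffel_chartChange hq hq' (deriv c t) (deriv c t)
  rw [tangentCoordChange_eq_fderiv] at htr
  change fderiv ℝ τ (c t) _ = cov.christoffel q' (γ t) (fderiv ℝ τ (c t) (deriv c t))
    (fderiv ℝ τ (c t) (deriv c t)) + fderiv ℝ (fderiv ℝ τ) (c t) (deriv c t) (deriv c t) at htr
  have h3 : deriv (deriv c) t = -cov.christoffel q (γ t) (deriv c t) (deriv c t) :=
    eq_neg_of_add_eq_zero_left h
  rw [GeodesicEquation, h2.deriv_eq, h2.eq_of_nhds, hd4.deriv, h3, map_neg, htr]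
  abel

theorem IsGeodesicOn.contMDiffAt {cov : LinearConnection I M} {γ : ℝ → M} {J : Set ℝ}
    (h : cov.IsGeodesicOn γ J) {t : ℝ} (ht : t ∈ J) : ContMDiffAt 𝓘(ℝ, ℝ) I 2 γ t :=
  h.contMDiffOn.contMDiffAt (h.isOpen.mem_nhds ht)

theorem IsGeodesicOn.mdifferentiableAt {cov : LinearConnection I M} {γ : ℝ → M} {J : Set ℝ}
    (h : cov.IsGeodesicOn γ J) {t : ℝ} (ht : t ∈ J) : MDifferentiableAt 𝓘(ℝ, ℝ) I γ t :=
  (h.contMDiffAt ht).mdifferentiableAt (by simp)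

/-- A curve which near each point of an interval agrees with a geodesic is a geodesic. -/
theorem isGeodesicOn_of_locally {cov : LinearConnection I M} {γ : ℝ → M} {J : Set ℝ}
    (hJ : IsOpen J) (hJ' : J.OrdConnected)
    (h : ∀ t ∈ J, ∃ (η : ℝ → M) (J' : Set ℝ), cov.IsGeodesicOn η J' ∧ t ∈ J' ∧ γ =ᶠ[𝓝 t] η) :
    cov.IsGeodesicOn γ J where
  isOpen := hJ
  ordConnected := hJ'
  contMDiffOn t ht := by
    obtain ⟨η, J', hη, ht', hγη⟩ := h t ht
    exact ((hη.contMDiffAt ht').congr_of_eventuallyEq hγη).contMDiffWithinAt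
  equation q t ht hq := by
    obtain ⟨η, J', hη, ht', hγη⟩ := h t ht
    have h1 : extChartAt I q ∘ γ =ᶠ[𝓝 t] extChartAt I q ∘ η := hγη.fun_comp _
    rw [h1.deriv.deriv_eq, h1.deriv_eq, hγη.eq_of_nhds]
    exact hη.equation q t ht' (hγη.eq_of_nhds ▸ hq)

/-- The geodesic spray in the preferred chart at `q`. -/
def spray (cov : LinearConnection I M) (q : M) (p : E × E) : E × E :=
  (p.2, -∑ i, (Module.finBasis ℝ E).repr p.2 i •
    cov.christoffelCLM q (Module.finBasis ℝ E i) ((extChartAt I q).symm p.1) p.2)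

theorem spray_eq (cov : LinearConnection I M) {q : M} {p : E × E}
    (hp : (extChartAt I q).symm p.1 ∈ (chartAt H q).source) :
    cov.spray q p = (p.2, -cov.christoffel q ((extChartAt I q).symm p.1) p.2 p.2) := by
  rw [spray, cov.christoffel_eq_sum (Module.finBasis ℝ E) hp]
  rfl

theorem contDiffAt_spray [T2Space M] (cov : LinearConnection I M)
    [cov.ContMDiffCovariantDerivative ∞] (q : M) (v : E) :
    ContDiffAt ℝ 1 (cov.spray q) (extChartAt I q q, v) := by
  have h1 : ∀ i, ContDiffAt ℝ 1 (fun p : E × E ↦ cov.christoffelCLM q (Module.finBasis ℝ E i)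
      ((extChartAt I q).symm p.1)) (extChartAt I q q, v) := by
    intro i
    have h2 : ContMDiffAt 𝓘(ℝ, E) I ∞ (extChartAt I q).symm (extChartAt I q q) := by
      have h := contMDiffWithinAt_extChartAt_symm_range (I := I) (n := ∞) q
        (mem_extChartAt_target (I := I) q)
      rwa [I.range_eq_univ, contMDiffWithinAt_univ] at h
    have h3 : ContMDiffAt 𝓘(ℝ, E) 𝓘(ℝ, E →L[ℝ] E) ∞
        (cov.christoffelCLM q (Module.finBasis ℝ E i) ∘ (extChartAt I q).symm)
        (extChartAt I q q) := by
      refine ContMDiffAt.comp _ ?_ h2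
      rw [(extChartAt I q).left_inv (mem_extChartAt_source q)]
      exact cov.contMDiffAt_christoffelCLM q _
    exact ContDiffAt.comp (extChartAt I q q, v) (g := cov.christoffelCLM q (Module.finBasis ℝ E i) ∘
      (extChartAt I q).symm) ((contMDiffAt_iff_contDiffAt.1 h3).of_le (by simp)) contDiffAt_fst
  refine contDiffAt_snd.prodMk (ContDiffAt.neg (ContDiffAt.sum fun i _ ↦ ?_))
  refine ContDiffAt.smul ?_ ((h1 i).clm_apply contDiffAt_snd)
  exact (LinearMap.toContinuousLinearMap ((Module.finBasis ℝ E).coord i)).contDiff.contDiffAt.comp _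
    contDiffAt_snd

/-- In a chart, a geodesic and its velocity form an integral curve of the spray. -/
theorem IsGeodesicOn.hasDerivAt_spray {cov : LinearConnection I M} {γ : ℝ → M} {J : Set ℝ}
    (h : cov.IsGeodesicOn γ J) {t : ℝ} (ht : t ∈ J) {q : M} (hq : γ t ∈ (chartAt H q).source) :
    HasDerivAt (fun s ↦ (extChartAt I q (γ s), deriv (extChartAt I q ∘ γ) s))
      (cov.spray q (extChartAt I q (γ t), deriv (extChartAt I q ∘ γ) t)) t := by
  have hcd : ContDiffAt ℝ 2 (extChartAt I q ∘ γ) t :=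
    (h.contMDiffAt ht).contDiffAt_extChartAt (by exact WithTop.coe_le_coe.2 le_top) hq
  have h1 : (extChartAt I q).symm (extChartAt I q (γ t)) = γ t :=
    (extChartAt I q).left_inv ((extChartAt_source I q).symm ▸ hq)
  have h2 := eq_neg_of_add_eq_zero_left (h.equation q t ht hq)
  rw [cov.spray_eq (p := (extChartAt I q (γ t), deriv (extChartAt I q ∘ γ) t)) (h1.symm ▸ hq), h1,
    ← h2]
  exact (hcd.differentiableAt (by simp)).hasDerivAt.prodMk
    ((hcd.derivWithin (m := 1) one_add_one_eq_two.le).differentiableAt (by simp)).hasDerivAt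

/-- Local uniqueness of geodesics. -/
theorem IsGeodesicOn.eventuallyEq [T2Space M] {cov : LinearConnection I M}
    [cov.ContMDiffCovariantDerivative ∞] {γ η : ℝ → M} {J J' : Set ℝ}
    (hγ : cov.IsGeodesicOn γ J) (hη : cov.IsGeodesicOn η J') {t : ℝ} (ht : t ∈ J) (ht' : t ∈ J')
    (h : curveLift I γ t = curveLift I η t) : γ =ᶠ[𝓝 t] η := by
  set q := γ t with hq
  have hqs : γ t ∈ (chartAt H q).source := mem_chart_source H q
  obtain ⟨h1, h2⟩ := (curveLift_eq_iff (hγ.mdifferentiableAt ht) (hη.mdifferentiableAt ht') hqs).1 h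
  have hqs' : η t ∈ (chartAt H q).source := h1 ▸ hqs
  obtain ⟨K, s, hs, hK⟩ := (cov.contDiffAt_spray q
    (deriv (extChartAt I q ∘ γ) t)).exists_lipschitzOnWith
  have key : ∀ {ζ : ℝ → M} {J'' : Set ℝ}, cov.IsGeodesicOn ζ J'' → t ∈ J'' → γ t = ζ t →
      deriv (extChartAt I q ∘ γ) t = deriv (extChartAt I q ∘ ζ) t →
      ∀ᶠ r in 𝓝 t, ζ r ∈ (chartAt H q).source ∧
        (HasDerivAt (fun s ↦ (extChartAt I q (ζ s), deriv (extChartAt I q ∘ ζ) s))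
          (cov.spray q (extChartAt I q (ζ r), deriv (extChartAt I q ∘ ζ) r)) r ∧
          (extChartAt I q (ζ r), deriv (extChartAt I q ∘ ζ) r) ∈ s) := by
    intro ζ J'' hζ htζ h3 h4
    have hζs : ζ t ∈ (chartAt H q).source := h3 ▸ hqs
    have hcont := (hζ.hasDerivAt_spray htζ hζs).continuousAt
    have hs' : s ∈ 𝓝 (extChartAt I q (ζ t), deriv (extChartAt I q ∘ ζ) t) := by
      rw [← h4, ← h3]; exact hs
    filter_upwards [hζ.isOpen.mem_nhds htζ, (hζ.contMDiffAt htζ).continuousAt.preimage_mem_nhds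
      ((chartAt H q).open_source.mem_nhds hζs), hcont.preimage_mem_nhds hs'] with r hr hr' hr''
    exact ⟨hr', hζ.hasDerivAt_spray hr hr', hr''⟩
  have kγ := key hγ ht rfl rfl
  have kη := key hη ht' h1 h2
  have h5 := ODE_solution_unique_of_eventually (v := fun _ ↦ cov.spray q) (s := fun _ ↦ s)
    (Filter.Eventually.of_forall fun _ ↦ hK) (kγ.mono fun r hr ↦ hr.2) (kη.mono fun r hr ↦ hr.2)
    (Prod.ext (congrArg (extChartAt I q) h1) h2)
  filter_upwards [h5, kγ, kη] with r hr hrγ hrη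
  exact (extChartAt I q).injOn ((extChartAt_source I q).symm ▸ hrγ.1)
    ((extChartAt_source I q).symm ▸ hrη.1) (congrArg Prod.fst hr)

/-- Local existence of geodesics. -/
theorem exists_isGeodesicOn [T2Space M] (cov : LinearConnection I M)
    [cov.ContMDiffCovariantDerivative ∞] (w : TangentBundle I M) :
    ∃ (γ : ℝ → M) (J : Set ℝ), cov.IsGeodesicOn γ J ∧ 0 ∈ J ∧ curveLift I γ 0 = w := by
  obtain ⟨q, w⟩ := w
  set v : E := (trivializationAt E (TangentSpace I : M → Type _) q).continuousLinearMapAt ℝ q w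
    with hv
  have hqs : q ∈ (chartAt H q).source := mem_chart_source H q
  have hspray := cov.contDiffAt_spray q v
  obtain ⟨α, hα0, ε, hε, hα⟩ :=
    hspray.exists_forall_mem_closedBall_exists_eq_forall_mem_Ioo_hasDerivAt₀ 0
  have h0 : (0 : ℝ) ∈ Ioo (0 - ε) (0 + ε) := by constructor <;> linarith
  have hcont : ContinuousAt α 0 := (hα 0 h0).continuousAt
  have hfst : ContinuousAt (fun t ↦ (α t).1) 0 := continuousAt_fst.comp hcont
  have hev : ∀ᶠ t in 𝓝 (0 : ℝ), t ∈ Ioo (0 - ε) (0 + ε) ∧ (α t).1 ∈ (extChartAt I q).target ∧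
      ContDiffAt ℝ 1 (cov.spray q) (α t) := by
    have hIoo : ∀ᶠ t in 𝓝 (0 : ℝ), t ∈ Ioo (0 - ε) (0 + ε) := Ioo_mem_nhds h0.1 h0.2
    refine hIoo.and (Filter.Eventually.and ?_ ?_)
    · refine hfst.eventually ?_
      simp only [hα0]
      exact extChartAt_target_mem_nhds q
    · refine hcont.eventually ?_
      rw [hα0]
      exact hspray.eventually (by simp)
  obtain ⟨δ, hδ, hδs⟩ := Metric.eventually_nhds_iff_ball.1 hev
  let J : Set ℝ := Metric.ball 0 δ
  have hJo : IsOpen J := Metric.isOpen_ball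
  let γ : ℝ → M := fun t ↦ (extChartAt I q).symm (α t).1
  have hγs : ∀ t ∈ J, γ t ∈ (chartAt H q).source := fun t ht ↦ by
    rw [← extChartAt_source I]
    exact (extChartAt I q).map_target (hδs t ht).2.1
  have hγc : ∀ t ∈ J, extChartAt I q (γ t) = (α t).1 := fun t ht ↦
    (extChartAt I q).right_inv (hδs t ht).2.1
  have hd : ∀ t ∈ J, HasDerivAt α (cov.spray q (α t)) t := fun t ht ↦ hα t (hδs t ht).1
  have hd1 : ∀ t ∈ J, HasDerivAt (fun s ↦ (α s).1) (α t).2 t := fun t ht ↦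
    (hasFDerivAt_fst (𝕜 := ℝ) (p := α t)).comp_hasDerivAt t (hd t ht)
  have hd2 : ∀ t ∈ J, HasDerivAt (fun s ↦ (α s).2) (cov.spray q (α t)).2 t := fun t ht ↦
    (hasFDerivAt_snd (𝕜 := ℝ) (p := α t)).comp_hasDerivAt t (hd t ht)
  have hα1 : ContDiffOn ℝ 1 α J := by
    rw [← zero_add (1 : WithTop ℕ∞), contDiffOn_succ_iff_deriv_of_isOpen hJo]
    refine ⟨fun t ht ↦ (hd t ht).differentiableAt.differentiableWithinAt, by simp, ?_⟩
    rw [contDiffOn_zero]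
    refine ContinuousOn.congr (f := fun t ↦ cov.spray q (α t)) ?_ (fun t ht ↦ (hd t ht).deriv)
    intro t ht
    exact (ContinuousAt.comp (f := α) (hδs t ht).2.2.continuousAt
      (hd t ht).continuousAt).continuousWithinAt
  have hα2 : ContDiffOn ℝ 2 (fun t ↦ (α t).1) J := by
    rw [← one_add_one_eq_two, contDiffOn_succ_iff_deriv_of_isOpen hJo]
    refine ⟨fun t ht ↦ (hd1 t ht).differentiableAt.differentiableWithinAt, by simp, ?_⟩
    exact (contDiff_snd.comp_contDiffOn hα1).congr (fun t ht ↦ (hd1 t ht).deriv)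
  have hγ2 : ContMDiffOn 𝓘(ℝ, ℝ) I 2 γ J :=
    ((contMDiffOn_extChartAt_symm (n := ∞) q).of_le
      (by exact WithTop.coe_le_coe.2 le_top)).comp (contMDiffOn_iff_contDiffOn.2 hα2)
      (fun t ht ↦ (hδs t ht).2.1)
  have hc : ∀ t ∈ J, extChartAt I q ∘ γ =ᶠ[𝓝 t] fun s ↦ (α s).1 := fun t ht ↦ by
    filter_upwards [hJo.mem_nhds ht] with s hs
    exact hγc s hs
  have hc1 : ∀ t ∈ J, deriv (extChartAt I q ∘ γ) t = (α t).2 := fun t ht ↦ by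
    rw [(hc t ht).deriv_eq, (hd1 t ht).deriv]
  have h0J : (0 : ℝ) ∈ J := Metric.mem_ball_self hδ
  refine ⟨γ, J, ⟨hJo, (convex_ball _ _).ordConnected, hγ2, ?_⟩, h0J, ?_⟩
  · intro q' t ht hq'
    refine GeodesicEquation.chartChange (q := q) (hγ2.contMDiffAt (hJo.mem_nhds ht)) (hγs t ht) hq'
      ?_
    have h3 : deriv (extChartAt I q ∘ γ) =ᶠ[𝓝 t] fun s ↦ (α s).2 := by
      filter_upwards [hJo.mem_nhds ht] with s hs
      exact hc1 s hs
    rw [GeodesicEquation, h3.deriv_eq, h3.eq_of_nhds, (hd2 t ht).deriv, cov.spray_eq (hγs t ht)]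
    exact neg_add_cancel _
  · have h4 : γ 0 = q := by
      change (extChartAt I q).symm (α 0).1 = q
      rw [hα0]
      exact (extChartAt I q).left_inv (mem_extChartAt_source q)
    have h5 := coordField_deriv_extChartAt_comp (I := I)
      ((hγ2.contMDiffAt (hJo.mem_nhds h0J)).mdifferentiableAt (by simp)) (hγs 0 h0J)
    rw [curveLift, ← h5, hc1 0 h0J, hα0]
    change (⟨γ 0, coordField I q v (γ 0)⟩ : TangentBundle I M) = _
    rw [h4, hv, coordField_continuousLinearMapAt hqs]

end LinearConnection

end Geodesics

section GeodesicFlow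

variable {E : Type*} [NormedAddCommGroup E] [NormedSpace ℝ E]
  {H : Type*} [TopologicalSpace H] {I : ModelWithCorners ℝ E H}
  {M : Type*} [TopologicalSpace M] [ChartedSpace H M] [IsManifold I ∞ M]

theorem t2Space_tangentBundle [T2Space M] : T2Space (TangentBundle I M) where
  t2 v w hvw := by
    by_cases hp : v.proj = w.proj
    · set e := trivializationAt E (TangentSpace I : M → Type _) v.proj with he
      have hv : v ∈ e.source := FiberBundle.mem_trivializationAt_proj_source
      have hw : w ∈ e.source := by
        rw [e.mem_source, ← hp]
        exact e.mem_source.1 hv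
      obtain ⟨a, b, ha, hb, hva, hwb, hab⟩ := t2_separation fun h ↦ hvw (e.injOn hv hw h)
      exact ⟨e.source ∩ e ⁻¹' a, e.source ∩ e ⁻¹' b,
        e.continuousOn.isOpen_inter_preimage e.open_source ha,
        e.continuousOn.isOpen_inter_preimage e.open_source hb, ⟨hv, hva⟩, ⟨hw, hwb⟩,
        (hab.preimage e).mono inter_subset_right inter_subset_right⟩
    · exact separated_by_continuous (FiberBundle.continuous_proj E (TangentSpace I : M → Type _)) hp

variable (I) in
/-- The vectors proportional to the velocity of a curve. -/
def scaledLift (γ : ℝ → M) (s : ℝ × ℝ) : TangentBundle I M := ⟨γ s.1, s.2 • curveVelocity I γ s.1⟩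

theorem scaledLift_one (γ : ℝ → M) (t : ℝ) : scaledLift I γ (t, 1) = curveLift I γ t := by
  rw [scaledLift, one_smul, curveLift]

theorem curveVelocity_eq_zero_iff_of_curveLift_eq {γ η : ℝ → M} {t t' : ℝ} (h : curveLift I γ t = curveLift I η t') :
    curveVelocity I γ t = 0 ↔ curveVelocity I η t' = 0 :=
  iff_of_eq (congrArg (fun w : TangentBundle I M ↦ w.2 = 0) h)

theorem curveLift_comp_affine {γ : ℝ → M} {a b s : ℝ}
    (h : MDifferentiableAt 𝓘(ℝ, ℝ) I γ (a * s + b)) :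
    curveLift I (fun s ↦ γ (a * s + b)) s = scaledLift I γ (a * s + b, a) := by
  have h1 : HasDerivAt (fun s : ℝ ↦ a * s + b) a s := by
    simpa using ((hasDerivAt_id s).const_mul a).add_const b
  have h2 : MDifferentiableAt 𝓘(ℝ, ℝ) 𝓘(ℝ, ℝ) (fun s : ℝ ↦ a * s + b) s :=
    h1.differentiableAt.mdifferentiableAt
  have h3 : mfderiv 𝓘(ℝ, ℝ) I (fun s ↦ γ (a * s + b)) s =
      (mfderiv 𝓘(ℝ, ℝ) I γ (a * s + b)).comp (mfderiv 𝓘(ℝ, ℝ) 𝓘(ℝ, ℝ) (fun s : ℝ ↦ a * s + b) s) :=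
    mfderiv_comp (I := 𝓘(ℝ, ℝ)) (I' := 𝓘(ℝ, ℝ)) (I'' := I) (g := γ) s h h2
  have h4 : mfderiv 𝓘(ℝ, ℝ) 𝓘(ℝ, ℝ) (fun s : ℝ ↦ a * s + b) s (1 : ℝ) = a := by
    rw [mfderiv_eq_fderiv]
    exact h1.deriv
  have h5 : curveVelocity I (fun s ↦ γ (a * s + b)) s = a • curveVelocity I γ (a * s + b) := by
    rw [curveVelocity, h3]
    change mfderiv 𝓘(ℝ, ℝ) I γ (a * s + b)
      (mfderiv 𝓘(ℝ, ℝ) 𝓘(ℝ, ℝ) (fun s : ℝ ↦ a * s + b) s (1 : ℝ)) = _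
    rw [h4]
    exact (congrArg (mfderiv 𝓘(ℝ, ℝ) I γ (a * s + b)) (mul_one a).symm).trans
      ((mfderiv 𝓘(ℝ, ℝ) I γ (a * s + b)).map_smul a (1 : ℝ))
  exact TotalSpace.ext rfl (heq_of_eq h5)

variable [FiniteDimensional ℝ E] [I.Boundaryless]

namespace LinearConnection

variable {cov : LinearConnection I M}

theorem IsGeodesicOn.continuousOn_curveLift {γ : ℝ → M} {J : Set ℝ} (h : cov.IsGeodesicOn γ J) :
    ContinuousOn (curveLift I γ) J := by
  intro t ht
  have h1 : ContinuousAt (fun s : ℝ ↦ scaledLift I γ (s, 1)) t :=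
    ContinuousAt.comp (f := fun s : ℝ ↦ (s, (1 : ℝ)))
      (contMDiffAt_smul_curveLift (c := 1) (h.contMDiffAt ht)).continuousAt
      (continuousAt_id.prodMk continuousAt_const)
  simp only [scaledLift_one] at h1
  exact h1.continuousWithinAt

theorem christoffel_smul_smul {q x : M} (hx : x ∈ (chartAt H q).source) (a : ℝ) (v : E) :
    cov.christoffel q x (a • v) (a • v) = (a * a) • cov.christoffel q x v v := by
  rw [← christoffelCLM_apply, map_smul, christoffelCLM_apply,
    cov.christoffel_eq_sum (Module.finBasis ℝ E) hx,
    cov.christoffel_eq_sum (Module.finBasis ℝ E) hx v v, Finset.smul_sum, Finset.smul_sum]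
  refine Finset.sum_congr rfl fun i _ ↦ ?_
  rw [map_smul, Finsupp.smul_apply, smul_smul, smul_smul, smul_eq_mul]
  ring_nf

/-- Affine reparametrizations of geodesics are geodesics. -/
theorem IsGeodesicOn.comp_affine {γ : ℝ → M} {J : Set ℝ} (h : cov.IsGeodesicOn γ J) (a b : ℝ) :
    cov.IsGeodesicOn (fun s ↦ γ (a * s + b)) ((fun s ↦ a * s + b) ⁻¹' J) where
  isOpen := h.isOpen.preimage (by fun_prop)
  ordConnected := by
    rw [← convex_iff_ordConnected]
    have h1 := (convex_iff_ordConnected.2 h.ordConnected).affine_preimage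
      (a • AffineMap.id ℝ ℝ + AffineMap.const ℝ ℝ b)
    exact h1
  contMDiffOn := h.contMDiffOn.comp (t := J) (f := fun s ↦ a * s + b)
    (contMDiffOn_iff_contDiffOn.2 (ContDiff.contDiffOn (by fun_prop))) (fun _ hs ↦ hs)
  equation q s hs hq := by
    set c := extChartAt I q ∘ γ with hc
    have h2 : ContDiffAt ℝ 2 c (a * s + b) :=
      (h.contMDiffAt hs).contDiffAt_extChartAt (by exact WithTop.coe_le_coe.2 le_top) hq
    have h3 : ∀ r : ℝ, HasDerivAt (fun s : ℝ ↦ a * s + b) a r := fun r ↦ by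
      simpa using ((hasDerivAt_id r).const_mul a).add_const b
    have h4 : ∀ᶠ r in 𝓝 s, ContDiffAt ℝ 2 c (a * r + b) :=
      (h3 s).continuousAt.eventually (h2.eventually (by simp))
    have h5 : deriv (extChartAt I q ∘ fun s ↦ γ (a * s + b)) =ᶠ[𝓝 s]
        fun r ↦ a • deriv c (a * r + b) := by
      filter_upwards [h4] with r hr
      exact ((hr.differentiableAt (by simp)).hasDerivAt.scomp r (h3 r)).deriv
    have h6 : HasDerivAt (fun r ↦ a • deriv c (a * r + b))
        (a • a • deriv (deriv c) (a * s + b)) s :=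
      (((h2.derivWithin (m := 1) one_add_one_eq_two.le).differentiableAt
        (by simp)).hasDerivAt.scomp s (h3 s)).const_smul a
    rw [h5.deriv_eq, h5.eq_of_nhds, h6.deriv, christoffel_smul_smul hq, smul_smul, ← smul_add,
      h.equation q _ hs hq, smul_zero]

variable [T2Space M] [cov.ContMDiffCovariantDerivative ∞]

/-- Global uniqueness of geodesics. -/
theorem IsGeodesicOn.eqOn_curveLift {γ η : ℝ → M} {J J' : Set ℝ} (hγ : cov.IsGeodesicOn γ J)
    (hη : cov.IsGeodesicOn η J') {t : ℝ} (ht : t ∈ J) (ht' : t ∈ J')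
    (h : curveLift I γ t = curveLift I η t) :
    EqOn (curveLift I γ) (curveLift I η) (J ∩ J') := by
  have := t2Space_tangentBundle (I := I) (M := M)
  have hconn : IsPreconnected (J ∩ J') :=
    isPreconnected_iff_ordConnected.2 (hγ.ordConnected.inter hη.ordConnected)
  let u : Set ℝ := {s | s ∈ J ∩ J' ∧ curveLift I γ s = curveLift I η s}
  have hu : IsOpen u := by
    rw [isOpen_iff_mem_nhds]
    rintro s ⟨hs, hs'⟩
    filter_upwards [(hγ.eventuallyEq hη hs.1 hs.2 hs').eventually_nhds, hγ.isOpen.mem_nhds hs.1,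
      hη.isOpen.mem_nhds hs.2] with r hr hr1 hr2
    exact ⟨⟨hr1, hr2⟩, curveLift_congr hr⟩
  let v : Set ℝ := (J ∩ J') ∩ (fun s ↦ (curveLift I γ s, curveLift I η s)) ⁻¹' (diagonal _)ᶜ
  have hv : IsOpen v :=
    ((hγ.continuousOn_curveLift.mono inter_subset_left).prodMk
      (hη.continuousOn_curveLift.mono inter_subset_right)).isOpen_inter_preimage
      (hγ.isOpen.inter hη.isOpen) isClosed_diagonal.isOpen_compl
  have hsub : J ∩ J' ⊆ u := by
    refine hconn.subset_left_of_subset_union hu hv ?_ ?_ ⟨t, ⟨ht, ht'⟩, ⟨ht, ht'⟩, h⟩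
    · rw [disjoint_left]
      exact fun s hs hs' ↦ hs'.2 hs.2
    · intro s hs
      by_cases h' : curveLift I γ s = curveLift I η s
      · exact Or.inl ⟨hs, h'⟩
      · exact Or.inr ⟨hs, h'⟩
  exact fun s hs ↦ (hsub hs).2

/-- A geodesic whose velocity vanishes once is constant. -/
theorem IsGeodesicOn.curveVelocity_eq_zero {γ : ℝ → M} {J : Set ℝ} (hγ : cov.IsGeodesicOn γ J)
    {s t : ℝ} (hs : s ∈ J) (ht : t ∈ J) (h : curveVelocity I γ s = 0) :
    curveVelocity I γ t = 0 := by
  have hη := hγ.comp_affine 0 s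
  have hmem : ∀ r, (0 : ℝ) * r + s ∈ J := fun r ↦ by rwa [zero_mul, zero_add]
  have h1 : ∀ r, curveLift I (fun r ↦ γ (0 * r + s)) r = ⟨γ s, 0⟩ := by
    intro r
    rw [curveLift_comp_affine (hγ.mdifferentiableAt (hmem r)), scaledLift, zero_smul]
    exact congrArg (fun r ↦ (⟨γ r, 0⟩ : TangentBundle I M)) (by ring)
  have h2 : curveLift I γ s = ⟨γ s, 0⟩ := by rw [curveLift, h]
  have h3 := hγ.eqOn_curveLift hη hs (hmem s) (h2.trans (h1 s).symm) ⟨ht, hmem t⟩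
  have h4 : curveVelocity I (fun r ↦ γ (0 * r + s)) t = 0 :=
    (congrArg (fun w : TangentBundle I M ↦ w.2 = 0) (h1 t)).mpr rfl
  exact (curveVelocity_eq_zero_iff_of_curveLift_eq h3).2 h4

theorem exists_isGeodesicOn_union {γ η : ℝ → M} {J J' : Set ℝ} (hγ : cov.IsGeodesicOn γ J)
    (hη : cov.IsGeodesicOn η J') {t : ℝ} (ht : t ∈ J) (ht' : t ∈ J')
    (h : curveLift I γ t = curveLift I η t) :
    ∃ ζ : ℝ → M, cov.IsGeodesicOn ζ (J ∪ J') ∧ EqOn ζ γ J ∧ EqOn ζ η J' := by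
  classical
  have heq := hγ.eqOn_curveLift hη ht ht' h
  let ζ : ℝ → M := J.piecewise γ η
  have h1 : EqOn ζ γ J := piecewise_eqOn _ _ _
  have h2 : EqOn ζ η J' := by
    intro s hs
    by_cases hsJ : s ∈ J
    · exact (h1 hsJ).trans (congrArg TotalSpace.proj (heq ⟨hsJ, hs⟩))
    · exact piecewise_eq_of_notMem _ _ _ hsJ
  refine ⟨ζ, isGeodesicOn_of_locally (hγ.isOpen.union hη.isOpen) ?_ ?_, h1, h2⟩
  · exact isPreconnected_iff_ordConnected.1 (IsPreconnected.union t ht ht'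
      (isPreconnected_iff_ordConnected.2 hγ.ordConnected)
      (isPreconnected_iff_ordConnected.2 hη.ordConnected))
  · rintro s (hs | hs)
    · exact ⟨γ, J, hγ, hs, h1.eventuallyEq_of_mem (hγ.isOpen.mem_nhds hs)⟩
    · exact ⟨η, J', hη, hs, h2.eventuallyEq_of_mem (hη.isOpen.mem_nhds hs)⟩

variable (cov) in
/-- Existence of the maximal geodesic with given initial velocity. -/
theorem exists_isGeodesicOn_maximal (w : TangentBundle I M) :
    ∃ (Γ : ℝ → M) (J : Set ℝ), cov.IsGeodesicOn Γ J ∧ 0 ∈ J ∧ curveLift I Γ 0 = w ∧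
      ∀ (γ : ℝ → M) (J' : Set ℝ), cov.IsGeodesicOn γ J' → 0 ∈ J' → curveLift I γ 0 = w →
        J' ⊆ J ∧ EqOn γ Γ J' := by
  let P : (ℝ → M) → Set ℝ → Prop := fun γ J ↦
    cov.IsGeodesicOn γ J ∧ 0 ∈ J ∧ curveLift I γ 0 = w
  let J : Set ℝ := {t | ∃ γ J', P γ J' ∧ t ∈ J'}
  have hx : Nonempty M := ⟨w.proj⟩
  have hch : ∀ t, ∃ x : M, ∀ γ J', P γ J' → t ∈ J' → γ t = x := by
    intro t
    by_cases ht : ∃ γ J', P γ J' ∧ t ∈ J'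
    · obtain ⟨γ, J', hP, htJ⟩ := ht
      refine ⟨γ t, fun η J'' hη htη ↦ ?_⟩
      exact congrArg TotalSpace.proj (hη.1.eqOn_curveLift hP.1 hη.2.1 hP.2.1
        (hη.2.2.trans hP.2.2.symm) ⟨htη, htJ⟩)
    · exact ⟨hx.some, fun γ J' hP htJ ↦ absurd ⟨γ, J', hP, htJ⟩ ht⟩
  choose Γ hΓ using hch
  have hΓeq : ∀ γ J', P γ J' → EqOn γ Γ J' := fun γ J' hP t ht ↦ hΓ t γ J' hP ht
  obtain ⟨γ₀, J₀, hγ₀, h0, hw⟩ := cov.exists_isGeodesicOn w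
  have hP₀ : P γ₀ J₀ := ⟨hγ₀, h0, hw⟩
  refine ⟨Γ, J, isGeodesicOn_of_locally ?_ ?_ ?_, ⟨γ₀, J₀, hP₀, h0⟩, ?_, ?_⟩
  · rw [isOpen_iff_mem_nhds]
    rintro t ⟨γ, J', hP, ht⟩
    filter_upwards [hP.1.isOpen.mem_nhds ht] with s hs
    exact ⟨γ, J', hP, hs⟩
  · rw [← isPreconnected_iff_ordConnected]
    refine isPreconnected_of_forall 0 ?_
    rintro t ⟨γ, J', hP, ht⟩
    exact ⟨J', fun s hs ↦ ⟨γ, J', hP, hs⟩, hP.2.1, ht,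
      isPreconnected_iff_ordConnected.2 hP.1.ordConnected⟩
  · rintro t ⟨γ, J', hP, ht⟩
    exact ⟨γ, J', hP.1, ht,
      (hΓeq γ J' hP).symm.eventuallyEq_of_mem (hP.1.isOpen.mem_nhds ht)⟩
  · rw [← hw]
    exact curveLift_congr ((hΓeq γ₀ J₀ hP₀).symm.eventuallyEq_of_mem (hγ₀.isOpen.mem_nhds h0))
  · intro γ J' h1 h2 h3
    exact ⟨fun s hs ↦ ⟨γ, J', ⟨h1, h2, h3⟩, hs⟩, hΓeq γ J' ⟨h1, h2, h3⟩⟩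

end LinearConnection

end GeodesicFlow

section GeodesicFibers

variable {E : Type*} [NormedAddCommGroup E] [NormedSpace ℝ E]
  {H : Type*} [TopologicalSpace H] {I : ModelWithCorners ℝ E H}
  {M : Type*} [TopologicalSpace M] [ChartedSpace H M] [IsManifold I ∞ M]

namespace LinearConnection

variable {cov : LinearConnection I M}

/-- Functions on the space of geodesics are invariant functions on the reduced tangent bundle. -/
theorem exists_comp_toGeodesic_eq {α : Type*} {P : ReducedTangentBundle I M → α}
    (h₁ : ∀ v w, Proportional v w → P v = P w)
    (h₂ : ∀ (γ : ℝ → M) (J : Set ℝ), cov.IsGeodesicOn γ J → ∀ s ∈ J, ∀ t ∈ J,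
      ∀ (hs : curveVelocity I γ s ≠ 0) (ht : curveVelocity I γ t ≠ 0),
        P ⟨curveLift I γ s, hs⟩ = P ⟨curveLift I γ t, ht⟩) :
    ∃ g : cov.GeodesicSpace → α, ∀ v, g (cov.toGeodesic v) = P v := by
  refine ⟨Quot.lift (Quot.lift P h₁) ?_, fun v ↦ rfl⟩
  rintro _ _ ⟨γ, J, hγ, s, hsJ, t, htJ, hs, ht, rfl, rfl⟩
  exact h₂ γ J hγ s hsJ t htJ hs ht

theorem toGeodesic_eq_of_proportional {v w : ReducedTangentBundle I M} (h : Proportional v w) :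
    cov.toGeodesic v = cov.toGeodesic w :=
  congrArg (Quot.mk _) (Quot.sound h)

theorem IsGeodesicOn.toGeodesic_eq {γ : ℝ → M} {J : Set ℝ} (h : cov.IsGeodesicOn γ J) {s t : ℝ}
    (hsJ : s ∈ J) (htJ : t ∈ J) (hs : curveVelocity I γ s ≠ 0) (ht : curveVelocity I γ t ≠ 0) :
    cov.toGeodesic ⟨curveLift I γ s, hs⟩ = cov.toGeodesic ⟨curveLift I γ t, ht⟩ :=
  Quot.sound ⟨γ, J, h, s, hsJ, t, htJ, hs, ht, rfl, rfl⟩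

theorem toGeodesic_surjective : Function.Surjective cov.toGeodesic := by
  rintro ⟨⟨v⟩⟩
  exact ⟨v, rfl⟩

theorem continuous_toGeodesic : Continuous cov.toGeodesic :=
  continuous_quot_mk.comp continuous_quot_mk

theorem isQuotientMap_toGeodesic : Topology.IsQuotientMap cov.toGeodesic :=
  isQuotientMap_quot_mk.comp isQuotientMap_quot_mk

end LinearConnection

theorem contMDiffAt_subtypeVal_comp_iff {F : Type*} [NormedAddCommGroup F] [NormedSpace ℝ F]
    {K : Type*} [TopologicalSpace K] {J : ModelWithCorners ℝ F K}
    {X : Type*} [TopologicalSpace X] [ChartedSpace K X] {n : WithTop ℕ∞}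
    {U : TopologicalSpace.Opens M} {f : X → U} {x : X} :
    ContMDiffAt J I n (Subtype.val ∘ f) x ↔ ContMDiffAt J I n f x :=
  ChartedSpace.liftPropWithinAt_subtypeVal_comp_iff ..

namespace LinearConnection

variable {cov : LinearConnection I M} [FiniteDimensional ℝ E] [I.Boundaryless]

/-- The coordinates of `c • γ'(t)` in a chart of the tangent bundle. -/
theorem extChartAt_scaledLift {γ : ℝ → M} {t : ℝ} (h : MDifferentiableAt 𝓘(ℝ, ℝ) I γ t)
    (p : TangentBundle I M) (hp : γ t ∈ (chartAt H p.proj).source) (c : ℝ) :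
    extChartAt I.tangent p (scaledLift I γ (t, c)) =
      (extChartAt I p.proj (γ t), c • deriv (extChartAt I p.proj ∘ γ) t) := by
  rw [deriv_extChartAt_comp h hp, ← map_smul, FiberBundle.extChartAt]
  refine Prod.ext rfl ?_
  rw [Trivialization.continuousLinearMapAt_apply, Trivialization.coe_linearMapAt_of_mem _ hp]
  rfl

theorem injective_mfderiv_scaledLift {γ : ℝ → M} {t : ℝ}
    (h : ContMDiffAt 𝓘(ℝ, ℝ) I 2 γ t) (h0 : curveVelocity I γ t ≠ 0) :
    Function.Injective (mfderiv 𝓘(ℝ, ℝ × ℝ) I.tangent (scaledLift I γ) (t, 1)) := by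
  set p := scaledLift I γ (t, 1) with hp
  have hmd := h.mdifferentiableAt (by simp)
  have hq : γ t ∈ (chartAt H p.proj).source := mem_chart_source H (γ t)
  have hcd : ContDiffAt ℝ 2 (extChartAt I p.proj ∘ γ) t :=
    h.contDiffAt_extChartAt (by exact WithTop.coe_le_coe.2 le_top) hq
  set c := extChartAt I p.proj ∘ γ with hc
  have hd1 : HasDerivAt c (deriv c t) t := (hcd.differentiableAt (by simp)).hasDerivAt
  have hd2 : HasDerivAt (deriv c) (deriv (deriv c) t) t :=
    ((hcd.derivWithin (m := 1) one_add_one_eq_two.le).differentiableAt (by simp)).hasDerivAt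
  have hne : deriv c t ≠ 0 := fun h1 ↦ h0 ((curveVelocity_eq_zero_iff hmd hq).2 h1)
  have hfst : HasFDerivAt (Prod.fst : ℝ × ℝ → ℝ) (ContinuousLinearMap.fst ℝ ℝ ℝ) (t, (1 : ℝ)) :=
    hasFDerivAt_fst
  have hsnd : HasFDerivAt (Prod.snd : ℝ × ℝ → ℝ) (ContinuousLinearMap.snd ℝ ℝ ℝ) (t, (1 : ℝ)) :=
    hasFDerivAt_snd
  have hF := (HasFDerivAt.comp (g := c) (t, (1 : ℝ)) hd1.hasFDerivAt hfst).prodMk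
    (hsnd.smul (HasFDerivAt.comp (g := deriv c) (t, (1 : ℝ)) hd2.hasFDerivAt hfst))
  have hev : (extChartAt I.tangent p ∘ scaledLift I γ) =ᶠ[𝓝 (t, (1 : ℝ))]
      fun s : ℝ × ℝ ↦ ((c ∘ Prod.fst) s, Prod.snd s • (deriv c ∘ Prod.fst) s) := by
    have h3 := (contMDiffAt_iff_contMDiffAt_nhds (n := 1) (by simp)).1 (h.of_le (by norm_num))
    have h2 : ∀ᶠ s in 𝓝 t, MDifferentiableAt 𝓘(ℝ, ℝ) I γ s ∧ γ s ∈ (chartAt H p.proj).source := by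
      filter_upwards [h3, h.continuousAt.preimage_mem_nhds
        ((chartAt H p.proj).open_source.mem_nhds hq)] with s hs hs'
      exact ⟨hs.mdifferentiableAt (by simp), hs'⟩
    filter_upwards [(continuousAt_fst (p := (t, (1 : ℝ)))).eventually h2] with s hs
    exact extChartAt_scaledLift hs.1 p hs.2 s.2
  have hF' := hF.congr_of_eventuallyEq hev
  have hΦ : MDifferentiableAt 𝓘(ℝ, ℝ × ℝ) I.tangent (scaledLift I γ) (t, 1) :=
    (contMDiffAt_smul_curveLift h).mdifferentiableAt (by simp)
  have hcomp : mfderiv 𝓘(ℝ, ℝ × ℝ) 𝓘(ℝ, E × E) (extChartAt I.tangent p ∘ scaledLift I γ) (t, 1) =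
      mfderiv I.tangent 𝓘(ℝ, E × E) (extChartAt I.tangent p) p ∘L
        mfderiv 𝓘(ℝ, ℝ × ℝ) I.tangent (scaledLift I γ) (t, 1) :=
    mfderiv_comp (t, (1 : ℝ)) (mdifferentiableAt_extChartAt (mem_chart_source _ p)) hΦ
  rw [mfderiv_eq_fderiv, hF'.fderiv] at hcomp
  refine (injective_iff_map_eq_zero _).2 fun u hu ↦ ?_
  have h4 : mfderiv I.tangent 𝓘(ℝ, E × E) (extChartAt I.tangent p) p
      (mfderiv 𝓘(ℝ, ℝ × ℝ) I.tangent (scaledLift I γ) (t, 1) u) = 0 :=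
    (congrArg (mfderiv I.tangent 𝓘(ℝ, E × E) (extChartAt I.tangent p) p) hu).trans (map_zero _)
  have h5 := (DFunLike.congr_fun hcomp u).trans h4
  obtain ⟨u1, u2⟩ := u
  have h6 : u1 • deriv c t = (0 : E) := congrArg Prod.fst h5
  have h7 : (1 : ℝ) • u1 • deriv (deriv c) t + u2 • deriv c t = (0 : E) := congrArg Prod.snd h5
  obtain rfl : u1 = 0 := (smul_eq_zero.1 h6).resolve_right hne
  rw [zero_smul, smul_zero, zero_add] at h7
  obtain rfl : u2 = 0 := (smul_eq_zero.1 h7).resolve_right hne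
  rfl

variable [T2Space M] [cov.ContMDiffCovariantDerivative ∞]

/-- The vectors tangent to a maximal geodesic are those proportional to its velocities. -/
theorem IsGeodesicOn.toGeodesic_eq_iff_of_maximal {w : ReducedTangentBundle I M} {Γ : ℝ → M}
    {J : Set ℝ} (hΓ : cov.IsGeodesicOn Γ J) (h0 : 0 ∈ J) (hw : curveLift I Γ 0 = w.1)
    (hmax : ∀ (γ : ℝ → M) (J' : Set ℝ), cov.IsGeodesicOn γ J' → 0 ∈ J' → curveLift I γ 0 = w.1 →
      J' ⊆ J ∧ EqOn γ Γ J') (v : ReducedTangentBundle I M) :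
    cov.toGeodesic v = cov.toGeodesic w ↔
      ∃ s : ℝ × ℝ, s.1 ∈ J ∧ s.2 ≠ 0 ∧ v.1 = scaledLift I Γ s := by
  let P : ReducedTangentBundle I M → Prop := fun v ↦
    ∃ s : ℝ × ℝ, s.1 ∈ J ∧ s.2 ≠ 0 ∧ v.1 = scaledLift I Γ s
  have hP1 : ∀ (v v' : ReducedTangentBundle I M) (c : ℝ), c ≠ 0 →
      v'.1 = ⟨v.1.proj, c • v.1.2⟩ → P v → P v' := by
    rintro v v' c hc hv' ⟨⟨t, a⟩, ht, ha, hv⟩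
    refine ⟨(t, c * a), ht, mul_ne_zero hc ha, ?_⟩
    rw [hv', hv, scaledLift, scaledLift, ← smul_smul]
  have hP2 : ∀ (γ : ℝ → M) (J' : Set ℝ), cov.IsGeodesicOn γ J' → ∀ s ∈ J', ∀ t ∈ J',
      ∀ (hs : curveVelocity I γ s ≠ 0) (ht : curveVelocity I γ t ≠ 0),
        P ⟨curveLift I γ s, hs⟩ → P ⟨curveLift I γ t, ht⟩ := by
    rintro γ J' hγ s hsJ t htJ hs ht ⟨⟨r, a⟩, hr, ha, hv⟩
    replace hr : r ∈ J := hr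
    replace ha : a ≠ 0 := ha
    have hη := hγ.comp_affine a⁻¹ (s - a⁻¹ * r)
    have hval : ∀ x, a⁻¹ * (a * (x - s) + r) + (s - a⁻¹ * r) = x := fun x ↦ by
      field_simp
      ring
    have hval' : a⁻¹ * r + (s - a⁻¹ * r) = s := by ring
    have hrη : r ∈ (fun x ↦ a⁻¹ * x + (s - a⁻¹ * r)) ⁻¹' J' := by
      change a⁻¹ * r + (s - a⁻¹ * r) ∈ J'
      rwa [hval']
    have hlift : ∀ x, a⁻¹ * x + (s - a⁻¹ * r) ∈ J' →
        curveLift I (fun x ↦ γ (a⁻¹ * x + (s - a⁻¹ * r))) x =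
          scaledLift I γ (a⁻¹ * x + (s - a⁻¹ * r), a⁻¹) :=
      fun x hx ↦ curveLift_comp_affine (hγ.mdifferentiableAt hx)
    have heq : curveLift I Γ r = curveLift I (fun x ↦ γ (a⁻¹ * x + (s - a⁻¹ * r))) r := by
      rw [hlift r hrη, hval']
      have h1 : scaledLift I γ (s, a⁻¹) = (⟨(scaledLift I Γ (r, a)).1,
          a⁻¹ • (scaledLift I Γ (r, a)).2⟩ : TangentBundle I M) :=
        congrArg (fun w : TangentBundle I M ↦ (⟨w.1, a⁻¹ • w.2⟩ : TangentBundle I M)) hv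
      rw [h1, scaledLift]
      simp only [smul_smul, inv_mul_cancel₀ ha, one_smul]
      rfl
    obtain ⟨ζ, hζ, hζ1, hζ2⟩ := exists_isGeodesicOn_union hΓ hη hr hrη heq
    obtain ⟨hsub, hζΓ⟩ := hmax ζ _ hζ (Or.inl h0)
      ((curveLift_congr (hζ1.eventuallyEq_of_mem (hΓ.isOpen.mem_nhds h0))).trans hw)
    set x := a * (t - s) + r with hx
    have hxη : x ∈ (fun x ↦ a⁻¹ * x + (s - a⁻¹ * r)) ⁻¹' J' := by
      change a⁻¹ * x + (s - a⁻¹ * r) ∈ J'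
      rwa [hx, hval]
    have h2 : curveLift I Γ x = scaledLift I γ (t, a⁻¹) := by
      rw [← curveLift_congr (hζΓ.eventuallyEq_of_mem (hζ.isOpen.mem_nhds (Or.inr hxη))),
        curveLift_congr (hζ2.eventuallyEq_of_mem (hη.isOpen.mem_nhds hxη)), hlift x hxη, hx, hval]
    refine ⟨(x, a), hsub (Or.inr hxη), ha, ?_⟩
    have h3 : scaledLift I Γ (x, a) = (⟨(scaledLift I γ (t, a⁻¹)).1,
        a • (scaledLift I γ (t, a⁻¹)).2⟩ : TangentBundle I M) :=
      congrArg (fun w : TangentBundle I M ↦ (⟨w.1, a • w.2⟩ : TangentBundle I M)) h2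
    rw [h3, scaledLift]
    simp only [smul_smul, mul_inv_cancel₀ ha, one_smul]
    rfl
  have hΓ0 : curveVelocity I Γ 0 ≠ 0 := by
    have h1 : (curveLift I Γ 0).2 ≠ 0 := hw ▸ w.2
    exact h1
  have hw' : w = ⟨curveLift I Γ 0, hΓ0⟩ := Subtype.ext hw.symm
  constructor
  · intro h
    have h₁ : ∀ v v' : ReducedTangentBundle I M, Proportional v v' → P v = P v' := by
      rintro v v' ⟨c, hc, hv⟩
      refine propext ⟨hP1 v v' c hc hv, hP1 v' v c⁻¹ (inv_ne_zero hc) ?_⟩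
      rw [hv]
      simp only [smul_smul, inv_mul_cancel₀ hc, one_smul]
    obtain ⟨g, hg⟩ := exists_comp_toGeodesic_eq (cov := cov) h₁ fun γ J' hγ s hsJ t htJ hs ht ↦
      propext ⟨hP2 γ J' hγ s hsJ t htJ hs ht, hP2 γ J' hγ t htJ s hsJ ht hs⟩
    change P v
    rw [← hg, h, hg]
    exact ⟨(0, 1), h0, one_ne_zero, by rw [scaledLift_one, hw]⟩
  · rintro ⟨⟨t, a⟩, ht, ha, hv⟩
    have hΓt : curveVelocity I Γ t ≠ 0 := fun h ↦ hΓ0 (hΓ.curveVelocity_eq_zero ht h0 h)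
    rw [hw', ← hΓ.toGeodesic_eq ht h0 hΓt hΓ0]
    exact (toGeodesic_eq_of_proportional ⟨a, ha, hv⟩).symm

variable (cov) in
/-- The tangent vectors to one geodesic form the injectively immersed image of an open subset of
the plane. -/
theorem exists_parametrization_fiber (w : ReducedTangentBundle I M) :
    ∃ (Φ : ℝ × ℝ → ReducedTangentBundle I M) (S : Set (ℝ × ℝ)), IsOpen S ∧ (0, 1) ∈ S ∧
      ContMDiffOn 𝓘(ℝ, ℝ × ℝ) I.tangent 1 Φ S ∧ Φ (0, 1) = w ∧
      Function.Injective (mfderiv 𝓘(ℝ, ℝ × ℝ) I.tangent Φ (0, 1)) ∧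
      ∀ v, cov.toGeodesic v = cov.toGeodesic w ↔ v ∈ Φ '' S := by
  classical
  obtain ⟨Γ, J, hΓ, h0, hw, hmax⟩ := cov.exists_isGeodesicOn_maximal w.1
  have hΓ0 : curveVelocity I Γ 0 ≠ 0 := by
    have h1 : (curveLift I Γ 0).2 ≠ 0 := hw ▸ w.2
    exact h1
  let S : Set (ℝ × ℝ) := J ×ˢ {0}ᶜ
  have hS : IsOpen S := hΓ.isOpen.prod isOpen_compl_singleton
  have h0S : ((0 : ℝ), (1 : ℝ)) ∈ S := ⟨h0, one_ne_zero⟩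
  have hmem : ∀ s ∈ S, scaledLift I Γ s ∈ ReducedTangentBundle I M := fun s hs ↦
    smul_ne_zero hs.2 fun h ↦ hΓ0 (hΓ.curveVelocity_eq_zero hs.1 h0 h)
  let Φ : ℝ × ℝ → ReducedTangentBundle I M := fun s ↦
    if h : scaledLift I Γ s ∈ ReducedTangentBundle I M then ⟨scaledLift I Γ s, h⟩ else w
  have hΦ : ∀ s ∈ S, (Φ s).1 = scaledLift I Γ s := fun s hs ↦ by
    simp only [Φ, dif_pos (hmem s hs)]
  have hev : ∀ s ∈ S, Subtype.val ∘ Φ =ᶠ[𝓝 s] scaledLift I Γ := fun s hs ↦ by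
    filter_upwards [hS.mem_nhds hs] with r hr
    exact hΦ r hr
  have hsm : ∀ s ∈ S, ContMDiffAt 𝓘(ℝ, ℝ × ℝ) I.tangent 1 Φ s := fun s hs ↦ by
    rw [← contMDiffAt_subtypeVal_comp_iff]
    exact (contMDiffAt_smul_curveLift (t := s.1) (c := s.2)
      (hΓ.contMDiffAt hs.1)).congr_of_eventuallyEq (hev s hs)
  refine ⟨Φ, S, hS, h0S, fun s hs ↦ (hsm s hs).contMDiffWithinAt,
    Subtype.ext ((hΦ _ h0S).trans ((scaledLift_one Γ 0).trans hw)), ?_, fun v ↦ ?_⟩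
  · have h1 := injective_mfderiv_scaledLift (hΓ.contMDiffAt h0) hΓ0
    have h2 : mfderiv 𝓘(ℝ, ℝ × ℝ) I.tangent (Subtype.val ∘ Φ) (0, 1) =
        mfderiv I.tangent I.tangent (Subtype.val : ReducedTangentBundle I M → TangentBundle I M)
          (Φ (0, 1)) ∘L mfderiv 𝓘(ℝ, ℝ × ℝ) I.tangent Φ (0, 1) :=
      mfderiv_comp _ ((contMDiff_subtype_val (n := 1)).mdifferentiable (by simp) _)
        ((hsm _ h0S).mdifferentiableAt (by simp))
    have h3 := (hev _ h0S).mfderiv_eq (I := 𝓘(ℝ, ℝ × ℝ)) (I' := I.tangent)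
    refine (injective_iff_map_eq_zero _).2 fun u hu ↦ (injective_iff_map_eq_zero _).1 h1 u ?_
    exact ((DFunLike.congr_fun (h3.symm.trans h2) u).trans
      (congrArg (mfderiv I.tangent I.tangent (Subtype.val : ReducedTangentBundle I M → _)
        (Φ (0, 1))) hu)).trans (map_zero _)
  · rw [hΓ.toGeodesic_eq_iff_of_maximal h0 hw hmax]
    constructor
    · rintro ⟨s, hs1, hs2, hv⟩
      exact ⟨s, ⟨hs1, hs2⟩, Subtype.ext ((hΦ s ⟨hs1, hs2⟩).trans hv.symm)⟩
    · rintro ⟨s, hs, rfl⟩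
      exact ⟨s, hs.1, hs.2, hΦ s hs⟩

end LinearConnection

end GeodesicFibers

section Connected

variable {E : Type*} [NormedAddCommGroup E] [NormedSpace ℝ E]
  {H : Type*} [TopologicalSpace H] {I : ModelWithCorners ℝ E H}
  {M : Type*} [TopologicalSpace M] [ChartedSpace H M] [IsManifold I ∞ M]

/-- A continuous function on the reduced tangent bundle with values in a discrete space is constant
on each fiber if it is invariant under proportionality. -/
theorem apply_eq_of_proj_eq {α : Type*} [TopologicalSpace α] [DiscreteTopology α]
    [FiniteDimensional ℝ E] {ψ : ReducedTangentBundle I M → α} (hψ : Continuous ψ)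
    (hp : ∀ v w, Proportional v w → ψ v = ψ w) (x : M) (v w : TangentSpace I x)
    (hv : v ≠ 0) (hw : w ≠ 0) : ψ ⟨⟨x, v⟩, hv⟩ = ψ ⟨⟨x, w⟩, hw⟩ := by
  rcases le_or_gt (Module.finrank ℝ E) 1 with h | h
  · have : Nontrivial E := ⟨v, 0, hv⟩
    have h1 : Module.finrank ℝ E = 1 := le_antisymm h Module.finrank_pos
    obtain ⟨c, hc⟩ := (finrank_eq_one_iff_of_nonzero' (v : E) hv).1 h1 w
    refine hp _ _ ⟨c, ?_, ?_⟩
    · rintro rfl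
      exact hw (hc.symm.trans (zero_smul ℝ v))
    · exact congrArg (fun z ↦ (⟨x, z⟩ : TangentBundle I M)) hc.symm
  · have h1 : IsPreconnected ({0}ᶜ : Set E) :=
      (isConnected_compl_singleton_of_one_lt_rank (Module.one_lt_rank_of_one_lt_finrank h)
        0).isPreconnected
    have : PreconnectedSpace ({0}ᶜ : Set E) := Subtype.preconnectedSpace h1
    have h2 : Continuous fun z : ({0}ᶜ : Set E) ↦
        ψ ⟨(⟨x, (z : E)⟩ : TangentBundle I M), z.2⟩ := by
      refine hψ.comp (Continuous.subtype_mk ?_ _)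
      exact (FiberBundle.continuous_totalSpaceMk E (TangentSpace I : M → Type _) x).comp
        continuous_subtype_val
    exact PreconnectedSpace.constant inferInstance h2 (x := ⟨v, hv⟩) (y := ⟨w, hw⟩)

theorem coordField_ne_zero {q y : M} (hy : y ∈ (chartAt H q).source) {e : E} (he : e ≠ 0) :
    coordField I q e y ≠ 0 := by
  intro h
  have h1 := (trivializationAt E (TangentSpace I : M → Type _) q).continuousLinearMapAt_symmL
    (R := ℝ) (b := y) hy e
  exact he (h1.symm.trans ((congrArg _ h).trans (map_zero _)))

/-- The space of geodesics of a connected manifold is connected or empty. -/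
theorem LinearConnection.preconnectedSpace_geodesicSpace [FiniteDimensional ℝ E]
    [PreconnectedSpace M] (cov : LinearConnection I M) : PreconnectedSpace cov.GeodesicSpace := by
  refine preconnectedSpace_of_forall_constant fun φ hφ ↦ ?_
  let ψ : ReducedTangentBundle I M → Bool := φ ∘ cov.toGeodesic
  have hψ : Continuous ψ := hφ.comp continuous_toGeodesic
  have hp : ∀ v w, Proportional v w → ψ v = ψ w := fun v w h ↦
    congrArg φ (toGeodesic_eq_of_proportional h)
  intro a b
  obtain ⟨⟨⟨x, v⟩, hv⟩, rfl⟩ := toGeodesic_surjective a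
  obtain ⟨⟨⟨y, w⟩, hw⟩, rfl⟩ := toGeodesic_surjective b
  let e : E := v
  have he : e ≠ 0 := hv
  let χ : M → Bool := fun z ↦ ψ ⟨(⟨z, e⟩ : TangentBundle I M), he⟩
  have hχ : Continuous χ := by
    rw [continuous_iff_continuousAt]
    intro q
    refine ContinuousOn.continuousAt (s := (chartAt H q).source) ?_ (chart_source_mem_nhds H q)
    rw [continuousOn_iff_continuous_domRestrict]
    have h1 : (chartAt H q).source.domRestrict χ = fun z : (chartAt H q).source ↦
        ψ ⟨(⟨z, coordField I q e z⟩ : TangentBundle I M), coordField_ne_zero z.2 he⟩ :=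
      funext fun z ↦ apply_eq_of_proj_eq hψ hp z _ _ _ _
    rw [h1]
    refine hψ.comp (Continuous.subtype_mk ?_ _)
    exact continuousOn_iff_continuous_domRestrict.1 fun z hz ↦
      (contMDiffAt_coordField hz e).continuousAt.continuousWithinAt
  calc φ (cov.toGeodesic ⟨⟨x, v⟩, hv⟩) = χ x := rfl
    _ = χ y := PreconnectedSpace.constant inferInstance hχ
    _ = ψ ⟨⟨y, w⟩, hw⟩ := apply_eq_of_proj_eq hψ hp y _ _ _ _

end Connected

section Embedding

variable {E : Type*} [NormedAddCommGroup E] [NormedSpace ℝ E] [FiniteDimensional ℝ E]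
  {H : Type*} [TopologicalSpace H] {I : ModelWithCorners ℝ E H} [I.Boundaryless]
  {M : Type*} [TopologicalSpace M] [ChartedSpace H M] [IsManifold I ∞ M] [T2Space M]
  {E' : Type*} [NormedAddCommGroup E'] [NormedSpace ℝ E'] [FiniteDimensional ℝ E']
  {H' : Type*} [TopologicalSpace H'] {I' : ModelWithCorners ℝ E' H'} [I'.Boundaryless]
  {M' : Type*} [TopologicalSpace M'] [ChartedSpace H' M'] [IsManifold I' ∞ M']
  (cov : LinearConnection I M) (cov' : LinearConnection I' M')

/-- A closed smooth embedding of reduced tangent bundles whose image is a union of full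
tangent lifts of geodesics, and which induces an injection of the spaces of geodesics. -/
structure LinearConnection.GeodesicEmbedding
    (ι : ReducedTangentBundle I M → ReducedTangentBundle I' M') : Prop where
  contMDiff : ContMDiff I.tangent I'.tangent ∞ ι
  isClosedEmbedding : Topology.IsClosedEmbedding ι
  injective_mfderiv : ∀ w, Function.Injective (mfderiv I.tangent I'.tangent ι w)
  toGeodesic_eq : ∀ v w, cov.toGeodesic v = cov.toGeodesic w →
    cov'.toGeodesic (ι v) = cov'.toGeodesic (ι w)
  exists_of_toGeodesic_eq : ∀ v x, cov'.toGeodesic x = cov'.toGeodesic (ι v) →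
    ∃ w, ι w = x ∧ cov.toGeodesic w = cov.toGeodesic v

namespace LinearConnection.GeodesicEmbedding

variable {cov cov'} {ι : ReducedTangentBundle I M → ReducedTangentBundle I' M'}

theorem toGeodesic_eq_iff (h : cov.GeodesicEmbedding cov' ι) {v w : ReducedTangentBundle I M} :
    cov'.toGeodesic (ι v) = cov'.toGeodesic (ι w) ↔ cov.toGeodesic v = cov.toGeodesic w := by
  refine ⟨fun h1 ↦ ?_, h.toGeodesic_eq v w⟩
  obtain ⟨u, hu, hu'⟩ := h.exists_of_toGeodesic_eq w (ι v) h1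
  rwa [h.isClosedEmbedding.injective hu] at hu'

theorem exists_map (h : cov.GeodesicEmbedding cov' ι) :
    ∃ g : cov.GeodesicSpace → cov'.GeodesicSpace, Topology.IsClosedEmbedding g ∧
      ∀ v, g (cov.toGeodesic v) = cov'.toGeodesic (ι v) := by
  let g : cov.GeodesicSpace → cov'.GeodesicSpace := fun a ↦
    cov'.toGeodesic (ι (Function.surjInv (toGeodesic_surjective (cov := cov)) a))
  have hg : ∀ v, g (cov.toGeodesic v) = cov'.toGeodesic (ι v) := fun v ↦
    h.toGeodesic_eq _ _ (Function.surjInv_eq _ _)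
  refine ⟨g, .of_continuous_injective_isClosedMap ?_ ?_ ?_, hg⟩
  · rw [isQuotientMap_toGeodesic.continuous_iff]
    exact (continuous_toGeodesic.comp h.contMDiff.continuous).congr fun v ↦ (hg v).symm
  · intro a b hab
    obtain ⟨v, rfl⟩ := toGeodesic_surjective a
    obtain ⟨w, rfl⟩ := toGeodesic_surjective b
    rw [hg, hg, h.toGeodesic_eq_iff] at hab
    exact hab
  · intro C hC
    rw [← isQuotientMap_toGeodesic.isClosed_preimage]
    have h1 : cov'.toGeodesic ⁻¹' (g '' C) = ι '' (cov.toGeodesic ⁻¹' C) := by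
      ext x
      constructor
      · rintro ⟨a, ha, hax⟩
        obtain ⟨v, rfl⟩ := toGeodesic_surjective a
        rw [hg] at hax
        obtain ⟨w, rfl, hw⟩ := h.exists_of_toGeodesic_eq v x hax.symm
        exact ⟨w, (congrArg (· ∈ C) hw).mpr ha, rfl⟩
      · rintro ⟨v, hv, rfl⟩
        exact ⟨_, hv, hg v⟩
    rw [h1]
    exact h.isClosedEmbedding.isClosedMap _ (hC.preimage continuous_toGeodesic)

theorem isOpenMap_toGeodesic (h : cov.GeodesicEmbedding cov' ι) (ho : IsOpenMap cov'.toGeodesic) :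
    IsOpenMap cov.toGeodesic := by
  intro U hU
  obtain ⟨V, hV, rfl⟩ := h.isClosedEmbedding.isInducing.isOpen_iff.1 hU
  rw [← isQuotientMap_toGeodesic.isOpen_preimage]
  have h1 : cov.toGeodesic ⁻¹' (cov.toGeodesic '' (ι ⁻¹' V)) =
      ι ⁻¹' (cov'.toGeodesic ⁻¹' (cov'.toGeodesic '' V)) := by
    ext v
    constructor
    · rintro ⟨w, hw, hwv⟩
      exact ⟨ι w, hw, h.toGeodesic_eq _ _ hwv⟩
    · rintro ⟨x, hx, hxv⟩
      obtain ⟨w, rfl, hw⟩ := h.exists_of_toGeodesic_eq v x hxv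
      exact ⟨w, hx, hw⟩
  rw [h1]
  exact ((ho V hV).preimage continuous_toGeodesic).preimage h.contMDiff.continuous

variable [cov.ContMDiffCovariantDerivative ∞]

theorem finrank_ker_mfderiv (h : cov.GeodesicEmbedding cov' ι) {m : ℕ}
    [ChartedSpace (EuclideanSpace ℝ (Fin m)) cov'.GeodesicSpace]
    [IsManifold (𝓡 m) ∞ cov'.GeodesicSpace] {K : Type*} [NormedAddCommGroup K] [NormedSpace ℝ K]
    (hs : Manifold.IsSubmersionOfComplement K I'.tangent (𝓡 m) ∞ cov'.toGeodesic)
    (hc : ContMDiff I'.tangent (𝓡 m) ∞ cov'.toGeodesic) (w : ReducedTangentBundle I M) :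
    Module.finrank ℝ (mfderiv I.tangent (𝓡 m) (cov'.toGeodesic ∘ ι) w).ker = 2 := by
  obtain ⟨Φ, S, hS, h0, hΦ, hw, hinj, hfib⟩ := cov.exists_parametrization_fiber w
  obtain ⟨hK, hK2⟩ := (hs (ι w)).finrank_le_two (Φ := ι ∘ Φ) hS
    ((h.contMDiff.of_le (by simp)).comp_contMDiffOn hΦ) fun x hx ↦ by
      obtain ⟨v, rfl, hv⟩ := h.exists_of_toGeodesic_eq w x hx
      obtain ⟨s, hsS, rfl⟩ := (hfib v).1 hv
      exact ⟨s, hsS, rfl⟩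
  refine le_antisymm (((hs (ι w)).finrank_ker_comp_le (h.contMDiff.mdifferentiable (by simp) w)
    (h.injective_mfderiv w)).trans hK2) ?_
  refine two_le_finrank_ker_mfderiv ((hc.comp h.contMDiff).mdifferentiable (by simp) w) hw
    ((hΦ.contMDiffAt (hS.mem_nhds h0)).mdifferentiableAt (by simp)) hinj ?_
  filter_upwards [hS.mem_nhds h0] with s hsS
  exact h.toGeodesic_eq _ _ ((hfib _).2 ⟨s, hsS, rfl⟩)

/-- The space of geodesics is locally Euclidean if it embeds in a locally Euclidean one. -/
theorem geodesicSpaceLocallyEuclidean [PreconnectedSpace M] (h : cov.GeodesicEmbedding cov' ι)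
    (h' : cov'.GeodesicSpaceLocallyEuclidean) : cov.GeodesicSpaceLocallyEuclidean := by
  refine ⟨cov.preconnectedSpace_geodesicSpace, ?_⟩
  obtain ⟨-, m, _, _, K, _, _, hs⟩ := h'
  have hc : ContMDiff I'.tangent (𝓡 m) ∞ cov'.toGeodesic := hs.isSubmersion.contMDiff
  obtain ⟨g, hg, hgp⟩ := h.exists_map
  rcases isEmpty_or_nonempty (ReducedTangentBundle I M) with hN | ⟨⟨v⟩⟩
  · have hG : IsEmpty cov.GeodesicSpace := by
      rw [isEmpty_iff]
      intro a
      obtain ⟨v, -⟩ := toGeodesic_surjective a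
      exact hN.elim v
    let _ : ChartedSpace (EuclideanSpace ℝ (Fin 0)) cov.GeodesicSpace := ChartedSpace.empty _ _
    have hs0 : Manifold.IsSubmersionOfComplement (EuclideanSpace ℝ (Fin 0)) I.tangent (𝓡 0) ∞
        cov.toGeodesic := fun v ↦ hN.elim v
    exact ⟨0, inferInstance, inferInstance, hs0.isSubmersion⟩
  · have : Nontrivial E := ⟨v.1.2, 0, v.2⟩
    have hpos : 0 < Module.finrank ℝ E := Module.finrank_pos
    refine ⟨2 * Module.finrank ℝ E - 2, exists_manifold_isSubmersion (k := 2)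
      (hc.comp h.contMDiff) ?_ (h.finrank_ker_mfderiv hs hc) continuous_toGeodesic
      (h.isOpenMap_toGeodesic hs.isOpenMap) toGeodesic_surjective hg.injective hg.continuous hgp⟩
    rw [Module.finrank_prod]
    omega

theorem paracompactSpace (h : cov.GeodesicEmbedding cov' ι) [ParacompactSpace cov'.GeodesicSpace] :
    ParacompactSpace cov.GeodesicSpace := by
  obtain ⟨g, hg, -⟩ := h.exists_map
  exact hg.paracompactSpace

end LinearConnection.GeodesicEmbedding

end Embedding

section ProductConnection

variable {E₁ : Type*} [NormedAddCommGroup E₁] [NormedSpace ℝ E₁]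
  {H₁ : Type*} [TopologicalSpace H₁] {I₁ : ModelWithCorners ℝ E₁ H₁}
  {M₁ : Type*} [TopologicalSpace M₁] [ChartedSpace H₁ M₁] [IsManifold I₁ ∞ M₁]
  {E₂ : Type*} [NormedAddCommGroup E₂] [NormedSpace ℝ E₂]
  {H₂ : Type*} [TopologicalSpace H₂] {I₂ : ModelWithCorners ℝ E₂ H₂}
  {M₂ : Type*} [TopologicalSpace M₂] [ChartedSpace H₂ M₂] [IsManifold I₂ ∞ M₂]

theorem extChartAt_prod_comp {X : Type*} (q : M₁ × M₂) (γ : X → M₁ × M₂) :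
    extChartAt (I₁.prod I₂) q ∘ γ = fun t ↦
      ((extChartAt I₁ q.1 ∘ fun t ↦ (γ t).1) t, (extChartAt I₂ q.2 ∘ fun t ↦ (γ t).2) t) := by
  rw [extChartAt_prod]
  rfl

theorem mvfderiv_eq_zero_of_eventuallyEq_const {f : M₁ → E₂} {x : M₁} {c : E₂}
    (h : f =ᶠ[𝓝 x] fun _ ↦ c) : mvfderiv I₁ f x = 0 := by
  have h1 := h.mfderiv_eq (I := I₁) (I' := 𝓘(ℝ, E₂))
  have h2 : mfderiv I₁ 𝓘(ℝ, E₂) (fun _ : M₁ ↦ c) x = 0 := mfderiv_const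
  exact h1.trans h2

variable [I₁.Boundaryless] [I₂.Boundaryless]

theorem continuousLinearMapAt_prod {q y : M₁ × M₂} (h₁ : y.1 ∈ (chartAt H₁ q.1).source)
    (h₂ : y.2 ∈ (chartAt H₂ q.2).source) (w : TangentSpace (I₁.prod I₂) y) :
    (trivializationAt (E₁ × E₂) (TangentSpace (I₁.prod I₂) : M₁ × M₂ → Type _)
      q).continuousLinearMapAt ℝ y w =
      ((trivializationAt E₁ (TangentSpace I₁ : M₁ → Type _) q.1).continuousLinearMapAt ℝ y.1
        (tangentFst I₁ I₂ y w),
      (trivializationAt E₂ (TangentSpace I₂ : M₂ → Type _) q.2).continuousLinearMapAt ℝ y.2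
        (tangentSnd I₁ I₂ y w)) := by
  have hy : y ∈ (chartAt (ModelProd H₁ H₂) q).source := ⟨h₁, h₂⟩
  rw [TangentBundle.continuousLinearMapAt_trivializationAt hy,
    TangentBundle.continuousLinearMapAt_trivializationAt h₁,
    TangentBundle.continuousLinearMapAt_trivializationAt h₂]
  have d₁ := ((mdifferentiableAt_extChartAt (I := I₁) h₁).hasMFDerivAt).comp y
    (hasMFDerivAt_fst (I := I₁) (I' := I₂) y)
  have d₂ := ((mdifferentiableAt_extChartAt (I := I₂) h₂).hasMFDerivAt).comp y
    (hasMFDerivAt_snd (I := I₁) (I' := I₂) y)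
  have d : HasMFDerivAt (I₁.prod I₂) 𝓘(ℝ, E₁ × E₂) (extChartAt (I₁.prod I₂) q) y
      (ContinuousLinearMap.prod
        (mfderiv I₁ 𝓘(ℝ, E₁) (extChartAt I₁ q.1) y.1 ∘L tangentFst I₁ I₂ y)
        (mfderiv I₂ 𝓘(ℝ, E₂) (extChartAt I₂ q.2) y.2 ∘L tangentSnd I₁ I₂ y)) := by
    have h := extChartAt_prod_comp (I₁ := I₁) (I₂ := I₂) q id
    rw [Function.comp_id] at h
    rw [h]
    exact ⟨d₁.1.prodMk d₂.1, d₁.2.prodMk d₂.2⟩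
  rw [d.mfderiv]
  rfl

theorem coordField_prod {q y : M₁ × M₂} (h₁ : y.1 ∈ (chartAt H₁ q.1).source)
    (h₂ : y.2 ∈ (chartAt H₂ q.2).source) (v : E₁ × E₂) :
    coordField (I₁.prod I₂) q v y = (coordField I₁ q.1 v.1 y.1, coordField I₂ q.2 v.2 y.2) := by
  have hy : y ∈ (chartAt (ModelProd H₁ H₂) q).source := ⟨h₁, h₂⟩
  let w : TangentSpace (I₁.prod I₂) y := (coordField I₁ q.1 v.1 y.1, coordField I₂ q.2 v.2 y.2)
  have e₁ := (trivializationAt E₁ (TangentSpace I₁ : M₁ → Type _)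
    q.1).continuousLinearMapAt_symmL (R := ℝ) (b := y.1) h₁ v.1
  have e₂ := (trivializationAt E₂ (TangentSpace I₂ : M₂ → Type _)
    q.2).continuousLinearMapAt_symmL (R := ℝ) (b := y.2) h₂ v.2
  have h3 : (trivializationAt (E₁ × E₂) (TangentSpace (I₁.prod I₂) : M₁ × M₂ → Type _)
      q).continuousLinearMapAt ℝ y w = v :=
    (continuousLinearMapAt_prod h₁ h₂ w).trans (Prod.ext e₁ e₂)
  have h4 := coordField_continuousLinearMapAt hy w
  rw [h3] at h4
  exact h4

theorem crossFst_coordField {q x : M₁ × M₂} (h₁ : x.1 ∈ (chartAt H₁ q.1).source)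
    (h₂ : x.2 ∈ (chartAt H₂ q.2).source) (v : E₁ × E₂) :
    crossFst (coordField (I₁.prod I₂) q v) x = 0 := by
  have h : (fun y₂ ↦ (tangentFst I₁ I₂ (x.1, y₂) (coordField (I₁.prod I₂) q v (x.1, y₂)) : E₁))
      =ᶠ[𝓝 x.2] fun _ ↦ (coordField I₁ q.1 v.1 x.1 : E₁) := by
    filter_upwards [(chartAt H₂ q.2).open_source.mem_nhds h₂] with y hy
    exact congrArg Prod.fst (coordField_prod (y := (x.1, y)) h₁ hy v)
  exact mvfderiv_eq_zero_of_eventuallyEq_const h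

theorem crossSnd_coordField {q x : M₁ × M₂} (h₁ : x.1 ∈ (chartAt H₁ q.1).source)
    (h₂ : x.2 ∈ (chartAt H₂ q.2).source) (v : E₁ × E₂) :
    crossSnd (coordField (I₁.prod I₂) q v) x = 0 := by
  have h : (fun y₁ ↦ (tangentSnd I₁ I₂ (y₁, x.2) (coordField (I₁.prod I₂) q v (y₁, x.2)) : E₂))
      =ᶠ[𝓝 x.1] fun _ ↦ (coordField I₂ q.2 v.2 x.2 : E₂) := by
    filter_upwards [(chartAt H₁ q.1).open_source.mem_nhds h₁] with y hy
    exact congrArg Prod.snd (coordField_prod (y := (y, x.2)) hy h₂ v)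
  exact mvfderiv_eq_zero_of_eventuallyEq_const h

namespace LinearConnection

variable (cov₁ : LinearConnection I₁ M₁) (cov₂ : LinearConnection I₂ M₂)

/-- The Christoffel symbols of a product connection. -/
theorem christoffel_prod {q x : M₁ × M₂} (h₁ : x.1 ∈ (chartAt H₁ q.1).source)
    (h₂ : x.2 ∈ (chartAt H₂ q.2).source) (u v : E₁ × E₂) :
    (cov₁.prod cov₂).christoffel q x u v =
      (cov₁.christoffel q.1 x.1 u.1 v.1, cov₂.christoffel q.2 x.2 u.2 v.2) := by
  have hx : x ∈ (chartAt (ModelProd H₁ H₂) q).source := ⟨h₁, h₂⟩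
  have hσ := mdifferentiableAt_coordField (I := I₁.prod I₂) hx v
  have e₁ : cov₁ (sliceFst (coordField (I₁.prod I₂) q v) x.2) x.1 =
      cov₁ (coordField I₁ q.1 v.1) x.1 := by
    refine cov₁.isCovariantDerivativeOnUniv.congr_of_eventuallyEq (mdifferentiableAt_sliceFst hσ)
      (mdifferentiableAt_coordField h₁ _) Filter.univ_mem ?_
    filter_upwards [(chartAt H₁ q.1).open_source.mem_nhds h₁] with y hy
    exact congrArg Prod.fst (coordField_prod (y := (y, x.2)) hy h₂ v)
  have e₂ : cov₂ (sliceSnd (coordField (I₁.prod I₂) q v) x.1) x.2 =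
      cov₂ (coordField I₂ q.2 v.2) x.2 := by
    refine cov₂.isCovariantDerivativeOnUniv.congr_of_eventuallyEq (mdifferentiableAt_sliceSnd hσ)
      (mdifferentiableAt_coordField h₂ _) Filter.univ_mem ?_
    filter_upwards [(chartAt H₂ q.2).open_source.mem_nhds h₂] with y hy
    exact congrArg Prod.snd (coordField_prod (y := (x.1, y)) h₁ hy v)
  have hu := coordField_prod (I₁ := I₁) (I₂ := I₂) h₁ h₂ u
  have f₁ : tangentFst I₁ I₂ x (cov₁.prodFun cov₂ (coordField (I₁.prod I₂) q v) x
      (coordField (I₁.prod I₂) q u x)) =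
      cov₁ (coordField I₁ q.1 v.1) x.1 (coordField I₁ q.1 u.1 x.1) := by
    rw [tangentFst_prodFun, crossFst_coordField h₁ h₂, e₁, hu]
    exact add_zero _
  have f₂ : tangentSnd I₁ I₂ x (cov₁.prodFun cov₂ (coordField (I₁.prod I₂) q v) x
      (coordField (I₁.prod I₂) q u x)) =
      cov₂ (coordField I₂ q.2 v.2) x.2 (coordField I₂ q.2 u.2 x.2) := by
    rw [tangentSnd_prodFun, crossSnd_coordField h₁ h₂, e₂, hu]
    exact add_zero _
  rw [christoffel_eq, christoffel_eq, christoffel_eq, ← f₁, ← f₂]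
  exact continuousLinearMapAt_prod h₁ h₂ _

variable {cov₁ cov₂}

theorem deriv_extChartAt_prod_comp {γ : ℝ → M₁ × M₂} {t : ℝ} {q : M₁ × M₂}
    (h₁ : ContDiffAt ℝ 2 (extChartAt I₁ q.1 ∘ fun t ↦ (γ t).1) t)
    (h₂ : ContDiffAt ℝ 2 (extChartAt I₂ q.2 ∘ fun t ↦ (γ t).2) t) :
    deriv (extChartAt (I₁.prod I₂) q ∘ γ) t = (deriv (extChartAt I₁ q.1 ∘ fun t ↦ (γ t).1) t,
      deriv (extChartAt I₂ q.2 ∘ fun t ↦ (γ t).2) t) ∧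
    deriv (deriv (extChartAt (I₁.prod I₂) q ∘ γ)) t =
      (deriv (deriv (extChartAt I₁ q.1 ∘ fun t ↦ (γ t).1)) t,
        deriv (deriv (extChartAt I₂ q.2 ∘ fun t ↦ (γ t).2)) t) := by
  rw [extChartAt_prod_comp]
  set c₁ := extChartAt I₁ q.1 ∘ fun t ↦ (γ t).1
  set c₂ := extChartAt I₂ q.2 ∘ fun t ↦ (γ t).2
  have h : deriv (fun t ↦ (c₁ t, c₂ t)) =ᶠ[𝓝 t] fun t ↦ (deriv c₁ t, deriv c₂ t) := by
    filter_upwards [h₁.eventually (by simp), h₂.eventually (by simp)] with s hs₁ hs₂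
    exact ((hs₁.differentiableAt (by simp)).hasDerivAt.prodMk
      (hs₂.differentiableAt (by simp)).hasDerivAt).deriv
  refine ⟨h.eq_of_nhds, ?_⟩
  rw [h.deriv_eq]
  exact (((h₁.derivWithin (m := 1) one_add_one_eq_two.le).differentiableAt
    (by simp)).hasDerivAt.prodMk ((h₂.derivWithin (m := 1) one_add_one_eq_two.le).differentiableAt
    (by simp)).hasDerivAt).deriv

theorem geodesicEquation_prod_iff {γ : ℝ → M₁ × M₂} {t : ℝ} {q : M₁ × M₂}
    (hγ₁ : ContMDiffAt 𝓘(ℝ, ℝ) I₁ 2 (fun t ↦ (γ t).1) t)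
    (hγ₂ : ContMDiffAt 𝓘(ℝ, ℝ) I₂ 2 (fun t ↦ (γ t).2) t)
    (h₁ : (γ t).1 ∈ (chartAt H₁ q.1).source) (h₂ : (γ t).2 ∈ (chartAt H₂ q.2).source) :
    (cov₁.prod cov₂).GeodesicEquation γ q t ↔
      cov₁.GeodesicEquation (fun t ↦ (γ t).1) q.1 t ∧
        cov₂.GeodesicEquation (fun t ↦ (γ t).2) q.2 t := by
  obtain ⟨d1, d2⟩ := deriv_extChartAt_prod_comp (q := q)
    (hγ₁.contDiffAt_extChartAt (by exact WithTop.coe_le_coe.2 le_top) h₁)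
    (hγ₂.contDiffAt_extChartAt (by exact WithTop.coe_le_coe.2 le_top) h₂)
  rw [GeodesicEquation, d2, d1, christoffel_prod cov₁ cov₂ h₁ h₂]
  exact Prod.ext_iff

variable [FiniteDimensional ℝ E₁] [FiniteDimensional ℝ E₂]

theorem IsGeodesicOn.fst {γ : ℝ → M₁ × M₂} {J : Set ℝ} (h : (cov₁.prod cov₂).IsGeodesicOn γ J) :
    cov₁.IsGeodesicOn (fun t ↦ (γ t).1) J where
  isOpen := h.isOpen
  ordConnected := h.ordConnected
  contMDiffOn := contMDiff_fst.comp_contMDiffOn h.contMDiffOn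
  equation q t ht hq :=
    ((geodesicEquation_prod_iff (q := (q, (γ t).2)) (contMDiffAt_fst.comp t (h.contMDiffAt ht))
      (contMDiffAt_snd.comp t (h.contMDiffAt ht)) hq (mem_chart_source H₂ _)).1
      (h.equation _ t ht ⟨hq, mem_chart_source H₂ _⟩)).1

theorem IsGeodesicOn.snd {γ : ℝ → M₁ × M₂} {J : Set ℝ} (h : (cov₁.prod cov₂).IsGeodesicOn γ J) :
    cov₂.IsGeodesicOn (fun t ↦ (γ t).2) J where
  isOpen := h.isOpen
  ordConnected := h.ordConnected
  contMDiffOn := contMDiff_snd.comp_contMDiffOn h.contMDiffOn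
  equation q t ht hq :=
    ((geodesicEquation_prod_iff (q := ((γ t).1, q)) (contMDiffAt_fst.comp t (h.contMDiffAt ht))
      (contMDiffAt_snd.comp t (h.contMDiffAt ht)) (mem_chart_source H₁ _) hq).1
      (h.equation _ t ht ⟨mem_chart_source H₁ _, hq⟩)).2

theorem IsGeodesicOn.prodMk {γ₁ : ℝ → M₁} {γ₂ : ℝ → M₂} {J : Set ℝ}
    (h₁ : cov₁.IsGeodesicOn γ₁ J) (h₂ : cov₂.IsGeodesicOn γ₂ J) :
    (cov₁.prod cov₂).IsGeodesicOn (fun t ↦ (γ₁ t, γ₂ t)) J where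
  isOpen := h₁.isOpen
  ordConnected := h₁.ordConnected
  contMDiffOn := h₁.contMDiffOn.prodMk h₂.contMDiffOn
  equation _ t ht hq :=
    (geodesicEquation_prod_iff (γ := fun t ↦ (γ₁ t, γ₂ t)) (h₁.contMDiffAt ht) (h₂.contMDiffAt ht)
      hq.1 hq.2).2 ⟨h₁.equation _ t ht hq.1, h₂.equation _ t ht hq.2⟩

end LinearConnection

theorem equivTangentBundleProd_curveLift {γ : ℝ → M₁ × M₂} {t : ℝ}
    (h : MDifferentiableAt 𝓘(ℝ, ℝ) (I₁.prod I₂) γ t) :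
    equivTangentBundleProd I₁ M₁ I₂ M₂ (curveLift (I₁.prod I₂) γ t) =
      (curveLift I₁ (fun t ↦ (γ t).1) t, curveLift I₂ (fun t ↦ (γ t).2) t) := by
  have h1 : mfderiv 𝓘(ℝ, ℝ) (I₁.prod I₂) γ t =
      (mfderiv 𝓘(ℝ, ℝ) I₁ (fun t ↦ (γ t).1) t).prod (mfderiv 𝓘(ℝ, ℝ) I₂ (fun t ↦ (γ t).2) t) :=
    mfderiv_prodMk h.fst h.snd
  have h2 : curveVelocity (I₁.prod I₂) γ t =
      (curveVelocity I₁ (fun t ↦ (γ t).1) t, curveVelocity I₂ (fun t ↦ (γ t).2) t) :=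
    DFunLike.congr_fun h1 (1 : ℝ)
  exact Prod.ext (TotalSpace.ext rfl (heq_of_eq (congrArg Prod.fst h2)))
    (TotalSpace.ext rfl (heq_of_eq (congrArg Prod.snd h2)))

end ProductConnection

section Factors

variable {E : Type*} [NormedAddCommGroup E] [NormedSpace ℝ E]
  {H : Type*} [TopologicalSpace H] {I : ModelWithCorners ℝ E H}
  {M : Type*} [TopologicalSpace M] [ChartedSpace H M] [IsManifold I ∞ M]

/-- Near a point of an open submanifold, the inclusion has a smooth left inverse. -/
theorem exists_contMDiffAt_leftInverse_subtypeVal (U : TopologicalSpace.Opens M) (x : U) :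
    ∃ r : M → U, ContMDiffAt I I ∞ r x.1 ∧ ∀ u : U, r u.1 = u := by
  classical
  let r : M → U := fun y ↦ if h : y ∈ U then ⟨y, h⟩ else x
  refine ⟨r, contMDiffAt_subtypeVal_comp_iff.1 (contMDiffAt_id.congr_of_eventuallyEq ?_),
    fun u ↦ dif_pos u.2⟩
  filter_upwards [U.isOpen.mem_nhds x.2] with y hy
  exact congrArg Subtype.val (dif_pos hy : r y = ⟨y, hy⟩)

theorem isGeodesicOn_const (cov : LinearConnection I M) (y : M) :
    cov.IsGeodesicOn (fun _ ↦ y) univ where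
  isOpen := isOpen_univ
  ordConnected := ordConnected_univ
  contMDiffOn := contMDiffOn_const
  equation q t _ _ := by
    have h : extChartAt I q ∘ (fun _ : ℝ ↦ y) = fun _ ↦ extChartAt I q y := rfl
    rw [h, deriv_const', deriv_const, LinearConnection.christoffel_zero_left, add_zero]

theorem curveLift_const (y : M) (t : ℝ) : curveLift I (fun _ ↦ y) t = ⟨y, 0⟩ := by
  have h : curveVelocity I (fun _ ↦ y) t = 0 := by
    rw [curveVelocity, mfderiv_const]
    rfl
  exact TotalSpace.ext rfl (heq_of_eq h)

theorem LinearConnection.IsGeodesicOn.mono {cov : LinearConnection I M} {γ : ℝ → M} {J J' : Set ℝ}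
    (h : cov.IsGeodesicOn γ J) (hJ : J' ⊆ J) (ho : IsOpen J') (hc : J'.OrdConnected) :
    cov.IsGeodesicOn γ J' :=
  ⟨ho, hc, h.contMDiffOn.mono hJ, fun q t ht ↦ h.equation q t (hJ ht)⟩

/-- Scalar multiplication on the total space of the tangent bundle. -/
def tangentSMul (c : ℝ) (v : TangentBundle I M) : TangentBundle I M := ⟨v.proj, c • v.2⟩

theorem mem_reducedTangentBundle_iff {v : TangentBundle I M} :
    v ∈ ReducedTangentBundle I M ↔ tangentSMul 0 v ≠ v := by
  refine not_congr ⟨fun h ↦ ?_, fun h ↦ ?_⟩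
  · exact TotalSpace.ext rfl (heq_of_eq ((zero_smul ℝ v.2).trans h.symm))
  · obtain ⟨x, v⟩ := v
    have h1 : (0 : ℝ) • v = v := eq_of_heq (TotalSpace.mk.inj h).2
    exact h1.symm.trans (zero_smul ℝ v)

theorem tangentSMul_zero_vector (c : ℝ) (y : M) :
    tangentSMul c (⟨y, 0⟩ : TangentBundle I M) = ⟨y, 0⟩ :=
  congrArg (fun z ↦ (⟨y, z⟩ : TangentBundle I M)) (smul_zero c)

theorem Proportional.symm {v w : ReducedTangentBundle I M} (h : Proportional v w) :
    Proportional w v := by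
  obtain ⟨c, hc, hw⟩ := h
  refine ⟨c⁻¹, inv_ne_zero hc, ?_⟩
  rw [hw]
  simp only [smul_smul, inv_mul_cancel₀ hc, one_smul]

variable {E₂ : Type*} [NormedAddCommGroup E₂] [NormedSpace ℝ E₂]
  {H₂ : Type*} [TopologicalSpace H₂] {I₂ : ModelWithCorners ℝ E₂ H₂}
  {M₂ : Type*} [TopologicalSpace M₂] [ChartedSpace H₂ M₂] [IsManifold I₂ ∞ M₂]
  {E' : Type*} [NormedAddCommGroup E'] [NormedSpace ℝ E']
  {H' : Type*} [TopologicalSpace H'] {I' : ModelWithCorners ℝ E' H'}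
  {M' : Type*} [TopologicalSpace M'] [ChartedSpace H' M'] [IsManifold I' ∞ M']

/-- A diffeomorphism `e` of `TM'` with `TM × TM₂` which is homogeneous on the fibers and for which
the geodesics of `M'` are the pairs of geodesics of `M` and `M₂`. -/
structure LinearConnection.IsProductDecomposition (cov : LinearConnection I M)
    (cov₂ : LinearConnection I₂ M₂) (cov' : LinearConnection I' M')
    (e : TangentBundle I' M' ≃ TangentBundle I M × TangentBundle I₂ M₂) : Prop where
  contMDiff : ContMDiff I'.tangent (I.tangent.prod I₂.tangent) ∞ e
  contMDiff_symm : ContMDiff (I.tangent.prod I₂.tangent) I'.tangent ∞ e.symm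
  map_smul : ∀ c v, e (tangentSMul c v) = (tangentSMul c (e v).1, tangentSMul c (e v).2)
  exists_components : ∀ γ J, cov'.IsGeodesicOn γ J → ∃ γ₁ γ₂, cov.IsGeodesicOn γ₁ J ∧
    cov₂.IsGeodesicOn γ₂ J ∧ ∀ t ∈ J, e (curveLift I' γ t) = (curveLift I γ₁ t, curveLift I₂ γ₂ t)
  exists_pair : ∀ γ₁ γ₂ J, cov.IsGeodesicOn γ₁ J → cov₂.IsGeodesicOn γ₂ J →
    ∃ γ, cov'.IsGeodesicOn γ J ∧
      ∀ t ∈ J, e (curveLift I' γ t) = (curveLift I γ₁ t, curveLift I₂ γ₂ t)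

namespace LinearConnection.IsProductDecomposition

variable {cov : LinearConnection I M} {cov₂ : LinearConnection I₂ M₂}
  {cov' : LinearConnection I' M'} {e : TangentBundle I' M' ≃ TangentBundle I M × TangentBundle I₂ M₂}

theorem mem_iff (h : IsProductDecomposition cov cov₂ cov' e) {x : TangentBundle I' M'} {y : M₂}
    (hx : (e x).2 = ⟨y, 0⟩) :
    x ∈ ReducedTangentBundle I' M' ↔ (e x).1 ∈ ReducedTangentBundle I M := by
  rw [mem_reducedTangentBundle_iff, mem_reducedTangentBundle_iff, ← e.injective.ne_iff, h.map_smul,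
    Ne, Ne, Prod.ext_iff, hx]
  simp only [tangentSMul_zero_vector, and_true]

/-- The inclusion of one factor, in the tangent spaces along the zero vector at a point of the
other factor. -/
def slice (h : IsProductDecomposition cov cov₂ cov' e) (y : M₂) (v : ReducedTangentBundle I M) :
    ReducedTangentBundle I' M' :=
  ⟨e.symm (v.1, ⟨y, 0⟩), (h.mem_iff (y := y) (by rw [e.apply_symm_apply])).2
    (by rw [e.apply_symm_apply]; exact v.2)⟩

theorem apply_slice (h : IsProductDecomposition cov cov₂ cov' e) (y : M₂)
    (v : ReducedTangentBundle I M) : e (h.slice y v).1 = (v.1, ⟨y, 0⟩) :=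
  e.apply_symm_apply _

theorem exists_slice_eq (h : IsProductDecomposition cov cov₂ cov' e) {y : M₂}
    {x : ReducedTangentBundle I' M'} (hx : (e x.1).2 = ⟨y, 0⟩) :
    ∃ hv : (e x.1).1 ∈ ReducedTangentBundle I M, h.slice y ⟨(e x.1).1, hv⟩ = x := by
  refine ⟨(h.mem_iff hx).1 x.2, Subtype.ext (e.injective ?_)⟩
  rw [h.apply_slice, ← hx]

theorem contMDiff_slice (h : IsProductDecomposition cov cov₂ cov' e) (y : M₂) :
    ContMDiff I.tangent I'.tangent ∞ (h.slice y) := fun _ ↦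
  contMDiffAt_subtypeVal_comp_iff.1 ((h.contMDiff_symm.comp
    (contMDiff_subtype_val.prodMk contMDiff_const)).contMDiffAt)

theorem isClosedEmbedding_slice [T2Space M₂] (h : IsProductDecomposition cov cov₂ cov' e) (y : M₂) :
    Topology.IsClosedEmbedding (h.slice y) := by
  have hρ : Continuous fun x : ReducedTangentBundle I' M' ↦ (e x.1).1 :=
    continuous_fst.comp (h.contMDiff.continuous.comp continuous_subtype_val)
  have hσ : Continuous fun x : ReducedTangentBundle I' M' ↦ (e x.1).2 :=
    continuous_snd.comp (h.contMDiff.continuous.comp continuous_subtype_val)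
  refine ⟨.of_comp (h.contMDiff_slice y).continuous hρ ?_, ?_⟩
  · refine (congrArg Topology.IsEmbedding (funext fun v ↦ ?_)).mp Topology.IsEmbedding.subtypeVal
    exact (congrArg Prod.fst (h.apply_slice y v)).symm
  · have := t2Space_tangentBundle (I := I₂) (M := M₂)
    have h1 : range (h.slice y) =
        (fun x : ReducedTangentBundle I' M' ↦ (e x.1).2) ⁻¹' {⟨y, 0⟩} := by
      ext x
      constructor
      · rintro ⟨v, rfl⟩
        exact congrArg Prod.snd (h.apply_slice y v)
      · intro hx
        obtain ⟨hv, hx'⟩ := h.exists_slice_eq hx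
        exact ⟨_, hx'⟩
    rw [h1]
    exact isClosed_singleton.preimage hσ

theorem injective_mfderiv_slice (h : IsProductDecomposition cov cov₂ cov' e) (y : M₂)
    (v : ReducedTangentBundle I M) :
    Function.Injective (mfderiv I.tangent I'.tangent (h.slice y) v) := by
  obtain ⟨r, hr, hrv⟩ := exists_contMDiffAt_leftInverse_subtypeVal (I := I.tangent)
    (ReducedTangentBundle I M) v
  let s : ReducedTangentBundle I' M' → ReducedTangentBundle I M := fun x ↦ r (e x.1).1
  have hes : (e (h.slice y v).1).1 = v.1 := congrArg Prod.fst (h.apply_slice y v)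
  have hs : MDifferentiableAt I'.tangent I.tangent s (h.slice y v) := by
    refine ContMDiffAt.mdifferentiableAt (n := ∞) ?_ (by simp)
    refine ContMDiffAt.comp (g := r) (h.slice y v) (hes ▸ hr) ?_
    exact (contMDiff_fst.comp (h.contMDiff.comp contMDiff_subtype_val)).contMDiffAt
  have hid : s ∘ h.slice y = id := funext fun w ↦
    (congrArg (fun z ↦ r (Prod.fst z)) (h.apply_slice y w)).trans (hrv w)
  have h1 := mfderiv_comp v hs ((h.contMDiff_slice y).mdifferentiable (by simp) v)
  rw [hid, mfderiv_id] at h1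
  exact Function.LeftInverse.injective (g := mfderiv I'.tangent I.tangent s (h.slice y v))
    fun u ↦ (DFunLike.congr_fun h1 u).symm

variable [FiniteDimensional ℝ E] [I.Boundaryless] [FiniteDimensional ℝ E₂] [I₂.Boundaryless]
  [T2Space M₂] [cov₂.ContMDiffCovariantDerivative ∞]

/-- The geodesics of a product through a slice stay in the slice. -/
theorem exists_of_toGeodesic_eq_slice (h : IsProductDecomposition cov cov₂ cov' e) (y : M₂)
    (v : ReducedTangentBundle I M) (x : ReducedTangentBundle I' M')
    (hx : cov'.toGeodesic x = cov'.toGeodesic (h.slice y v)) :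
    ∃ w, h.slice y w = x ∧ cov.toGeodesic w = cov.toGeodesic v := by
  let P : ReducedTangentBundle I' M' → Set cov.GeodesicSpace := fun x ↦
    {a | ∃ w, h.slice y w = x ∧ cov.toGeodesic w = a}
  have hP1 : ∀ x x', Proportional x x' → P x ⊆ P x' := by
    rintro x x' ⟨c, hc, hxx'⟩ _ ⟨w, rfl, rfl⟩
    replace hxx' : x'.1 = tangentSMul c (h.slice y w).1 := hxx'
    have he : e x'.1 = (tangentSMul c w.1, ⟨y, 0⟩) := by
      rw [hxx', h.map_smul, h.apply_slice, tangentSMul_zero_vector]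
    obtain ⟨hv, hx'⟩ := h.exists_slice_eq (congrArg Prod.snd he)
    exact ⟨_, hx', (toGeodesic_eq_of_proportional ⟨c, hc, congrArg Prod.fst he⟩).symm⟩
  have hP2 : ∀ (γ : ℝ → M') (J : Set ℝ), cov'.IsGeodesicOn γ J → ∀ s ∈ J, ∀ t ∈ J,
      ∀ (hs : curveVelocity I' γ s ≠ 0) (ht : curveVelocity I' γ t ≠ 0),
        P ⟨curveLift I' γ s, hs⟩ ⊆ P ⟨curveLift I' γ t, ht⟩ := by
    rintro γ J hγ s hsJ t htJ hs ht _ ⟨w, hw, rfl⟩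
    obtain ⟨γ₁, γ₂, hγ₁, hγ₂, hγe⟩ := h.exists_components γ J hγ
    have h1 : (w.1, (⟨y, 0⟩ : TangentBundle I₂ M₂)) = (curveLift I γ₁ s, curveLift I₂ γ₂ s) := by
      rw [← hγe s hsJ, ← h.apply_slice y w, hw]
    have h2 : curveLift I₂ γ₂ t = ⟨y, 0⟩ := by
      rw [← curveLift_const y t]
      exact hγ₂.eqOn_curveLift (isGeodesicOn_const cov₂ y) hsJ (mem_univ s)
        ((congrArg Prod.snd h1).symm.trans (curveLift_const y s).symm) ⟨htJ, mem_univ t⟩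
    have h3 := hγe t htJ
    rw [h2] at h3
    obtain ⟨hv, hx'⟩ := h.exists_slice_eq (x := ⟨curveLift I' γ t, ht⟩) (congrArg Prod.snd h3)
    have h4 : curveVelocity I γ₁ s ≠ 0 := by
      have h5 : curveLift I γ₁ s ∈ ReducedTangentBundle I M := by
        rw [← show w.1 = curveLift I γ₁ s from congrArg Prod.fst h1]
        exact w.2
      exact h5
    have h6 : curveVelocity I γ₁ t ≠ 0 := by
      have h5 : curveLift I γ₁ t ∈ ReducedTangentBundle I M := by
        rw [← show (e (curveLift I' γ t)).1 = curveLift I γ₁ t from congrArg Prod.fst h3]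
        exact hv
      exact h5
    refine ⟨_, hx', ?_⟩
    have h7 : (⟨(e (curveLift I' γ t)).1, hv⟩ : ReducedTangentBundle I M) =
        ⟨curveLift I γ₁ t, h6⟩ := Subtype.ext (congrArg Prod.fst h3)
    have h8 : w = ⟨curveLift I γ₁ s, h4⟩ := Subtype.ext (congrArg Prod.fst h1)
    rw [h7, h8]
    exact hγ₁.toGeodesic_eq htJ hsJ h6 h4
  obtain ⟨g, hg⟩ := exists_comp_toGeodesic_eq (cov := cov') (P := P)
    (fun x x' hxx' ↦ (hP1 x x' hxx').antisymm (hP1 x' x hxx'.symm))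
    fun γ J hγ s hsJ t htJ hs ht ↦
      (hP2 γ J hγ s hsJ t htJ hs ht).antisymm (hP2 γ J hγ t htJ s hsJ ht hs)
  have hPx : cov.toGeodesic v ∈ P x := by
    rw [← hg, hx, hg]
    exact ⟨v, rfl, rfl⟩
  exact hPx

theorem geodesicEmbedding [T2Space M] (h : IsProductDecomposition cov cov₂ cov' e) (y : M₂) :
    cov.GeodesicEmbedding cov' (h.slice y) where
  contMDiff := h.contMDiff_slice y
  isClosedEmbedding := h.isClosedEmbedding_slice y
  injective_mfderiv := h.injective_mfderiv_slice y
  toGeodesic_eq v w hvw := by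
    have h₁ : ∀ v w : ReducedTangentBundle I M, Proportional v w →
        cov'.toGeodesic (h.slice y v) = cov'.toGeodesic (h.slice y w) := by
      rintro v w ⟨c, hc, hw⟩
      refine toGeodesic_eq_of_proportional ⟨c, hc, e.injective ?_⟩
      refine (h.apply_slice y w).trans (Eq.trans ?_ (h.map_smul c (h.slice y v).1).symm)
      rw [h.apply_slice, tangentSMul_zero_vector]
      exact Prod.ext hw rfl
    have h₂ : ∀ (γ : ℝ → M) (J : Set ℝ), cov.IsGeodesicOn γ J → ∀ s ∈ J, ∀ t ∈ J,
        ∀ (hs : curveVelocity I γ s ≠ 0) (ht : curveVelocity I γ t ≠ 0),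
          cov'.toGeodesic (h.slice y ⟨curveLift I γ s, hs⟩) =
            cov'.toGeodesic (h.slice y ⟨curveLift I γ t, ht⟩) := by
      intro γ J hγ s hsJ t htJ hs ht
      obtain ⟨η, hη, hηe⟩ := h.exists_pair γ (fun _ ↦ y) J hγ
        ((isGeodesicOn_const cov₂ y).mono (subset_univ J) hγ.isOpen hγ.ordConnected)
      have h1 : ∀ r ∈ J, ∀ hr : curveVelocity I γ r ≠ 0,
          (h.slice y ⟨curveLift I γ r, hr⟩).1 = curveLift I' η r := fun r hrJ hr ↦ by
        refine e.injective ((h.apply_slice y _).trans ?_)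
        rw [hηe r hrJ, curveLift_const]
      have h2 : ∀ r ∈ J, curveVelocity I γ r ≠ 0 → curveVelocity I' η r ≠ 0 := fun r hrJ hr ↦ by
        have h3 : curveLift I' η r ∈ ReducedTangentBundle I' M' :=
          h1 r hrJ hr ▸ (h.slice y ⟨curveLift I γ r, hr⟩).2
        exact h3
      have h3 : ∀ r (hrJ : r ∈ J) (hr : curveVelocity I γ r ≠ 0),
          h.slice y ⟨curveLift I γ r, hr⟩ = ⟨curveLift I' η r, h2 r hrJ hr⟩ := fun r hrJ hr ↦
        Subtype.ext (h1 r hrJ hr)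
      rw [h3 s hsJ hs, h3 t htJ ht]
      exact hη.toGeodesic_eq hsJ htJ _ _
    obtain ⟨g, hg⟩ := exists_comp_toGeodesic_eq h₁ h₂
    rw [← hg, hvw, hg]
  exists_of_toGeodesic_eq := h.exists_of_toGeodesic_eq_slice y

end LinearConnection.IsProductDecomposition

variable [FiniteDimensional ℝ E] [I.Boundaryless] [FiniteDimensional ℝ E₂] [I₂.Boundaryless]

namespace LinearConnection

theorem isProductDecomposition_prod (cov : LinearConnection I M) (cov₂ : LinearConnection I₂ M₂) :
    IsProductDecomposition cov cov₂ (cov.prod cov₂) (equivTangentBundleProd I M I₂ M₂) where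
  contMDiff := contMDiff_equivTangentBundleProd
  contMDiff_symm := contMDiff_equivTangentBundleProd_symm
  map_smul _ _ := rfl
  exists_components _ _ h := ⟨_, _, h.fst, h.snd, fun _ ht ↦
    equivTangentBundleProd_curveLift (h.mdifferentiableAt ht)⟩
  exists_pair _ _ _ h₁ h₂ := ⟨_, h₁.prodMk h₂, fun _ ht ↦
    equivTangentBundleProd_curveLift ((h₁.prodMk h₂).mdifferentiableAt ht)⟩

theorem IsProductDecomposition.swap {cov : LinearConnection I M} {cov₂ : LinearConnection I₂ M₂}
    {cov' : LinearConnection I' M'}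
    {e : TangentBundle I' M' ≃ TangentBundle I M × TangentBundle I₂ M₂}
    (h : IsProductDecomposition cov cov₂ cov' e) :
    IsProductDecomposition cov₂ cov cov' (e.trans (Equiv.prodComm _ _)) where
  contMDiff := (contMDiff_snd.prodMk contMDiff_fst).comp h.contMDiff
  contMDiff_symm := h.contMDiff_symm.comp (contMDiff_snd.prodMk contMDiff_fst)
  map_smul c v := congrArg Prod.swap (h.map_smul c v)
  exists_components γ J hγ := by
    obtain ⟨γ₁, γ₂, h₁, h₂, he⟩ := h.exists_components γ J hγ
    exact ⟨γ₂, γ₁, h₂, h₁, fun t ht ↦ congrArg Prod.swap (he t ht)⟩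
  exists_pair γ₁ γ₂ J h₁ h₂ := by
    obtain ⟨γ, hγ, he⟩ := h.exists_pair γ₂ γ₁ J h₂ h₁
    exact ⟨γ, hγ, fun t ht ↦ congrArg Prod.swap (he t ht)⟩

end LinearConnection

end Factors

end

theorem mainTheorem12
    {E₁ : Type*} [NormedAddCommGroup E₁] [NormedSpace ℝ E₁] [FiniteDimensional ℝ E₁]
    {M₁ : Type*} [TopologicalSpace M₁] [ChartedSpace E₁ M₁] [IsManifold 𝓘(ℝ, E₁) ∞ M₁]
    [T2Space M₁] [ParacompactSpace M₁] [ConnectedSpace M₁]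
    {E₂ : Type*} [NormedAddCommGroup E₂] [NormedSpace ℝ E₂] [FiniteDimensional ℝ E₂]
    {M₂ : Type*} [TopologicalSpace M₂] [ChartedSpace E₂ M₂] [IsManifold 𝓘(ℝ, E₂) ∞ M₂]
    [T2Space M₂] [ParacompactSpace M₂] [ConnectedSpace M₂]
    (cov₁ : LinearConnection 𝓘(ℝ, E₁) M₁) [cov₁.ContMDiffCovariantDerivative ∞]
    (cov₂ : LinearConnection 𝓘(ℝ, E₂) M₂) [cov₂.ContMDiffCovariantDerivative ∞]
    (h : (cov₁.prod cov₂).GeodesicSpaceLocallyEuclidean) :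
    cov₁.GeodesicSpaceLocallyEuclidean ∧ cov₂.GeodesicSpaceLocallyEuclidean ∧
      (ParacompactSpace (cov₁.prod cov₂).GeodesicSpace →
        ParacompactSpace cov₁.GeodesicSpace ∧ ParacompactSpace cov₂.GeodesicSpace) := by
  obtain ⟨y₁⟩ := (inferInstance : Nonempty M₁)
  obtain ⟨y₂⟩ := (inferInstance : Nonempty M₂)
  have hd := LinearConnection.isProductDecomposition_prod cov₁ cov₂
  have h₁ := hd.geodesicEmbedding y₂
  have h₂ := hd.swap.geodesicEmbedding y₁
  exact ⟨h₁.geodesicSpaceLocallyEuclidean h, h₂.geodesicSpaceLocallyEuclidean h,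
    fun _ ↦ ⟨h₁.paracompactSpace, h₂.paracompactSpace⟩⟩
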